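/- **Setting.** Let $j\in\{1,\dots,d-2\}$ (so $d\ge 3$). Let $\mathcal K$ be the space of convex bodies (non-empty compact convex sets) in $\mathbb R^d$ with the Hausdorff metric, and $\mathcal P\subset\mathcal K$ the set of convex polytopes. A real functional $\varphi$ on $\mathcal P$ (or $\mathcal K$) is a *valuation* if $\varphi(K\cup M)+\varphi(K\cap M)=\varphi(K)+\varphi(M)$ whenever $K,M,K\cup M$ lie in $\mathcal P$ (resp. $\mathcal K$). For a polytope $P$, $\mathcal F_j(P)$ is the set of its $j$-faces; for $F\in\mathcal F_j(P)$, $V_j(F)$ is the $j$-dimensional volume of $F$, $n(P,F)$ is the set of unit vectors in the normal cone of $P$ at $F$, and $F^\perp$ is the $(d-j)$-dimensional linear subspace orthogonal to $F$. $\mathcal H^s$ is the $s$-dimensional Hausdorff measure. Let $$F(d,d-j)=\{(u,L): u\in S^{d-1},\ L\subset\mathbb R^d \text{ a linear subspace},\ \dim L=d-j,\ u\in L\}$$ be the flag manifold with its usual compact topology. For $u\in S^{d-1}$ let $\nu^{\langle u\rangle}$ be the unique probability measure on the set $G(\langle u\rangle,d-j)$ of $(d-j)$-dimensional linear subspaces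 containing $u$ that is invariant under the proper rotations fixing $u$. For $(d-j)$-dimensional subspaces $L,M$ let $|\langle L,M\rangle|$ be the absolute determinant of the orthogonal projection from $L$ to $M$. For continuous $g$ on $F(d,d-j)$ put $$(T_jg)(u,L)=\int_{G(\langle u\rangle,d-j)}|\langle L,M\rangle|^2\,g(u,M)\,\nu^{\langle u\rangle}(dM).$$ A spherical polytope is the intersection of $S^{d-1}$ with a polyhedral cone; its dimension is the dimension of its linear span $\langle p\rangle$ minus one. An *associated function* of $\varphi:\mathcal P\to\mathbb R$ is an additive functional $f$ on the spherical polytopes of dimension at most $d-1-j$, vanishing on those of smaller dimension, with $\varphi(P)=\sum_{F\in\mathcal F_j(P)}f(n(P,F))\,V_j(F)$ for all $P\in\mathcal P$. The functional $\varphi$ is *strongly flag-continuous, with the function $\tilde g$*, if $\tilde g$ is continuous on $F(d,d-j)$ and $\varphi$ has an associated function $f$ such that $$f(p)=\int_p (T_j\tilde g)(u,\langle p\rangle)\,\mathcal H^{d-1-j}(du)\ \text{ if }\dim p=d-1-j,\qquad f(p)=0\ \text{ if }\dim p<d-1-j .$$ The *flag measure* of a polytope $P$ is the measure on $F(d,d-j)$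 $$\psi_j(P,\cdot)=\sum_{F\in\mathcal F_j(P)}V_j(F)\int_{n(P,F)}\int_{G(\langle u\rangle,d-j)}|\langle L,F^\perp\rangle|^2\,\mathbf 1\{(u,L)\in\cdot\}\,\nu^{\langle u\rangle}(dL)\,\mathcal H^{d-1-j}(du).$$ **Theorem 4.1.** Let $1\le j\le d-2$ and let $\varphi$ be a $j$-homogeneous, translation invariant valuation on $\mathcal P$ that is strongly flag-continuous with the function $\tilde g$. Then $\varphi$ has a unique extension to a functional on $\mathcal K$ that is continuous in the Hausdorff metric. This extension is a translation invariant valuation on $\mathcal K$. Moreover, $P\mapsto\psi_j(P,\cdot)$ has a unique extension $K\mapsto\psi_j(K,\cdot)$ from $\mathcal P$ to a map from $\mathcal K$ to the finite Borel measures on $F(d,d-j)$ that is continuous from the Hausdorff metric to the weak topology, and the extension of $\varphi$ is given by $$\varphi(K)=\int_{F(d,d-j)}\tilde g(u,L)\,\psi_j(K,d(u,L)),\qquad K\in\mathcal K .$$ -/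

import Mathlib

open MeasureTheory
open scoped Pointwise

noncomputable section

namespace FlagVal

/-- Euclidean space of dimension `d`. Its convex bodies are `ConvexBody (E d)`, whose topology is
the one of the Hausdorff metric. -/
abbrev E (d : ℕ) : Type := EuclideanSpace ℝ (Fin d)

/-! ### Functionals on classes of convex bodies -/

/-- The convex polytopes: convex hulls of finite sets (non-empty, as every `ConvexBody`). -/
def polytopes (d : ℕ) : Set (ConvexBody (E d)) :=
  {K | ∃ s : Finset (E d), (K : Set (E d)) = convexHull ℝ (s : Set (E d))}

/-- `φ (K ∪ M) + φ (K ∩ M) = φ K + φ M` whenever the bodies involved lie in the class `𝒞`. -/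
def IsValuationOn {d : ℕ} (𝒞 : Set (ConvexBody (E d))) (φ : 𝒞 → ℝ) : Prop :=
  ∀ K M U I : 𝒞, (U.1 : Set (E d)) = (K.1 : Set (E d)) ∪ (M.1 : Set (E d)) →
    (I.1 : Set (E d)) = (K.1 : Set (E d)) ∩ (M.1 : Set (E d)) → φ U + φ I = φ K + φ M

def IsTranslationInvariantOn {d : ℕ} (𝒞 : Set (ConvexBody (E d))) (φ : 𝒞 → ℝ) : Prop :=
  ∀ (K M : 𝒞) (x : E d), (M.1 : Set (E d)) = x +ᵥ (K.1 : Set (E d)) → φ M = φ K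

def IsHomogeneousOn {d : ℕ} (j : ℕ) (𝒞 : Set (ConvexBody (E d))) (φ : 𝒞 → ℝ) : Prop :=
  ∀ (K M : 𝒞) (r : ℝ), 0 < r → (M.1 : Set (E d)) = r • (K.1 : Set (E d)) → φ M = r ^ j * φ K

/-- `Φ` is an extension of `φ` from polytopes to convex bodies, continuous in the Hausdorff
metric. -/
def IsContinuousExtension {d : ℕ} (φ : polytopes d → ℝ) (Φ : ConvexBody (E d) → ℝ) : Prop :=
  Continuous Φ ∧ ∀ P : polytopes d, Φ P.1 = φ P

/-! ### Faces, normal cones and spherical polytopes -/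

/-- The `j`-dimensional faces of `P` (intersections of `P` with supporting hyperplanes, and `P`
itself). -/
def faces {d : ℕ} (j : ℕ) (P : Set (E d)) : Set (Set (E d)) :=
  {F | F.Nonempty ∧ IsExposed ℝ P F ∧ Module.finrank ℝ (vectorSpan ℝ F) = j}

/-- The spherical image `n(P, F)`: the unit vectors of the normal cone of `P` at the face `F`. -/
def sphericalNormals {d : ℕ} (P F : Set (E d)) : Set (E d) :=
  {u | ‖u‖ = 1 ∧ ∀ x ∈ F, ∀ y ∈ P, inner ℝ u (y - x) ≤ 0}

/-- The `j`-th intrinsic volume of a `j`-dimensional polytope `F`, that is, its `j`-dimensional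
volume. Here `μHE[j]` is the `j`-dimensional Hausdorff measure with the usual normalization. -/
def faceVolume {d : ℕ} (j : ℕ) (F : Set (E d)) : ℝ := (μHE[j] F).toReal

/-- `p` is a spherical polytope of dimension at most `k`: the intersection of the unit sphere with
a polyhedral cone (a finite intersection of closed half-spaces with `0` on the boundary), whose
linear span has dimension at most `k + 1`. -/
def IsSphericalPolytope {d : ℕ} (k : ℕ) (p : Set (E d)) : Prop :=
  (∃ s : Finset (E d), p = {u | ‖u‖ = 1 ∧ ∀ a ∈ s, inner ℝ a u ≤ 0}) ∧
    Module.finrank ℝ (Submodule.span ℝ p) ≤ k + 1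

/-- `f` is an associated function of `φ` in degree `j`: a simple, additive functional on the
spherical polytopes of dimension at most `d - 1 - j` such that
`φ P = ∑_F f (n(P, F)) V_j(F)`, the sum being over the `j`-faces `F` of `P`.
(The values of `f` on other sets are irrelevant.) -/
structure IsAssociatedFunction {d : ℕ} (j : ℕ) (φ : polytopes d → ℝ) (f : Set (E d) → ℝ) :
    Prop where
  simple : ∀ p, IsSphericalPolytope (d - 1 - j) p →
    Module.finrank ℝ (Submodule.span ℝ p) < d - j → f p = 0
  additive : ∀ p q, IsSphericalPolytope (d - 1 - j) p → IsSphericalPolytope (d - 1 - j) q →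
    IsSphericalPolytope (d - 1 - j) (p ∪ q) → f (p ∪ q) + f (p ∩ q) = f p + f q
  eq_sum : ∀ P : polytopes d, φ P =
    ∑ᶠ F ∈ faces j (P.1 : Set (E d)), f (sphericalNormals (P.1 : Set (E d)) F) * faceVolume j F

/-! ### The flag manifold -/

/-- The flag manifold `F(d, q)`: pairs of a unit vector `u` and a `q`-dimensional linear subspace
`L` that contains `u`. -/
@[ext]
structure FlagManifold (d q : ℕ) where
  u : E d
  L : Submodule ℝ (E d)
  norm_u : ‖u‖ = 1
  finrank_L : Module.finrank ℝ L = q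
  mem : u ∈ L

/-- The usual topology: a subspace is identified with the orthogonal projection onto it. -/
instance (d q : ℕ) : TopologicalSpace (FlagManifold d q) :=
  TopologicalSpace.induced
    (fun x => ((x.u, x.L.starProjection) : E d × (E d →L[ℝ] E d))) inferInstance

instance (d q : ℕ) : MeasurableSpace (FlagManifold d q) := borel _

instance (d q : ℕ) : BorelSpace (FlagManifold d q) := ⟨rfl⟩

open Classical in
/-- The value `h (u, L)` of a function `h` on the flag manifold, for a pair `(u, L)` that is not
bundled as a flag; it is `0` if `(u, L)` is not a flag. -/
def FlagManifold.eval {d q : ℕ} {α : Type*} [Zero α] (h : FlagManifold d q → α)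
    (u : E d) (L : Submodule ℝ (E d)) : α :=
  if hx : ‖u‖ = 1 ∧ Module.finrank ℝ L = q ∧ u ∈ L then h ⟨u, L, hx.1, hx.2.1, hx.2.2⟩ else 0

/-- An orthonormal basis of the subspace of a flag. -/
def FlagManifold.basis {d q : ℕ} (x : FlagManifold d q) : OrthonormalBasis (Fin q) ℝ x.L :=
  (stdOrthonormalBasis ℝ x.L).reindex (finCongr x.finrank_L)

/-- `|⟨L, M⟩|` for the subspaces `L`, `M` of two flags: the absolute value of the determinant of
the orthogonal projection from `L` to `M`, with respect to orthonormal bases of `L` and `M`. -/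
def absDet {d q : ℕ} (x y : FlagManifold d q) : ℝ :=
  |(LinearMap.toMatrix x.basis.toBasis y.basis.toBasis
    (y.L.orthogonalProjectionOnto ∘L x.L.subtypeL : x.L →L[ℝ] y.L).toLinearMap).det|

/-! ### Invariant measures on the fibres -/

instance (d : ℕ) : ContinuousStar (E d →L[ℝ] E d) :=
  ⟨(ContinuousLinearMap.adjoint (𝕜 := ℝ) (E := E d) (F := E d)).continuous⟩

/-- `SO(u)`: the proper rotations of `E d` that fix `u`. -/
def rotationsFixing {d : ℕ} (u : E d) : Subgroup (unitary (E d →L[ℝ] E d)) where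
  carrier := {ρ | (ρ : E d →L[ℝ] E d).det = 1 ∧ (ρ : E d →L[ℝ] E d) u = u}
  mul_mem' := by
    rintro a b ⟨ha, hau⟩ ⟨hb, hbu⟩
    refine ⟨?_, ?_⟩
    · have : LinearMap.det ((a : E d →L[ℝ] E d).toLinearMap ∘ₗ (b : E d →L[ℝ] E d).toLinearMap)
          = 1 := by
        rw [LinearMap.det_comp]
        change (a : E d →L[ℝ] E d).det * (b : E d →L[ℝ] E d).det = 1
        rw [ha, hb, one_mul]
      exact this
    · change (a : E d →L[ℝ] E d) ((b : E d →L[ℝ] E d) u) = u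
      rw [hbu, hau]
  one_mem' := ⟨LinearMap.det_id, rfl⟩
  inv_mem' := by
    rintro a ⟨ha, hau⟩
    have h1 : ((a⁻¹ : unitary (E d →L[ℝ] E d)) : E d →L[ℝ] E d) * (a : E d →L[ℝ] E d) = 1 := by
      rw [← Submonoid.coe_mul, inv_mul_cancel]; rfl
    refine ⟨?_, ?_⟩
    · have h2 : LinearMap.det (((a⁻¹ : unitary (E d →L[ℝ] E d)) : E d →L[ℝ] E d).toLinearMap ∘ₗ
          (a : E d →L[ℝ] E d).toLinearMap) = 1 := by
        have := congrArg ContinuousLinearMap.toLinearMap h1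
        exact (congrArg LinearMap.det this).trans LinearMap.det_id
      rw [LinearMap.det_comp] at h2
      change _ * (a : E d →L[ℝ] E d).det = 1 at h2
      rw [ha, mul_one] at h2
      exact h2
    · have := congrArg (fun T : E d →L[ℝ] E d => T u) h1
      change ((a⁻¹ : unitary (E d →L[ℝ] E d)) : E d →L[ℝ] E d) ((a : E d →L[ℝ] E d) u) = u at this
      rwa [hau] at this

theorem unitary_norm_map {d : ℕ} (ρ : unitary (E d →L[ℝ] E d)) (v : E d) :
    ‖(ρ : E d →L[ℝ] E d) v‖ = ‖v‖ :=
  (Unitary.linearIsometryEquiv ρ).norm_map v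

instance {d : ℕ} (u : E d) : CompactSpace (rotationsFixing u) := by
  have hemb : Topology.IsClosedEmbedding
      (fun ρ : rotationsFixing u => ((ρ : unitary (E d →L[ℝ] E d)) : E d →L[ℝ] E d)) := by
    refine Topology.IsClosedEmbedding.comp (isClosed_unitary.isClosedEmbedding_subtypeVal)
      (Topology.IsClosedEmbedding.subtypeVal ?_)
    have h1 : Continuous fun ρ : unitary (E d →L[ℝ] E d) => (ρ : E d →L[ℝ] E d).det :=
      ContinuousLinearMap.continuous_det.comp continuous_subtype_val
    have h2 : Continuous fun ρ : unitary (E d →L[ℝ] E d) => (ρ : E d →L[ℝ] E d) u :=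
      (ContinuousLinearMap.apply ℝ (E d) u).continuous.comp continuous_subtype_val
    exact (isClosed_eq h1 continuous_const).inter (isClosed_eq h2 continuous_const)
  rw [← isCompact_univ_iff, hemb.isCompact_iff]
  refine Metric.isCompact_of_isClosed_isBounded
    (hemb.isClosedMap _ isClosed_univ) ?_
  refine (Metric.isBounded_closedBall (x := (0 : E d →L[ℝ] E d)) (r := 1)).subset ?_
  rintro _ ⟨ρ, -, rfl⟩
  rw [mem_closedBall_zero_iff]
  exact ContinuousLinearMap.opNorm_le_bound _ zero_le_one fun v => by
    rw [unitary_norm_map, one_mul]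

/-- The image `(u, ρ L)` of the flag `(u, L)` under a rotation `ρ` that fixes `u`. -/
def FlagManifold.rotate {d q : ℕ} (x : FlagManifold d q) (ρ : rotationsFixing x.u) :
    FlagManifold d q where
  u := x.u
  L := x.L.map ((ρ : unitary (E d →L[ℝ] E d)) : E d →L[ℝ] E d).toLinearMap
  norm_u := x.norm_u
  finrank_L := by
    have hinj : Function.Injective
        ((ρ : unitary (E d →L[ℝ] E d)) : E d →L[ℝ] E d).toLinearMap :=
      (Unitary.linearIsometryEquiv (ρ : unitary (E d →L[ℝ] E d))).injective
    exact (Submodule.equivMapOfInjective _ hinj x.L).finrank_eq.symm.trans x.finrank_L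
  mem := ⟨x.u, x.mem, ρ.2.2⟩

/-- For `x = (u, L₀)`, the `SO(u)`-invariant probability measure on the fibre
`{u} × G(⟨u⟩, q)` of the flag manifold over `u`: the distribution of `(u, ρ L₀)` where `ρ` is
distributed according to the Haar probability measure of `SO(u)`. As `SO(u)` is transitive on the
set `G(⟨u⟩, q)` of the `q`-dimensional subspaces containing `u`, this is the only such measure,
and it does not depend on the choice of `L₀`. -/
def fibreMeasure {d q : ℕ} (x : FlagManifold d q) : Measure (FlagManifold d q) :=
  (Measure.haarMeasure (⊤ : TopologicalSpace.PositiveCompacts (rotationsFixing x.u))).map x.rotate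

/-- The transform `(T h) (u, L) = ∫ |⟨L, M⟩|² h (u, M) ν(dM)`, where `ν` is the invariant
probability measure on the subspaces `M` that contain `u`. -/
def flagTransform {d q : ℕ} (h : FlagManifold d q → ℝ) (x : FlagManifold d q) : ℝ :=
  ∫ y, absDet x y ^ 2 * h y ∂(fibreMeasure x)

/-! ### Flag-continuous valuations and flag measures -/

/-- The valuation `φ` on polytopes is flag-continuous in degree `j`, with density `h`: it has an
associated function `f` with `f p = ∫_p h (u, ⟨p⟩) du` if `p` has full dimension `d - 1 - j`, and
`f p = 0` for `p` of smaller dimension. -/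
def IsFlagContinuousWith {d : ℕ} (j : ℕ) (φ : polytopes d → ℝ)
    (h : C(FlagManifold d (d - j), ℝ)) : Prop :=
  ∃ f : Set (E d) → ℝ, IsAssociatedFunction j φ f ∧
    ∀ p, IsSphericalPolytope (d - 1 - j) p →
      (Module.finrank ℝ (Submodule.span ℝ p) = d - j →
        f p = ∫ u in p, FlagManifold.eval h u (Submodule.span ℝ p) ∂μHE[d - 1 - j]) ∧
      (Module.finrank ℝ (Submodule.span ℝ p) < d - j → f p = 0)

/-- `φ` is strongly flag-continuous in degree `j`, with the continuous function `g` on the flag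
manifold: it is flag-continuous with the density `T g`. -/
def IsStronglyFlagContinuousWith {d : ℕ} (j : ℕ) (φ : polytopes d → ℝ)
    (g : C(FlagManifold d (d - j), ℝ)) : Prop :=
  ∃ h : C(FlagManifold d (d - j), ℝ), (∀ x, h x = flagTransform g x) ∧ IsFlagContinuousWith j φ h

/-- The value at `A` of the flag measure of a polytope `P`:
`∑_F V_j(F) ∫_{n(P, F)} ∫ |⟨L, F^⊥⟩|² 1{(u, L) ∈ A} ν(dL) du`, the sum being over the `j`-faces
`F` of `P`, and `ν` being the invariant probability measure on the subspaces `L` of dimension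
`d - j` that contain `u`. -/
def flagMeasureValue {d : ℕ} (j : ℕ) (P : Set (E d)) (A : Set (FlagManifold d (d - j))) : ENNReal :=
  ∑ᶠ F ∈ faces j P, μHE[j] F * ∫⁻ u in sphericalNormals P F,
    FlagManifold.eval (fun x : FlagManifold d (d - j) =>
      ∫⁻ y, ENNReal.ofReal (absDet y x ^ 2) * A.indicator 1 y ∂(fibreMeasure x))
      u (vectorSpan ℝ F)ᗮ ∂μHE[d - 1 - j]

/-- `ψ` is an extension of the flag measures from polytopes to convex bodies which is continuous
with respect to the Hausdorff metric and the weak topology on finite measures. -/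
def IsContinuousFlagMeasure {d : ℕ} (j : ℕ)
    (ψ : ConvexBody (E d) → FiniteMeasure (FlagManifold d (d - j))) : Prop :=
  Continuous ψ ∧ ∀ P ∈ polytopes d, ∀ A : Set (FlagManifold d (d - j)), MeasurableSet A →
    (ψ P : Measure (FlagManifold d (d - j))) A = flagMeasureValue j (P : Set (E d)) A

end FlagVal

end

/-!
The flag measures of convex bodies are constructed by one formula that makes sense for all bodies
and depends on the body continuously. The formula rests on parametric linear programming. Given
vectors `a = (a₁, …, a_j)`, a vector `w` and a point `x` of `ℝ^j`, consider the maximum of `⟪w,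
y⟫` over the points `y` of the body `K` with `⟪a_i, y⟫ = x_i` for all `i`. By duality, it is the
minimum over `l` of `h_K (w + ∑ l_i a_i) - ⟪l, x⟫`, where `h_K` is the support function. To have
a minimum over a compact set, `l` is confined to the unit ball; the resulting function `val K a
w` of `x` is 1-Lipschitz, and wherever it is differentiable, that is, for almost every `x`, the
minimizer `mult K a w x` is unique, being the negative gradient. The vector `u = w + comb a (mult
K a w x)` is then a normal vector of `K`, and together with `a` it determines a flag `flagOf x₀
(u, a)`: the direction of `u` and the orthogonal complement of the projections of the `a_i` to
the orthogonal complement of `u`. The measure `auxMeasure x₀ K` is the distribution of this flag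
with respect to Lebesgue measure in `(a, w, x)`, with a density that has bounded support and
vanishes where `l` approaches the boundary of the ball and where the flag degenerates.

Uniqueness of the minimizer makes the flag depend continuously on `K`, for almost all parameters,
so that `auxMeasure` is weakly continuous by dominated convergence
(`tendsto_integral_auxMeasure`). It is a valuation because the support functions of `K ∪ M` and
`K ∩ M` are the maximum and the minimum of those of `K` and `M`, and hence the multipliers of `K
∪ M` and `K ∩ M` are those of `K` and `M` in one of the two orders (`mult_union_inter`).

For a polytope `P`, the maximizing point `y` lies, for almost all parameters, in exactly one
`j`-face `F` of `P`, the one in direction `u` (`eq_sum_faces`). For fixed `a`, integration over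
`x` yields the volume of the image of `F` under `coord a`, and the change of variables from `w`
to `(u, l)`, with `u` in the normal cone of `F`, yields the same determinant once more
(`volume_mul_lintegral_faceMult`). The square of this determinant is the product of the Gram
determinant of the projected `a_i` and `|⟨L, F^⊥⟩|²`, where `L` is the subspace of the flag
(`det_coord_sq`); this is where the factor in the definition of the flag measure comes from.
Finally, the distribution of `L` for fixed `u` and a rotation invariant distribution of `a` is
the invariant measure on the fibre over `u`, up to a constant (`lintegral_frameWeight`), and
polar coordinates in the normal space of `F` lead to the integral over `n(P, F)`
(`lintegral_normal_space`). So `auxMeasure x₀ P` is a constant multiple of the flag measure of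
`P` (`exists_lintegral_auxMeasure_eq`), and the multiple of `auxMeasure` by the inverse constant
is the extension of the flag measures to convex bodies.

A functional `φ` that is strongly flag-continuous with `g` satisfies `φ P = ∫ g dψ_j(P, ·)` for
all polytopes `P`, because the matrix of the projection from `M` to `L` is the transpose of the
one from `L` to `M` (`eq_integral_of_isStronglyFlagContinuousWith`). The right-hand side makes
sense for convex bodies and is the continuous extension. All uniqueness statements, and
translation invariance, follow from the density of the polytopes.
-/

open MeasureTheory
open scoped Pointwise

noncomputable section

namespace FlagVal

open Metric Filter Topology

variable {d j q : ℕ}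

/-! ### Support functions -/

/-- The support function `h_K u = max_{y ∈ K} ⟪u, y⟫` of a convex body. -/
def supp {d : ℕ} (K : ConvexBody (E d)) (u : E d) : ℝ :=
  sSup ((fun y => inner ℝ u y) '' (K : Set (E d)))


lemma bddAbove_inner_image (K : ConvexBody (E d)) (u : E d) :
    BddAbove ((fun y => inner ℝ u y) '' (K : Set (E d))) :=
  K.isCompact.bddAbove_image (by fun_prop)

lemma le_supp (K : ConvexBody (E d)) (u : E d) {y : E d} (hy : y ∈ (K : Set (E d))) :
    inner ℝ u y ≤ supp K u :=
  le_csSup (bddAbove_inner_image K u) (Set.mem_image_of_mem _ hy)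

lemma supp_le (K : ConvexBody (E d)) (u : E d) {c : ℝ}
    (h : ∀ y ∈ (K : Set (E d)), inner ℝ u y ≤ c) : supp K u ≤ c :=
  csSup_le (K.nonempty.image _) (by rintro _ ⟨y, hy, rfl⟩; exact h y hy)

lemma exists_eq_supp (K : ConvexBody (E d)) (u : E d) :
    ∃ y ∈ (K : Set (E d)), inner ℝ u y = supp K u := by
  obtain ⟨y, hy, h⟩ := K.isCompact.exists_isMaxOn K.nonempty
    (f := fun y => inner ℝ u y) (by fun_prop)
  exact ⟨y, hy, le_antisymm (le_supp K u hy) (supp_le K u fun z hz => h hz)⟩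

lemma supp_sub_le_dist (K M : ConvexBody (E d)) (u : E d) :
    supp K u - supp M u ≤ ‖u‖ * dist K M := by
  obtain ⟨y, hy, hyu⟩ := exists_eq_supp K u
  refine le_of_forall_pos_le_add fun ε hε => ?_
  have hlt : hausdorffDist (K : Set (E d)) M < dist K M + ε / (‖u‖ + 1) := by
    rw [ConvexBody.hausdorffDist_coe]; have : 0 < ε / (‖u‖ + 1) := by positivity
    linarith
  obtain ⟨z, hz, hyz⟩ := exists_dist_lt_of_hausdorffDist_lt hy hlt
    ConvexBody.hausdorffEDist_ne_top
  have h1 := le_supp M u hz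
  have h2 : inner ℝ u (y - z) ≤ ‖u‖ * ‖y - z‖ := real_inner_le_norm _ _
  rw [inner_sub_right] at h2
  rw [dist_eq_norm] at hyz
  have h3 : ‖u‖ * ‖y - z‖ ≤ ‖u‖ * (dist K M + ε / (‖u‖ + 1)) :=
    mul_le_mul_of_nonneg_left hyz.le (norm_nonneg _)
  have h4 : ‖u‖ * (ε / (‖u‖ + 1)) ≤ ε := by
    rw [mul_div_assoc', div_le_iff₀ (by positivity)]
    nlinarith [norm_nonneg u]
  rw [mul_add] at h3
  linarith

lemma supp_add_sub_le (K : ConvexBody (E d)) {R : ℝ}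
    (hR : ∀ y ∈ (K : Set (E d)), ‖y‖ ≤ R) (u v : E d) :
    supp K (u + v) - supp K u ≤ ‖v‖ * R := by
  obtain ⟨y, hy, h⟩ := exists_eq_supp K (u + v)
  have h1 := le_supp K u hy
  have h2 : inner ℝ v y ≤ ‖v‖ * ‖y‖ := real_inner_le_norm _ _
  have h3 : ‖v‖ * ‖y‖ ≤ ‖v‖ * R := mul_le_mul_of_nonneg_left (hR y hy) (norm_nonneg _)
  rw [inner_add_left] at h
  linarith

lemma exists_norm_le (K : ConvexBody (E d)) : ∃ R : ℝ, 0 ≤ R ∧ ∀ y ∈ (K : Set (E d)), ‖y‖ ≤ R := by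
  obtain ⟨R, hR⟩ := K.isBounded.exists_norm_le
  exact ⟨max R 0, le_max_right _ _, fun y hy => (hR y hy).trans (le_max_left _ _)⟩

/-- The bound for `M` is uniform over bodies near `K`. -/
lemma norm_le_of_dist_le {K M : ConvexBody (E d)} {R : ℝ}
    (hR : ∀ y ∈ (K : Set (E d)), ‖y‖ ≤ R) (h : dist M K < 1) :
    ∀ y ∈ (M : Set (E d)), ‖y‖ ≤ R + 1 := by
  intro y hy
  rw [← ConvexBody.hausdorffDist_coe] at h
  obtain ⟨z, hz, hyz⟩ := exists_dist_lt_of_hausdorffDist_lt hy h ConvexBody.hausdorffEDist_ne_top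
  have := hR z hz
  have h2 : ‖y‖ ≤ ‖z‖ + ‖y - z‖ := by
    simpa using norm_add_le z (y - z)
  rw [dist_eq_norm] at hyz
  linarith

lemma continuous_supp :
    Continuous fun p : ConvexBody (E d) × E d => supp p.1 p.2 := by
  rw [continuous_iff_continuousAt]
  rintro ⟨K, u⟩
  obtain ⟨R, hR0, hR⟩ := exists_norm_le K
  rw [ContinuousAt, tendsto_iff_dist_tendsto_zero]
  have hb : Tendsto (fun p : ConvexBody (E d) × E d =>
      ‖p.2‖ * dist p.1 K + ‖p.2 - u‖ * R) (𝓝 (K, u)) (𝓝 0) := by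
    have : Continuous fun p : ConvexBody (E d) × E d => ‖p.2‖ * dist p.1 K + ‖p.2 - u‖ * R := by
      fun_prop
    simpa using this.tendsto (K, u)
  refine squeeze_zero (fun _ => dist_nonneg) (fun p => ?_) hb
  rw [Real.dist_eq, abs_le]
  have h1 := supp_sub_le_dist p.1 K p.2
  have h2 := supp_sub_le_dist K p.1 p.2
  have h3 := supp_add_sub_le K hR u (p.2 - u)
  have h4 := supp_add_sub_le K hR p.2 (u - p.2)
  rw [dist_comm] at h2
  rw [norm_sub_rev] at h4
  simp only [add_sub_cancel] at h3 h4
  constructor <;> linarith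

lemma supp_union {K M U : ConvexBody (E d)}
    (hU : (U : Set (E d)) = (K : Set (E d)) ∪ (M : Set (E d))) (u : E d) :
    supp U u = max (supp K u) (supp M u) := by
  refine le_antisymm (supp_le U u fun y hy => ?_) (max_le (supp_le K u fun y hy => ?_)
    (supp_le M u fun y hy => ?_))
  · rw [hU] at hy
    rcases hy with hy | hy
    · exact (le_supp K u hy).trans (le_max_left _ _)
    · exact (le_supp M u hy).trans (le_max_right _ _)
  · exact le_supp U u (hU ▸ Or.inl hy)
  · exact le_supp U u (hU ▸ Or.inr hy)

/-- If `K ∪ M` is convex, a segment from a point of `K` to a point of `M` meets `K ∩ M`. -/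
lemma supp_inter {K M U I : ConvexBody (E d)}
    (hU : (U : Set (E d)) = (K : Set (E d)) ∪ (M : Set (E d)))
    (hI : (I : Set (E d)) = (K : Set (E d)) ∩ (M : Set (E d))) (u : E d) :
    supp I u = min (supp K u) (supp M u) := by
  refine le_antisymm (supp_le I u fun y hy => ?_) ?_
  · rw [hI] at hy
    exact le_min (le_supp K u hy.1) (le_supp M u hy.2)
  · obtain ⟨y, hy, hyu⟩ := exists_eq_supp K u
    obtain ⟨z, hz, hzu⟩ := exists_eq_supp M u
    have hseg : segment ℝ y z ⊆ (K : Set (E d)) ∪ M := by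
      rw [← hU]
      exact U.convex.segment_subset (hU ▸ Or.inl hy) (hU ▸ Or.inr hz)
    have hconn : IsPreconnected (segment ℝ y z) := (convex_segment y z).isPreconnected
    obtain ⟨p, hp, hpK, hpM⟩ := isPreconnected_closed_iff.1 hconn _ _ K.isClosed M.isClosed hseg
      ⟨y, left_mem_segment ℝ y z, hy⟩ ⟨z, right_mem_segment ℝ y z, hz⟩
    refine le_trans ?_ (le_supp I u (y := p) (hI ▸ ⟨hpK, hpM⟩))
    obtain ⟨a, b, ha, hb, hab, rfl⟩ := hp
    rw [inner_add_right, inner_smul_right, inner_smul_right, hyu, hzu]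
    have h1 : min (supp K u) (supp M u) ≤ supp K u := min_le_left _ _
    have h2 : min (supp K u) (supp M u) ≤ supp M u := min_le_right _ _
    calc min (supp K u) (supp M u)
        = a * min (supp K u) (supp M u) + b * min (supp K u) (supp M u) := by
          rw [← add_mul, hab, one_mul]
      _ ≤ _ := by gcongr

lemma supp_convex (K : ConvexBody (E d)) (u v : E d) {s t : ℝ} (hs : 0 ≤ s) (ht : 0 ≤ t) :
    supp K (s • u + t • v) ≤ s * supp K u + t * supp K v := by
  refine supp_le K _ fun y hy => ?_
  rw [inner_add_left, inner_smul_left, inner_smul_left]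
  have h1 := le_supp K u hy
  have h2 := le_supp K v hy
  simp only [conj_trivial]
  gcongr

/-! ### Density of polytopes and translations -/

lemma dense_polytopes (d : ℕ) : Dense (polytopes d) := by
  intro K
  rw [Metric.mem_closure_iff]
  intro ε hε
  obtain ⟨t, htK, htfin, hcov⟩ := K.isCompact.finite_cover_balls (half_pos hε)
  have htne : t.Nonempty := by
    obtain ⟨y, hy⟩ := K.nonempty
    obtain ⟨z, hz, -⟩ := Set.mem_iUnion₂.1 (hcov hy)
    exact ⟨z, hz⟩
  let P : ConvexBody (E d) := ⟨convexHull ℝ t, convex_convexHull ℝ t, htfin.isCompact_convexHull ℝ,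
    htne.convexHull⟩
  have hPK : (P : Set (E d)) ⊆ K := convexHull_min htK K.convex
  refine ⟨P, ⟨htfin.toFinset, by simp [P]⟩, lt_of_le_of_lt ?_ (half_lt_self hε)⟩
  rw [← ConvexBody.hausdorffDist_coe]
  refine hausdorffDist_le_of_mem_dist (half_pos hε).le (fun y hy => ?_) fun y hy => ?_
  · obtain ⟨z, hz, hyz⟩ := Set.mem_iUnion₂.1 (hcov hy)
    exact ⟨z, subset_convexHull ℝ t hz, (mem_ball.1 hyz).le⟩
  · exact ⟨y, hPK hy, by simpa using (half_pos hε).le⟩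

/-- The translate `t + K`. -/
def translate (t : E d) (K : ConvexBody (E d)) : ConvexBody (E d) :=
  ⟨t +ᵥ (K : Set (E d)), K.convex.vadd t, K.isCompact.vadd t, K.nonempty.vadd_set⟩

lemma continuous_translate (t : E d) : Continuous (translate t) := by
  refine Isometry.continuous (Isometry.of_dist_eq fun K M => ?_)
  rw [← ConvexBody.hausdorffDist_coe, ← ConvexBody.hausdorffDist_coe]
  exact hausdorffDist_image (isometry_vadd (E d) t)

lemma translate_mem_polytopes (t : E d) {P : ConvexBody (E d)} (hP : P ∈ polytopes d) :
    translate t P ∈ polytopes d := by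
  classical
  obtain ⟨s, hs⟩ := hP
  refine ⟨s.image (fun y => t + y), ?_⟩
  change t +ᵥ (P : Set (E d)) = _
  rw [hs, ← convexHull_vadd]
  rw [Finset.coe_image]
  rfl

/-! ### The multiplier of a convex body -/

/-- The linear combination `∑ i, l i • a i`. -/
def comb (a : Fin j → E d) : E j →ₗ[ℝ] E d where
  toFun l := ∑ i, l i • a i
  map_add' l m := by simp [add_smul, Finset.sum_add_distrib]
  map_smul' c l := by simp [Finset.smul_sum, smul_smul]

/-- The adjoint `y ↦ (⟪a i, y⟫)_i` of `comb a`. -/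
def coord (a : Fin j → E d) : E d →ₗ[ℝ] E j where
  toFun y := WithLp.toLp 2 fun i => inner ℝ (a i) y
  map_add' y z := by ext i; simp [inner_add_right]
  map_smul' c y := by ext i; simp [inner_smul_right]

lemma comb_apply (a : Fin j → E d) (l : E j) : comb a l = ∑ i, l i • a i := rfl

@[simp] lemma coord_apply (a : Fin j → E d) (y : E d) (i : Fin j) :
    coord a y i = inner ℝ (a i) y := rfl

lemma inner_comb (a : Fin j → E d) (l : E j) (y : E d) :
    inner ℝ (comb a l) y = inner ℝ l (coord a y) := by
  rw [comb_apply, sum_inner, PiLp.inner_apply]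
  simp [inner_smul_left, mul_comm]

lemma continuous_comb {X : Type*} [TopologicalSpace X] {f : X → Fin j → E d} {g : X → E j}
    (hf : Continuous f) (hg : Continuous g) : Continuous fun p => comb (f p) (g p) := by
  simp only [comb_apply]; fun_prop

lemma norm_comb_le (a : Fin j → E d) (l : E j) {c : ℝ} (ha : ∀ i, ‖a i‖ ≤ c) :
    ‖comb a l‖ ≤ j * (‖l‖ * c) := by
  rw [comb_apply]
  refine (norm_sum_le _ _).trans ?_
  have : ∀ i ∈ Finset.univ, ‖l i • a i‖ ≤ ‖l‖ * c := fun i _ => by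
    rw [norm_smul]
    exact mul_le_mul (PiLp.norm_apply_le l i) (ha i) (norm_nonneg _) (norm_nonneg _)
  simpa using Finset.sum_le_card_nsmul _ _ _ this

/-- The function `l ↦ h_K (w + comb a l) - ⟪l, x⟫`. -/
def obj (K : ConvexBody (E d)) (a : Fin j → E d) (w : E d) (x l : E j) : ℝ :=
  supp K (w + comb a l) - inner ℝ l x

/-- The minimum of `obj` over the unit ball. As a function of `x`, it is a Lipschitz version of the
concave function `x ↦ max {⟪w, y⟫ | y ∈ K, coord a y = x}`. -/
def val (K : ConvexBody (E d)) (a : Fin j → E d) (w : E d) (x : E j) : ℝ :=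
  sInf (obj K a w x '' closedBall 0 1)

/-- The negative gradient in `x` of `val K a w x`. For almost every `x` it is the only minimizer of
`obj K a w x` on the unit ball; where `val K a w` is not differentiable, it is `0`. -/
def mult (K : ConvexBody (E d)) (a : Fin j → E d) (w : E d) (x : E j) : E j :=
  -gradient (val K a w) x

lemma continuous_obj {X : Type*} [TopologicalSpace X] {fK : X → ConvexBody (E d)}
    {fa : X → Fin j → E d} {fw : X → E d} {fx fl : X → E j} (hK : Continuous fK)
    (ha : Continuous fa) (hw : Continuous fw) (hx : Continuous fx) (hl : Continuous fl) :
    Continuous fun p => obj (fK p) (fa p) (fw p) (fx p) (fl p) := by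
  unfold obj
  have h1 : Continuous fun p => (fK p, fw p + comb (fa p) (fl p)) :=
    hK.prodMk (hw.add (continuous_comb ha hl))
  exact (continuous_supp.comp h1).sub (hl.inner hx)

lemma continuous_val : Continuous fun p : ConvexBody (E d) × (Fin j → E d) × E d × E j =>
    val p.1 p.2.1 p.2.2.1 p.2.2.2 :=
  (isCompact_closedBall (0 : E j) 1).continuous_sInf
    (f := fun (p : ConvexBody (E d) × (Fin j → E d) × E d × E j) l =>
      obj p.1 p.2.1 p.2.2.1 p.2.2.2 l)
    (continuous_obj (continuous_fst.comp continuous_fst)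
      (continuous_fst.comp (continuous_snd.comp continuous_fst))
      (continuous_fst.comp (continuous_snd.comp (continuous_snd.comp continuous_fst)))
      (continuous_snd.comp (continuous_snd.comp (continuous_snd.comp continuous_fst)))
      continuous_snd)

lemma continuous_obj_right (K : ConvexBody (E d)) (a : Fin j → E d) (w : E d) (x : E j) :
    Continuous (obj K a w x) :=
  continuous_obj continuous_const continuous_const continuous_const continuous_const continuous_id

lemma val_le (K : ConvexBody (E d)) (a : Fin j → E d) (w : E d) (x : E j) {l : E j}
    (hl : ‖l‖ ≤ 1) : val K a w x ≤ obj K a w x l :=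
  csInf_le ((isCompact_closedBall (0 : E j) 1).bddBelow_image
    (continuous_obj_right K a w x).continuousOn)
    (Set.mem_image_of_mem _ (by simpa using hl))

lemma exists_obj_eq_val (K : ConvexBody (E d)) (a : Fin j → E d) (w : E d) (x : E j) :
    ∃ l : E j, ‖l‖ ≤ 1 ∧ obj K a w x l = val K a w x := by
  obtain ⟨l, hl, h⟩ := (isCompact_closedBall (0 : E j) 1).exists_sInf_image_eq
    ⟨0, by simp⟩ (continuous_obj_right K a w x).continuousOn
  exact ⟨l, by simpa using hl, h.symm⟩

lemma obj_sub (K : ConvexBody (E d)) (a : Fin j → E d) (w : E d) (x x' l : E j) :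
    obj K a w x' l = obj K a w x l - inner ℝ l (x' - x) := by
  simp only [obj, inner_sub_right]; ring

lemma val_sub_le (K : ConvexBody (E d)) (a : Fin j → E d) (w : E d) (x x' : E j) :
    val K a w x' ≤ val K a w x + ‖x' - x‖ := by
  obtain ⟨l, hl, h⟩ := exists_obj_eq_val K a w x
  have h1 := val_le K a w x' hl
  rw [obj_sub K a w x, h] at h1
  have h2 : |inner ℝ l (x' - x)| ≤ ‖l‖ * ‖x' - x‖ := abs_real_inner_le_norm _ _
  have h3 : ‖l‖ * ‖x' - x‖ ≤ 1 * ‖x' - x‖ := by gcongr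
  have := (abs_le.1 h2).1
  linarith

lemma lipschitzWith_val (K : ConvexBody (E d)) (a : Fin j → E d) (w : E d) :
    LipschitzWith 1 (val K a w) :=
  LipschitzWith.of_le_add fun x y => by
    rw [dist_eq_norm]; exact val_sub_le K a w y x

/-- At a point of differentiability of `val`, a minimizer is determined by the gradient: the
function `x' ↦ val x' + ⟪l, x'⟫` has a maximum at `x`. -/
lemma eq_mult {K : ConvexBody (E d)} {a : Fin j → E d} {w : E d} {x : E j}
    (hx : DifferentiableAt ℝ (val K a w) x) {l : E j} (hl : ‖l‖ ≤ 1)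
    (h : obj K a w x l = val K a w x) : l = mult K a w x := by
  have hmax : IsLocalMax (fun x' => val K a w x' + inner ℝ l x') x := by
    refine Filter.Eventually.of_forall fun x' => ?_
    have h1 := val_le K a w x' hl
    rw [obj_sub K a w x, h, inner_sub_right] at h1
    linarith
  have h1 : HasGradientAt (val K a w) (gradient (val K a w) x) x := hx.hasGradientAt
  have h2 : HasFDerivAt (fun x' => val K a w x' + inner ℝ l x')
      (InnerProductSpace.toDual ℝ (E j) (gradient (val K a w) x) + innerSL ℝ l) x :=
    h1.hasFDerivAt.add (innerSL ℝ l).hasFDerivAt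
  have h3 := hmax.hasFDerivAt_eq_zero h2
  have h4 : gradient (val K a w) x + l = 0 := by
    refine ext_inner_right ℝ fun v => ?_
    have := congrArg (fun T => T v) h3
    simpa [inner_add_left] using this
  rw [mult]
  exact eq_neg_of_add_eq_zero_right h4

lemma mult_spec {K : ConvexBody (E d)} {a : Fin j → E d} {w : E d} {x : E j}
    (hx : DifferentiableAt ℝ (val K a w) x) :
    ‖mult K a w x‖ ≤ 1 ∧ obj K a w x (mult K a w x) = val K a w x := by
  obtain ⟨l, hl, h⟩ := exists_obj_eq_val K a w x
  rw [← eq_mult hx hl h]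
  exact ⟨hl, h⟩

lemma ae_differentiableAt_val (K : ConvexBody (E d)) (a : Fin j → E d) (w : E d) :
    ∀ᵐ x, DifferentiableAt ℝ (val K a w) x :=
  (lipschitzWith_val K a w).ae_differentiableAt

/-- The space of the parameters `(a, w, x)`. -/
abbrev Param (d j : ℕ) : Type := ((Fin j → E d) × E d) × E j

lemma continuous_val_uncurry (K : ConvexBody (E d)) :
    Continuous (Function.uncurry fun (p : (Fin j → E d) × E d) => val K p.1 p.2) :=
  continuous_val.comp (g := fun p : ConvexBody (E d) × (Fin j → E d) × E d × E j =>
    val p.1 p.2.1 p.2.2.1 p.2.2.2) (f := fun p : Param d j => (K, p.1.1, p.1.2, p.2)) (by fun_prop)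

lemma measurable_mult (K : ConvexBody (E d)) :
    Measurable fun p : Param d j => mult K p.1.1 p.1.2 p.2 := by
  have h := measurable_fderiv_with_param ℝ (continuous_val_uncurry (j := j) K)
  exact ((InnerProductSpace.toDual ℝ (E j)).symm.continuous.measurable.comp h).neg

lemma ae_param_differentiableAt (K : ConvexBody (E d)) :
    ∀ᵐ p : Param d j, DifferentiableAt ℝ (val K p.1.1 p.1.2) p.2 := by
  have hm := measurableSet_of_differentiableAt_with_param ℝ (continuous_val_uncurry (j := j) K)
  exact (Measure.ae_prod_iff_ae_ae hm).2
    (Filter.Eventually.of_forall fun p => ae_differentiableAt_val K p.1 p.2)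

/-- The multiplier depends continuously on the convex body, by compactness and uniqueness. -/
lemma tendsto_mult {K : ℕ → ConvexBody (E d)} {K₀ : ConvexBody (E d)} (hK : Tendsto K atTop (𝓝 K₀))
    {a : Fin j → E d} {w : E d} {x : E j} (h : ∀ n, DifferentiableAt ℝ (val (K n) a w) x)
    (h₀ : DifferentiableAt ℝ (val K₀ a w) x) :
    Tendsto (fun n => mult (K n) a w x) atTop (𝓝 (mult K₀ a w x)) := by
  refine tendsto_of_subseq_tendsto fun ns hns => ?_
  obtain ⟨l, hl, φ, hφ, hlim⟩ := (isCompact_closedBall (0 : E j) 1).tendsto_subseq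
    (x := fun n => mult (K (ns n)) a w x) (fun n => by simpa using (mult_spec (h _)).1)
  refine ⟨φ, ?_⟩
  have hKn : Tendsto (fun n => K (ns (φ n))) atTop (𝓝 K₀) :=
    hK.comp (hns.comp hφ.tendsto_atTop)
  have h1 : Tendsto (fun n => obj (K (ns (φ n))) a w x (mult (K (ns (φ n))) a w x)) atTop
      (𝓝 (obj K₀ a w x l)) := by
    have hc : Continuous fun p : ConvexBody (E d) × E j => obj p.1 a w x p.2 :=
      continuous_obj continuous_fst continuous_const continuous_const continuous_const
        continuous_snd
    have h := (hc.tendsto (K₀, l)).comp (hKn.prodMk_nhds hlim)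
    simpa only [Function.comp_def] using h
  have h2 : Tendsto (fun n => val (K (ns (φ n))) a w x) atTop (𝓝 (val K₀ a w x)) := by
    have hc : Continuous fun p : ConvexBody (E d) => val p a w x :=
      continuous_val.comp (f := fun p : ConvexBody (E d) => (p, a, w, x))
        (continuous_id.prodMk continuous_const)
    have h := (hc.tendsto K₀).comp hKn
    simpa only [Function.comp_def] using h
  have h3 : obj K₀ a w x l = val K₀ a w x :=
    tendsto_nhds_unique h1 (h2.congr fun n => (mult_spec (h _)).2.symm)
  rw [← eq_mult h₀ (by simpa using hl) h3]
  exact hlim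

/-- If the multiplier is interior to the unit ball, the minimum is global; this confines `x` to the
image of a ball containing `K`. -/
lemma norm_le_of_norm_mult_lt {K : ConvexBody (E d)} {a : Fin j → E d} {w : E d} {x : E j}
    (hx : DifferentiableAt ℝ (val K a w) x) (hlt : ‖mult K a w x‖ < 1) {R : ℝ}
    (hR : ∀ y ∈ (K : Set (E d)), ‖y‖ ≤ R) (ha : ∀ i, ‖a i‖ ≤ 1) (hR0 : 0 ≤ R) : ‖x‖ ≤ j * R := by
  set l := mult K a w x with hl
  have hev : ∀ᶠ t : ℝ in 𝓝[>] 0, ‖l + t • x‖ ≤ 1 := by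
    have hc : Tendsto (fun t : ℝ => ‖l + t • x‖) (𝓝 0) (𝓝 ‖l‖) := by
      have : Continuous fun t : ℝ => ‖l + t • x‖ := by fun_prop
      simpa using this.tendsto 0
    exact ((hc.eventually (gt_mem_nhds hlt)).filter_mono nhdsWithin_le_nhds).mono
      fun t ht => le_of_lt ht
  obtain ⟨t, ht, ht0⟩ := (hev.and self_mem_nhdsWithin).exists
  have ht0 : 0 < t := ht0
  have h1 := val_le K a w x ht
  rw [← (mult_spec hx).2, ← hl] at h1
  simp only [obj, map_add, map_smul, inner_add_left, inner_smul_left, conj_trivial,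
    real_inner_self_eq_norm_sq] at h1
  have h2 := supp_add_sub_le K hR (w + comb a l) (t • comb a x)
  have h3 := norm_comb_le a x ha
  rw [norm_smul, Real.norm_of_nonneg ht0.le] at h2
  rw [add_assoc] at h2
  have h4 : t * ‖x‖ ^ 2 ≤ t * (j * (‖x‖ * 1) * R) := by
    have : t * ‖comb a x‖ * R ≤ t * (j * (‖x‖ * 1) * R) := by
      rw [mul_assoc]; gcongr
    linarith
  have h5 := le_of_mul_le_mul_left h4 ht0
  rcases (norm_nonneg x).eq_or_lt with h0 | h0
  · rw [← h0]; positivity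
  · nlinarith

/-! ### Multipliers of unions and intersections -/

section Union

variable {K M U I : ConvexBody (E d)}
  (hU : (U : Set (E d)) = (K : Set (E d)) ∪ (M : Set (E d)))
  (hI : (I : Set (E d)) = (K : Set (E d)) ∩ (M : Set (E d)))
  {a : Fin j → E d} {w : E d} {x : E j}

include hU in
lemma obj_union (l : E j) : obj U a w x l = max (obj K a w x l) (obj M a w x l) := by
  simp only [obj, supp_union hU, max_sub_sub_right]

include hU hI in
lemma obj_inter (l : E j) : obj I a w x l = min (obj K a w x l) (obj M a w x l) := by
  simp only [obj, supp_inter hU hI, min_sub_sub_right]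

lemma obj_convex (K : ConvexBody (E d)) (a : Fin j → E d) (w : E d) (x l m : E j) {t : ℝ}
    (h0 : 0 ≤ t) (h1 : t ≤ 1) :
    obj K a w x ((1 - t) • l + t • m) ≤ (1 - t) * obj K a w x l + t * obj K a w x m := by
  have h := supp_convex K (w + comb a l) (w + comb a m) (sub_nonneg.2 h1) h0
  have he : w + comb a ((1 - t) • l + t • m)
      = (1 - t) • (w + comb a l) + t • (w + comb a m) := by
    simp only [map_add, map_smul]; module
  simp only [obj, he, inner_add_left, inner_smul_left, conj_trivial]
  linarith

include hU hI in
/-- The minimizers are unique, so it suffices to see that `mult K a w x` minimizes the minimum, and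
`mult M a w x` the maximum, of the functions `obj K a w x` and `obj M a w x`. -/
lemma mult_union_inter_of_le (hK : DifferentiableAt ℝ (val K a w) x)
    (hM : DifferentiableAt ℝ (val M a w) x) (hU' : DifferentiableAt ℝ (val U a w) x)
    (hI' : DifferentiableAt ℝ (val I a w) x) (hle : val K a w x ≤ val M a w x) :
    mult U a w x = mult M a w x ∧ mult I a w x = mult K a w x := by
  obtain ⟨hK1, hK2⟩ := mult_spec hK
  obtain ⟨hM1, hM2⟩ := mult_spec hM
  set l₁ := mult K a w x
  set l₂ := mult M a w x
  have hI1 : obj I a w x l₁ = val I a w x := by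
    refine le_antisymm ?_ (val_le I a w x hK1)
    obtain ⟨l, hl, h⟩ := exists_obj_eq_val I a w x
    rw [← h, obj_inter hU hI, obj_inter hU hI l]
    refine (min_le_left _ _).trans (le_min ?_ ?_)
    · exact hK2.le.trans (val_le K a w x hl)
    · exact (hK2.le.trans hle).trans (val_le M a w x hl)
  -- Otherwise `obj K = obj M` somewhere on the segment from `l₁` to `l₂`, and by convexity of
  -- `obj I` this point is another minimizer of `obj M`.
  have key : obj K a w x l₂ ≤ obj M a w x l₂ := by
    by_contra! hlt
    let p : ℝ → E j := fun t => (1 - t) • l₁ + t • l₂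
    have hcont : Continuous fun t : ℝ => obj K a w x (p t) - obj M a w x (p t) :=
      ((continuous_obj_right K a w x).comp (by fun_prop)).sub
        ((continuous_obj_right M a w x).comp (by fun_prop))
    have h0 : obj K a w x (p 0) - obj M a w x (p 0) ≤ 0 := by
      have := val_le M a w x hK1
      simp only [p, sub_zero, one_smul, zero_smul, add_zero]
      linarith
    have h1 : 0 ≤ obj K a w x (p 1) - obj M a w x (p 1) := by
      simp only [p, sub_self, one_smul, zero_smul, zero_add]
      linarith
    obtain ⟨t, ⟨ht0, ht1⟩, ht⟩ := intermediate_value_Icc zero_le_one hcont.continuousOn ⟨h0, h1⟩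
    have ht : obj K a w x (p t) = obj M a w x (p t) := sub_eq_zero.1 ht
    have hp : ‖p t‖ ≤ 1 := by
      have := convex_closedBall (0 : E j) 1 (by simpa using hK1 : l₁ ∈ closedBall 0 1)
        (by simpa using hM1 : l₂ ∈ closedBall 0 1) (sub_nonneg.2 ht1) ht0 (by ring)
      simpa using this
    have h2 : obj M a w x (p t) ≤ val M a w x := by
      have h3 := obj_convex I a w x l₁ l₂ ht0 ht1
      have h4 : obj I a w x (p t) = obj M a w x (p t) := by rw [obj_inter hU hI, ht, min_self]
      have h5 : obj I a w x l₁ ≤ val M a w x := by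
        rw [obj_inter hU hI]; exact (min_le_left _ _).trans (hK2.le.trans hle)
      have h6 : obj I a w x l₂ ≤ val M a w x := by
        rw [obj_inter hU hI]; exact (min_le_right _ _).trans hM2.le
      rw [← h4]
      refine h3.trans ?_
      have h7 := mul_le_mul_of_nonneg_left h5 (sub_nonneg.2 ht1)
      have h8 := mul_le_mul_of_nonneg_left h6 ht0
      linarith
    have h3 : p t = l₂ := eq_mult hM hp (le_antisymm h2 (val_le M a w x hp))
    rw [h3] at ht
    exact hlt.ne' ht
  have hU1 : obj U a w x l₂ = val U a w x := by
    refine le_antisymm ?_ (val_le U a w x hM1)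
    obtain ⟨l, hl, h⟩ := exists_obj_eq_val U a w x
    rw [← h, obj_union hU, obj_union hU l, max_eq_right key, hM2]
    exact (val_le M a w x hl).trans (le_max_right _ _)
  exact ⟨(eq_mult hU' hM1 hU1).symm, (eq_mult hI' hK1 hI1).symm⟩

include hU hI in
/-- If `K ∪ M` is convex, `K ∪ M` and `K ∩ M` have the same multipliers as `K` and `M`, in some
order. -/
lemma mult_union_inter (hK : DifferentiableAt ℝ (val K a w) x)
    (hM : DifferentiableAt ℝ (val M a w) x) (hU' : DifferentiableAt ℝ (val U a w) x)
    (hI' : DifferentiableAt ℝ (val I a w) x) :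
    (mult U a w x = mult M a w x ∧ mult I a w x = mult K a w x) ∨
    (mult U a w x = mult K a w x ∧ mult I a w x = mult M a w x) := by
  rcases le_total (val K a w x) (val M a w x) with h | h
  · exact Or.inl (mult_union_inter_of_le hU hI hK hM hU' hI' h)
  · exact Or.inr (mult_union_inter_of_le (Set.union_comm _ _ ▸ hU) (Set.inter_comm _ _ ▸ hI)
      hM hK hU' hI' h)

end Union

/-! ### The flag spanned by a vector and a frame -/

/-- The components of the vectors `a i` orthogonal to `u`, multiplied by `‖u‖ ^ 2` so that they are
polynomials in `u` and `a`. -/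
def reduced (u : E d) (a : Fin j → E d) (i : Fin j) : E d :=
  ‖u‖ ^ 2 • a i - inner ℝ u (a i) • u

/-- The Gram determinant of `reduced u a`. -/
def gramDet (u : E d) (a : Fin j → E d) : ℝ := (Matrix.gram ℝ (reduced u a)).det

lemma inner_reduced (u : E d) (a : Fin j → E d) (i : Fin j) : inner ℝ u (reduced u a i) = 0 := by
  simp only [reduced, inner_sub_right, inner_smul_right, real_inner_self_eq_norm_sq]; ring

lemma continuous_reduced (i : Fin j) :
    Continuous fun p : E d × (Fin j → E d) => reduced p.1 p.2 i := by
  unfold reduced; fun_prop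

lemma continuous_gram_reduced :
    Continuous fun p : E d × (Fin j → E d) => Matrix.gram ℝ (reduced p.1 p.2) :=
  continuous_matrix fun i k => (continuous_reduced i).inner (continuous_reduced k)

lemma continuous_gramDet : Continuous fun p : E d × (Fin j → E d) => gramDet p.1 p.2 :=
  continuous_gram_reduced.matrix_det

lemma gramDet_nonneg (u : E d) (a : Fin j → E d) : 0 ≤ gramDet u a :=
  (Matrix.posSemidef_gram (𝕜 := ℝ) (reduced u a)).det_nonneg

lemma gramDet_zero (hj : 1 ≤ j) (a : Fin j → E d) : gramDet 0 a = 0 := by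
  have h : reduced (0 : E d) a = 0 := by ext1 i; simp [reduced]
  have : Nonempty (Fin j) := ⟨⟨0, hj⟩⟩
  rw [gramDet, h, Matrix.gram_zero, Matrix.det_zero]

lemma linearIndependent_reduced {u : E d} {a : Fin j → E d} (h : gramDet u a ≠ 0) :
    LinearIndependent ℝ (reduced u a) :=
  Matrix.linearIndependent_of_det_gram_ne_zero h

/-- The orthogonal complement of the vectors `reduced u a i`. -/
def flagSpace (u : E d) (a : Fin j → E d) : Submodule ℝ (E d) :=
  (Submodule.span ℝ (Set.range (reduced u a)))ᗮ

lemma finrank_flagSpace {u : E d} {a : Fin j → E d} (h : gramDet u a ≠ 0) :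
    Module.finrank ℝ (flagSpace u a) = d - j := by
  have h1 := finrank_span_eq_card (linearIndependent_reduced h)
  have h2 := (Submodule.span ℝ (Set.range (reduced u a))).finrank_add_finrank_orthogonal
  rw [h1, Fintype.card_fin, finrank_euclideanSpace_fin] at h2
  rw [flagSpace]; omega

lemma mem_flagSpace (u : E d) (a : Fin j → E d) : u ∈ flagSpace u a := by
  rw [flagSpace, Submodule.mem_orthogonal']
  intro v hv
  induction hv using Submodule.span_induction with
  | mem x hx => obtain ⟨i, rfl⟩ := hx; exact inner_reduced u a i
  | zero => simp
  | add x y _ _ hx hy => rw [inner_add_right, hx, hy, add_zero]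
  | smul c x _ hx => rw [inner_smul_right, hx, mul_zero]

open Classical in
/-- The flag with unit vector `u / ‖u‖` whose subspace is the orthogonal complement of the
components of the `a i` orthogonal to `u`. In degenerate cases it is the flag `x₀`. -/
def flagOf (x₀ : FlagManifold d (d - j)) (p : E d × (Fin j → E d)) : FlagManifold d (d - j) :=
  if h : p.1 ≠ 0 ∧ gramDet p.1 p.2 ≠ 0 then
    { u := ‖p.1‖⁻¹ • p.1
      L := flagSpace p.1 p.2
      norm_u := by rw [norm_smul, norm_inv, norm_norm, inv_mul_cancel₀ (norm_ne_zero_iff.2 h.1)]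
      finrank_L := finrank_flagSpace h.2
      mem := Submodule.smul_mem _ _ (mem_flagSpace _ _) }
  else x₀

lemma flagOf_u (x₀ : FlagManifold d (d - j)) {p : E d × (Fin j → E d)}
    (h : p.1 ≠ 0 ∧ gramDet p.1 p.2 ≠ 0) : (flagOf x₀ p).u = ‖p.1‖⁻¹ • p.1 := by
  rw [flagOf, dif_pos h]

lemma flagOf_L (x₀ : FlagManifold d (d - j)) {p : E d × (Fin j → E d)}
    (h : p.1 ≠ 0 ∧ gramDet p.1 p.2 ≠ 0) : (flagOf x₀ p).L = flagSpace p.1 p.2 := by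
  rw [flagOf, dif_pos h]

lemma isOpen_nondegenerate :
    IsOpen {p : E d × (Fin j → E d) | p.1 ≠ 0 ∧ gramDet p.1 p.2 ≠ 0} :=
  (isOpen_ne_fun continuous_fst continuous_const).inter
    (isOpen_ne_fun continuous_gramDet continuous_const)

/-- The orthogonal projection onto the span of linearly independent vectors, in terms of the
inverse of their Gram matrix. -/
lemma starProjection_span_range {v : Fin j → E d} (h : (Matrix.gram ℝ v).det ≠ 0) :
    (Submodule.span ℝ (Set.range v)).starProjection =
      ∑ i, ∑ k, (Matrix.gram ℝ v)⁻¹ i k • (innerSL ℝ (v k)).smulRight (v i) := by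
  ext1 y
  refine (Submodule.eq_starProjection_of_mem_orthogonal ?_ ?_)
  · simp only [sum_apply, smul_apply,
      ContinuousLinearMap.smulRight_apply]
    exact Submodule.sum_mem _ fun i _ => Submodule.sum_mem _ fun k _ =>
      Submodule.smul_mem _ _ (Submodule.smul_mem _ _ (Submodule.subset_span ⟨i, rfl⟩))
  · rw [Submodule.mem_orthogonal]
    intro z hz
    induction hz using Submodule.span_induction with
    | zero => simp
    | add x y _ _ hx hy => rw [inner_add_left, hx, hy, add_zero]
    | smul c x _ hx => rw [inner_smul_left, hx, mul_zero]
    | mem x hx =>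
      obtain ⟨m, rfl⟩ := hx
      have h1 : (Matrix.gram ℝ v * (Matrix.gram ℝ v)⁻¹).mulVec (fun k => inner ℝ (v k) y) m
          = inner ℝ (v m) y := by
        rw [Matrix.mul_nonsing_inv _ (isUnit_iff_ne_zero.2 h), Matrix.one_mulVec]
      rw [← Matrix.mulVec_mulVec] at h1
      rw [inner_sub_right, ← h1, sub_eq_zero]
      simp only [sum_apply, smul_apply,
        ContinuousLinearMap.smulRight_apply, inner_sum, inner_smul_right, Matrix.mulVec,
        dotProduct, innerSL_apply_apply, Matrix.gram_apply, Finset.mul_sum]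
      refine Finset.sum_congr rfl fun i _ => Finset.sum_congr rfl fun k _ => by ring

lemma isInducing_flag (d q : ℕ) : Topology.IsInducing
    (fun x : FlagManifold d q => ((x.u, x.L.starProjection) : E d × (E d →L[ℝ] E d))) := ⟨rfl⟩

lemma injective_flag (d q : ℕ) : Function.Injective
    (fun x : FlagManifold d q => ((x.u, x.L.starProjection) : E d × (E d →L[ℝ] E d))) := by
  intro x y h
  have h1 := congrArg Prod.fst h
  have h2 := congrArg Prod.snd h
  exact FlagManifold.ext h1 (Submodule.starProjection_inj.1 h2)

instance (d q : ℕ) : SecondCountableTopology (FlagManifold d q) :=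
  (isInducing_flag d q).secondCountableTopology

instance (d q : ℕ) : TopologicalSpace.MetrizableSpace (FlagManifold d q) :=
  Topology.IsEmbedding.metrizableSpace ⟨isInducing_flag d q, injective_flag d q⟩

lemma continuousOn_flagOf (x₀ : FlagManifold d (d - j)) :
    ContinuousOn (flagOf x₀) {p : E d × (Fin j → E d) | p.1 ≠ 0 ∧ gramDet p.1 p.2 ≠ 0} := by
  rw [(isInducing_flag d (d - j)).continuousOn_iff]
  have hu : ContinuousOn (fun p : E d × (Fin j → E d) => ‖p.1‖⁻¹ • p.1)
      {p | p.1 ≠ 0 ∧ gramDet p.1 p.2 ≠ 0} :=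
    ContinuousOn.smul (ContinuousOn.inv₀ (by fun_prop) fun p hp => norm_ne_zero_iff.2 hp.1)
      (by fun_prop)
  have hL : ContinuousOn (fun p : E d × (Fin j → E d) =>
      (1 : E d →L[ℝ] E d) - ∑ i, ∑ k, ((gramDet p.1 p.2)⁻¹ *
        (Matrix.gram ℝ (reduced p.1 p.2)).adjugate i k) •
          (innerSL ℝ (reduced p.1 p.2 k)).smulRight (reduced p.1 p.2 i))
      {p | p.1 ≠ 0 ∧ gramDet p.1 p.2 ≠ 0} := by
    refine continuousOn_const.sub (continuousOn_finsetSum _ fun i _ =>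
      continuousOn_finsetSum _ fun k _ => ContinuousOn.smul (ContinuousOn.mul
        (continuous_gramDet.continuousOn.inv₀ fun p hp => hp.2)
        (continuous_gram_reduced.matrix_adjugate.matrix_elem i k).continuousOn) ?_)
    have h1 := continuous_reduced (d := d) i
    have h2 := continuous_reduced (d := d) k
    have h3 : Continuous fun p : E d × E d => (innerSL ℝ p.1).smulRight p.2 := by fun_prop
    exact (h3.comp (h2.prodMk h1)).continuousOn
  refine (hu.prodMk hL).congr fun p hp => ?_
  simp only [Function.comp_apply]
  rw [flagOf_u x₀ hp, flagOf_L x₀ hp, flagSpace, Submodule.starProjection_orthogonal',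
    starProjection_span_range hp.2]
  simp only [Matrix.inv_def, Ring.inverse_eq_inv', Matrix.smul_apply, smul_eq_mul]
  rfl

lemma measurable_flagOf (x₀ : FlagManifold d (d - j)) :
    Measurable (flagOf x₀ : E d × (Fin j → E d) → FlagManifold d (d - j)) := by
  classical
  have h : (flagOf x₀ : E d × (Fin j → E d) → FlagManifold d (d - j)) =
      Set.piecewise {p : E d × (Fin j → E d) | p.1 ≠ 0 ∧ gramDet p.1 p.2 ≠ 0}
        (flagOf x₀) (fun _ => x₀) := by
    ext1 p
    by_cases hp : p ∈ {p : E d × (Fin j → E d) | p.1 ≠ 0 ∧ gramDet p.1 p.2 ≠ 0}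
    · rw [Set.piecewise_eq_of_mem _ _ _ hp]
    · rw [Set.piecewise_eq_of_notMem _ _ _ hp]
      exact dif_neg hp
  rw [h]
  exact ContinuousOn.measurable_piecewise (continuousOn_flagOf x₀) continuousOn_const
    isOpen_nondegenerate.measurableSet

lemma exists_frame (hj : j ≤ d) (x : FlagManifold d (d - j)) :
    ∃ a : Fin j → E d, Orthonormal ℝ a ∧ (∀ i, inner ℝ x.u (a i) = 0) ∧
      Submodule.span ℝ (Set.range a) = x.Lᗮ := by
  have h1 : Module.finrank ℝ x.Lᗮ = j := by
    have h2 := x.L.finrank_add_finrank_orthogonal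
    rw [x.finrank_L, finrank_euclideanSpace_fin] at h2
    omega
  let b := (stdOrthonormalBasis ℝ x.Lᗮ).reindex (finCongr h1)
  refine ⟨fun i => b i, b.orthonormal.comp_linearIsometry x.Lᗮ.subtypeₗᵢ,
    fun i => (Submodule.mem_orthogonal _ _).1 (b i).2 _ x.mem, ?_⟩
  · have h2 := b.toBasis.span_eq
    have h3 := congrArg (Submodule.map x.Lᗮ.subtype) h2
    rw [Submodule.map_span, Submodule.map_top, Submodule.range_subtype, ← Set.range_comp] at h3
    simpa [Function.comp_def] using h3

lemma reduced_eq_self {u : E d} {a : Fin j → E d} (hu : ‖u‖ = 1)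
    (h : ∀ i, inner ℝ u (a i) = 0) : reduced u a = a := by
  ext1 i
  simp [reduced, hu, h i]

lemma gramDet_of_orthonormal {u : E d} {a : Fin j → E d} (hu : ‖u‖ = 1) (ha : Orthonormal ℝ a)
    (h : ∀ i, inner ℝ u (a i) = 0) : gramDet u a = 1 := by
  rw [gramDet, reduced_eq_self hu h, Matrix.gram_eq_one_iff_orthonormal.2 ha, Matrix.det_one]

lemma flagOf_frame (x₀ x : FlagManifold d (d - j)) {a : Fin j → E d} (ha : Orthonormal ℝ a)
    (h : ∀ i, inner ℝ x.u (a i) = 0) (hs : Submodule.span ℝ (Set.range a) = x.Lᗮ) :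
    flagOf x₀ (x.u, a) = x := by
  have hne : x.u ≠ 0 ∧ gramDet x.u a ≠ 0 := by
    rw [gramDet_of_orthonormal x.norm_u ha h]
    exact ⟨norm_ne_zero_iff.1 (by rw [x.norm_u]; exact one_ne_zero), one_ne_zero⟩
  refine FlagManifold.ext ?_ ?_
  · rw [flagOf_u x₀ hne, x.norm_u, inv_one, one_smul]
  · rw [flagOf_L x₀ hne, flagSpace, reduced_eq_self x.norm_u h, hs,
      Submodule.orthogonal_orthogonal]

/-- The flag manifold is the continuous image of a Stiefel manifold. -/
lemma compactSpace_flag (hj : j ≤ d) : CompactSpace (FlagManifold d (d - j)) := by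
  rcases isEmpty_or_nonempty (FlagManifold d (d - j)) with he | ⟨⟨x₀⟩⟩
  · infer_instance
  let S : Set (E d × (Fin j → E d)) :=
    {p | ‖p.1‖ = 1 ∧ Matrix.gram ℝ p.2 = 1 ∧ ∀ i, inner ℝ p.1 (p.2 i) = 0}
  have hS : IsCompact S := by
    refine Metric.isCompact_of_isClosed_isBounded ?_ ?_
    · refine (isClosed_eq (by fun_prop) continuous_const).inter (IsClosed.inter
        (isClosed_eq (continuous_matrix fun i k => ?_) continuous_const) ?_)
      · simp only [Matrix.gram_apply]; fun_prop
      · change IsClosed {p : E d × (Fin j → E d) | ∀ i, inner ℝ p.1 (p.2 i) = 0}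
        rw [Set.ofPred_forall]
        exact isClosed_iInter fun i => isClosed_eq (by fun_prop) continuous_const
    · refine (isBounded_closedBall (x := (0 : E d × (Fin j → E d))) (r := 1)).subset fun p hp => ?_
      have ha := Matrix.gram_eq_one_iff_orthonormal.1 hp.2.1
      rw [mem_closedBall_zero_iff, Prod.norm_def]
      exact max_le hp.1.le ((pi_norm_le_iff_of_nonneg zero_le_one).2 fun i => (ha.1 i).le)
  have himg : flagOf x₀ '' S = Set.univ := by
    refine Set.eq_univ_of_forall fun x => ?_
    obtain ⟨a, ha, h, hs⟩ := exists_frame hj x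
    exact ⟨(x.u, a), ⟨x.norm_u, Matrix.gram_eq_one_iff_orthonormal.2 ha, h⟩,
      flagOf_frame x₀ x ha h hs⟩
  rw [← isCompact_univ_iff, ← himg]
  refine hS.image_of_continuousOn ((continuousOn_flagOf x₀).mono fun p hp => ?_)
  refine ⟨norm_ne_zero_iff.1 (by rw [hp.1]; exact one_ne_zero), ?_⟩
  rw [gramDet_of_orthonormal hp.1 (Matrix.gram_eq_one_iff_orthonormal.1 hp.2.1) hp.2.2]
  exact one_ne_zero

lemma nonempty_flag (hj : 1 ≤ d - j) : Nonempty (FlagManifold d (d - j)) := by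
  have hd : d - j ≤ d := Nat.sub_le _ _
  let e : Fin (d - j) → E d := fun i => EuclideanSpace.basisFun (Fin d) ℝ (Fin.castLE hd i)
  have he : Orthonormal ℝ e :=
    (EuclideanSpace.basisFun (Fin d) ℝ).orthonormal.comp _ (Fin.castLE_injective hd)
  exact ⟨⟨e ⟨0, hj⟩, Submodule.span ℝ (Set.range e), he.1 _,
    by rw [finrank_span_eq_card he.linearIndependent, Fintype.card_fin],
    Submodule.subset_span ⟨_, rfl⟩⟩⟩

/-! ### The weight -/

/-- A cut-off function. -/
def cut (t : ℝ) : ℝ := max 0 (1 - t)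

@[fun_prop] lemma continuous_cut : Continuous cut := by unfold cut; fun_prop

lemma cut_nonneg (t : ℝ) : 0 ≤ cut t := le_max_left _ _

lemma cut_le_one {t : ℝ} (ht : 0 ≤ t) : cut t ≤ 1 := max_le zero_le_one (by linarith)

lemma lt_one_of_cut_ne_zero {t : ℝ} (h : cut t ≠ 0) : t < 1 := by
  by_contra! ht
  exact h (max_eq_left (by linarith))

lemma cut_pos {t : ℝ} (h : t < 1) : 0 < cut t := lt_max_of_lt_right (by linarith)

/-- The weight of a vector `u` and a frame `a`. It has bounded support, and the factor `gramDet`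
makes it vanish where `flagOf` degenerates. -/
def weight (p : E d × (Fin j → E d)) : ℝ :=
  cut (‖p.1‖ ^ 2) * (cut (∑ i, ‖p.2 i‖ ^ 2) * gramDet p.1 p.2)

lemma continuous_weight : Continuous (weight : E d × (Fin j → E d) → ℝ) :=
  Continuous.mul (by fun_prop) (Continuous.mul (by fun_prop) continuous_gramDet)

lemma weight_nonneg (p : E d × (Fin j → E d)) : 0 ≤ weight p :=
  mul_nonneg (cut_nonneg _) (mul_nonneg (cut_nonneg _) (gramDet_nonneg _ _))

lemma norm_le_of_weight_ne_zero {p : E d × (Fin j → E d)} (h : weight p ≠ 0) :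
    ‖p.1‖ ≤ 1 ∧ ∀ i, ‖p.2 i‖ ≤ 1 := by
  have h1 := lt_one_of_cut_ne_zero (left_ne_zero_of_mul h)
  have h2 := lt_one_of_cut_ne_zero (left_ne_zero_of_mul (right_ne_zero_of_mul h))
  refine ⟨by nlinarith [norm_nonneg p.1], fun i => ?_⟩
  have h3 : ‖p.2 i‖ ^ 2 ≤ ∑ i, ‖p.2 i‖ ^ 2 :=
    Finset.single_le_sum (f := fun i => ‖p.2 i‖ ^ 2) (fun _ _ => by positivity)
      (Finset.mem_univ i)
  nlinarith [norm_nonneg (p.2 i)]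

lemma exists_weight_le (d j : ℕ) :
    ∃ C : ℝ, 0 ≤ C ∧ ∀ p : E d × (Fin j → E d), weight p ≤ C := by
  obtain ⟨C, hC⟩ := (isCompact_closedBall (0 : E d × (Fin j → E d)) 1).bddAbove_image
    continuous_weight.continuousOn
  refine ⟨max C 0, le_max_right _ _, fun p => ?_⟩
  by_cases hp : weight p = 0
  · rw [hp]; exact le_max_right _ _
  · obtain ⟨h1, h2⟩ := norm_le_of_weight_ne_zero hp
    refine (hC ⟨p, ?_, rfl⟩).trans (le_max_left _ _)
    rw [mem_closedBall_zero_iff, Prod.norm_def]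
    exact max_le h1 ((pi_norm_le_iff_of_nonneg zero_le_one).2 h2)

lemma nondegenerate_of_weight_ne_zero (hj : 1 ≤ j) {p : E d × (Fin j → E d)} (h : weight p ≠ 0) :
    p.1 ≠ 0 ∧ gramDet p.1 p.2 ≠ 0 := by
  have h1 := right_ne_zero_of_mul (right_ne_zero_of_mul h)
  refine ⟨fun h0 => h1 ?_, h1⟩
  rw [h0, gramDet_zero hj]

lemma continuous_weight_mul (hj : 1 ≤ j) (x₀ : FlagManifold d (d - j))
    {f : FlagManifold d (d - j) → ℝ} (hf : Continuous f) {C : ℝ} (hC : ∀ x, |f x| ≤ C) :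
    Continuous fun p : E d × (Fin j → E d) => weight p * f (flagOf x₀ p) := by
  rw [continuous_iff_continuousAt]
  intro p
  by_cases hp : p.1 ≠ 0 ∧ gramDet p.1 p.2 ≠ 0
  · exact continuous_weight.continuousAt.mul (hf.continuousAt.comp
      ((continuousOn_flagOf x₀).continuousAt (isOpen_nondegenerate.mem_nhds hp)))
  · have h0 : weight p = 0 := by
      by_contra h
      exact hp (nondegenerate_of_weight_ne_zero hj h)
    rw [ContinuousAt, h0, zero_mul]
    refine squeeze_zero_norm (a := fun p => weight p * C) (fun p => ?_) ?_
    · rw [norm_mul, Real.norm_of_nonneg (weight_nonneg p)]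
      exact mul_le_mul_of_nonneg_left (hC _) (weight_nonneg p)
    · have h1 : Continuous fun p : E d × (Fin j → E d) => weight p * C :=
        continuous_weight.mul continuous_const
      simpa [h0] using h1.tendsto p

/-! ### The auxiliary measure on flags -/

/-- The normal vector `w + comb a (mult K a w x)` of `K`, together with the frame `a`. -/
def normalVec (K : ConvexBody (E d)) (p : Param d j) : E d × (Fin j → E d) :=
  (p.1.2 + comb p.1.1 (mult K p.1.1 p.1.2 p.2), p.1.1)

/-- The density of the parameter measure. The first factor confines the multiplier to the interior
of the unit ball, where the constraint on its norm is not active. -/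
def density (K : ConvexBody (E d)) (p : Param d j) : ℝ :=
  cut (‖mult K p.1.1 p.1.2 p.2‖ ^ 2) * weight (normalVec K p)

lemma measurable_normalVec (K : ConvexBody (E d)) :
    Measurable (normalVec K : Param d j → E d × (Fin j → E d)) := by
  have h1 : Continuous fun p : Param d j × E j => comb p.1.1.1 p.2 :=
    continuous_comb (by fun_prop) (by fun_prop)
  have h2 := h1.measurable.comp (measurable_id.prodMk (measurable_mult (j := j) K))
  simp only [Function.comp_def, id] at h2
  exact Measurable.prodMk (Measurable.add (by fun_prop) h2) (by fun_prop)

lemma measurable_density (K : ConvexBody (E d)) : Measurable (density K : Param d j → ℝ) :=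
  (continuous_cut.measurable.comp ((measurable_mult K).norm.pow_const 2)).mul
    (continuous_weight.measurable.comp (measurable_normalVec K))

lemma density_nonneg (K : ConvexBody (E d)) (p : Param d j) : 0 ≤ density K p :=
  mul_nonneg (cut_nonneg _) (weight_nonneg _)

/-- The parameters carrying mass lie in a bounded set, depending only on a bound for `K`. -/
lemma mem_closedBall_of_density_ne_zero {K : ConvexBody (E d)} {R : ℝ} (hR0 : 0 ≤ R)
    (hR : ∀ y ∈ (K : Set (E d)), ‖y‖ ≤ R) {p : Param d j}
    (hp : DifferentiableAt ℝ (val K p.1.1 p.1.2) p.2) (h : density K p ≠ 0) :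
    p ∈ closedBall 0 (1 + j + j * R) := by
  obtain ⟨⟨a, w⟩, x⟩ := p
  have hl : ‖mult K a w x‖ < 1 := by
    have := lt_one_of_cut_ne_zero (left_ne_zero_of_mul h)
    simp only at this
    nlinarith [norm_nonneg (mult K a w x)]
  obtain ⟨hu, ha⟩ := norm_le_of_weight_ne_zero (right_ne_zero_of_mul h)
  simp only [normalVec] at hu ha
  have hx := norm_le_of_norm_mult_lt hp hl hR ha hR0
  have hc : ‖comb a (mult K a w x)‖ ≤ j := by
    refine (norm_comb_le a _ ha).trans ?_
    have : ‖mult K a w x‖ * 1 ≤ 1 := by linarith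
    nlinarith [(Nat.cast_nonneg j : (0 : ℝ) ≤ j)]
  have hw : ‖w‖ ≤ 1 + j := by
    have := norm_sub_le (w + comb a (mult K a w x)) (comb a (mult K a w x))
    rw [add_sub_cancel_right] at this
    linarith
  have ha' : ‖a‖ ≤ 1 := (pi_norm_le_iff_of_nonneg zero_le_one).2 ha
  have hj0 : (0 : ℝ) ≤ j := Nat.cast_nonneg j
  have hjR : 0 ≤ j * R := by positivity
  rw [mem_closedBall_zero_iff, Prod.norm_def, Prod.norm_def]
  exact max_le (max_le (by linarith) (by linarith)) (by linarith)

lemma exists_density_le (d j : ℕ) :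
    ∃ C : ℝ, 0 ≤ C ∧ ∀ (K : ConvexBody (E d)) (p : Param d j), density K p ≤ C := by
  obtain ⟨C, hC0, hC⟩ := exists_weight_le d j
  refine ⟨C, hC0, fun K p => ?_⟩
  have := mul_le_mul (cut_le_one (sq_nonneg ‖mult K p.1.1 p.1.2 p.2‖)) (hC (normalVec K p))
    (weight_nonneg _) zero_le_one
  simpa [density] using this

/-- Up to a constant factor, the flag measure of `K`. -/
def auxMeasure (x₀ : FlagManifold d (d - j)) (K : ConvexBody (E d)) :
    Measure (FlagManifold d (d - j)) :=
  ((volume : Measure (Param d j)).withDensity fun p => ENNReal.ofReal (density K p)).map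
    fun p => flagOf x₀ (normalVec K p)

lemma measurable_flagOf_normalVec (x₀ : FlagManifold d (d - j)) (K : ConvexBody (E d)) :
    Measurable fun p : Param d j => flagOf x₀ (normalVec K p) :=
  (measurable_flagOf x₀).comp (measurable_normalVec K)

lemma lintegral_auxMeasure (x₀ : FlagManifold d (d - j)) (K : ConvexBody (E d))
    {G : FlagManifold d (d - j) → ENNReal} (hG : Measurable G) :
    ∫⁻ x, G x ∂(auxMeasure x₀ K) =
      ∫⁻ p : Param d j, ENNReal.ofReal (density K p) * G (flagOf x₀ (normalVec K p)) := by
  rw [auxMeasure, lintegral_map hG (measurable_flagOf_normalVec x₀ K)]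
  exact lintegral_withDensity_eq_lintegral_mul _ (measurable_density K).ennreal_ofReal
    (hG.comp (measurable_flagOf_normalVec x₀ K))

lemma integral_auxMeasure (x₀ : FlagManifold d (d - j)) (K : ConvexBody (E d))
    {f : FlagManifold d (d - j) → ℝ} (hf : Continuous f) :
    ∫ x, f x ∂(auxMeasure x₀ K) =
      ∫ p : Param d j, density K p * f (flagOf x₀ (normalVec K p)) := by
  rw [auxMeasure, integral_map (measurable_flagOf_normalVec x₀ K).aemeasurable
    hf.measurable.aestronglyMeasurable,
    integral_withDensity_eq_integral_toReal_smul (measurable_density K).ennreal_ofReal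
      (Filter.Eventually.of_forall fun _ => ENNReal.ofReal_lt_top)]
  simp only [ENNReal.toReal_ofReal (density_nonneg K _), smul_eq_mul]

instance isFiniteMeasure_auxMeasure (x₀ : FlagManifold d (d - j)) (K : ConvexBody (E d)) :
    IsFiniteMeasure (auxMeasure x₀ K) := by
  refine ⟨?_⟩
  rw [← lintegral_one, lintegral_auxMeasure x₀ K measurable_const]
  obtain ⟨R, hR0, hR⟩ := exists_norm_le K
  obtain ⟨C, -, hC⟩ := exists_density_le d j
  have hle : ∫⁻ p : Param d j, ENNReal.ofReal (density K p) * 1 ≤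
      ∫⁻ p : Param d j, (closedBall 0 (1 + j + j * R)).indicator
        (fun _ => ENNReal.ofReal C) p := by
    refine lintegral_mono_ae ?_
    filter_upwards [ae_param_differentiableAt K] with p hp
    by_cases h : density K p = 0
    · simp [h]
    · rw [Set.indicator_of_mem (mem_closedBall_of_density_ne_zero hR0 hR hp h), mul_one]
      exact ENNReal.ofReal_le_ofReal (hC K p)
  refine hle.trans_lt ?_
  rw [lintegral_indicator isClosed_closedBall.measurableSet, setLIntegral_const]
  exact ENNReal.mul_lt_top ENNReal.ofReal_lt_top (isCompact_closedBall _ _).measure_lt_top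

/-- Weak continuity of the auxiliary measure, by dominated convergence. -/
lemma tendsto_integral_auxMeasure (hj : 1 ≤ j) (x₀ : FlagManifold d (d - j))
    {K : ℕ → ConvexBody (E d)} {K₀ : ConvexBody (E d)} (hK : Tendsto K atTop (𝓝 K₀))
    {f : FlagManifold d (d - j) → ℝ} (hf : Continuous f) {C : ℝ} (hC : ∀ x, |f x| ≤ C) :
    Tendsto (fun n => ∫ x, f x ∂(auxMeasure x₀ (K n))) atTop
      (𝓝 (∫ x, f x ∂(auxMeasure x₀ K₀))) := by
  simp only [integral_auxMeasure x₀ _ hf]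
  obtain ⟨R, hR0, hR⟩ := exists_norm_le K₀
  obtain ⟨B, hB0, hB⟩ := exists_density_le d j
  have hev : ∀ᶠ n in atTop, dist (K n) K₀ < 1 := hK.eventually (ball_mem_nhds K₀ one_pos)
  refine tendsto_integral_filter_of_dominated_convergence
    ((closedBall 0 (1 + j + j * (R + 1))).indicator fun _ => B * C) ?_ ?_ ?_ ?_
  · exact Filter.Eventually.of_forall fun n => ((measurable_density (K n)).mul
      (hf.measurable.comp (measurable_flagOf_normalVec x₀ (K n)))).aestronglyMeasurable
  · filter_upwards [hev] with n hn
    filter_upwards [ae_param_differentiableAt (j := j) (K n)] with p hp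
    have hC0 : 0 ≤ C := (abs_nonneg _).trans (hC x₀)
    by_cases h : density (K n) p = 0
    · rw [h, zero_mul, norm_zero]
      exact Set.indicator_nonneg (fun _ _ => by positivity) p
    · rw [Set.indicator_of_mem (mem_closedBall_of_density_ne_zero (by positivity)
        (norm_le_of_dist_le hR hn) hp h), norm_mul, Real.norm_of_nonneg (density_nonneg _ _)]
      exact mul_le_mul (hB _ _) (hC _) (norm_nonneg _) hB0
  · refine (integrable_indicator_iff isClosed_closedBall.measurableSet).2 ?_
    exact integrableOn_const (isCompact_closedBall _ _).measure_lt_top.ne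
  · filter_upwards [ae_param_differentiableAt K₀,
      ae_all_iff.2 fun n => ae_param_differentiableAt (K n)] with p h₀ hn
    have hl := tendsto_mult hK hn h₀
    have hcomb : Continuous fun l : E j => (p.1.2 + comb p.1.1 l, p.1.1) :=
      (continuous_const.add (continuous_comb continuous_const continuous_id)).prodMk
        continuous_const
    have hc : Continuous fun l : E j => cut (‖l‖ ^ 2) *
        (weight (p.1.2 + comb p.1.1 l, p.1.1) * f (flagOf x₀ (p.1.2 + comb p.1.1 l, p.1.1))) :=
      Continuous.mul (by fun_prop) ((continuous_weight_mul hj x₀ hf hC).comp hcomb)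
    have := (hc.tendsto _).comp hl
    simpa only [Function.comp_def, density, normalVec, mul_assoc] using this

/-- The auxiliary measure is a valuation. -/
lemma auxMeasure_union_add_inter (x₀ : FlagManifold d (d - j)) {K M U I : ConvexBody (E d)}
    (hU : (U : Set (E d)) = (K : Set (E d)) ∪ (M : Set (E d)))
    (hI : (I : Set (E d)) = (K : Set (E d)) ∩ (M : Set (E d))) :
    auxMeasure x₀ U + auxMeasure x₀ I = auxMeasure x₀ K + auxMeasure x₀ M := by
  refine Measure.ext_of_lintegral _ fun G hG => ?_
  have hm : ∀ K : ConvexBody (E d), Measurable fun p : Param d j =>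
      ENNReal.ofReal (density K p) * G (flagOf x₀ (normalVec K p)) := fun K =>
    (measurable_density K).ennreal_ofReal.mul (hG.comp (measurable_flagOf_normalVec x₀ K))
  simp only [lintegral_add_measure, lintegral_auxMeasure x₀ _ hG]
  rw [← lintegral_add_left (hm U), ← lintegral_add_left (hm K)]
  refine lintegral_congr_ae ?_
  filter_upwards [ae_param_differentiableAt K, ae_param_differentiableAt M,
    ae_param_differentiableAt U, ae_param_differentiableAt I] with p h1 h2 h3 h4
  rcases mult_union_inter hU hI h1 h2 h3 h4 with ⟨h5, h6⟩ | ⟨h5, h6⟩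
  · simp only [density, normalVec, h5, h6]; rw [add_comm]
  · simp only [density, normalVec, h5, h6]

/-! ### Invariant measures under transitive compact groups -/

/-- Finite measures concentrated on an orbit of a group with an invariant probability measure are
proportional if they are invariant under the group: both are determined by the averages of
functions over the group. -/
lemma smul_eq_smul_of_invariant {G X : Type*} [Group G] [MeasurableSpace G] [MeasurableMul₂ G]
    [MeasurableInv G] (m : Measure G) [IsProbabilityMeasure m] [m.IsMulLeftInvariant]
    [MeasurableSpace X] {act : G → X → X} (hact : Measurable (Function.uncurry act))
    (hmul : ∀ g h x, act (g * h) x = act g (act h x)) {S : Set X}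
    (htrans : ∀ x ∈ S, ∀ y ∈ S, ∃ g, act g x = y) (μ ν : Measure X) [IsFiniteMeasure μ]
    [IsFiniteMeasure ν] (hμ : ∀ g, μ.map (act g) = μ) (hν : ∀ g, ν.map (act g) = ν)
    (hμS : ∀ᵐ x ∂μ, x ∈ S) (hνS : ∀ᵐ x ∂ν, x ∈ S) :
    ν Set.univ • μ = μ Set.univ • ν := by
  have hactg : ∀ g, Measurable (act g) := fun g => hact.comp measurable_prodMk_left
  let J : (X → ENNReal) → X → ENNReal := fun f x => ∫⁻ g, f (act g⁻¹ x) ∂m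
  have hJ : ∀ f, ∀ x ∈ S, ∀ y ∈ S, J f x = J f y := by
    intro f x hx y hy
    obtain ⟨h, rfl⟩ := htrans x hx y hy
    have h1 := lintegral_mul_left_eq_self (μ := m) (fun g => f (act g⁻¹ (act h x))) h
    simp only [J]
    rw [← h1]
    refine lintegral_congr fun g => ?_
    rw [← hmul, mul_inv_rev, inv_mul_cancel_right]
  have havg : ∀ (ρ : Measure X) [IsFiniteMeasure ρ], (∀ g, ρ.map (act g) = ρ) →
      ∀ f : X → ENNReal, Measurable f → ∫⁻ x, f x ∂ρ = ∫⁻ x, J f x ∂ρ := by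
    intro ρ _ hρ f hf
    have hm : Measurable (Function.uncurry fun x g => f (act g⁻¹ x)) :=
      hf.comp (hact.comp ((measurable_snd.inv).prodMk measurable_fst))
    simp only [J]
    rw [lintegral_lintegral_swap hm.aemeasurable]
    have : ∀ g, ∫⁻ x, f (act g⁻¹ x) ∂ρ = ∫⁻ x, f x ∂ρ := fun g => by
      conv_rhs => rw [← hρ g⁻¹]
      rw [lintegral_map hf (hactg _)]
    simp [this]
  rcases S.eq_empty_or_nonempty with rfl | ⟨x₀, hx₀⟩
  · have h1 : μ = 0 := by simpa using hμS
    have h2 : ν = 0 := by simpa using hνS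
    rw [h1, h2]
  · refine Measure.ext_of_lintegral _ fun f hf => ?_
    have h : ∀ (ρ : Measure X) [IsFiniteMeasure ρ], (∀ g, ρ.map (act g) = ρ) →
        (∀ᵐ x ∂ρ, x ∈ S) → ∫⁻ x, f x ∂ρ = J f x₀ * ρ Set.univ := by
      intro ρ _ hρ hρS
      rw [havg ρ hρ f hf, ← lintegral_const]
      exact lintegral_congr_ae (hρS.mono fun x hx => hJ f x hx x₀ hx₀)
    rw [lintegral_smul_measure, lintegral_smul_measure, h μ hμ hμS, h ν hν hνS, smul_eq_mul,
      smul_eq_mul]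
    ring

/-! ### Rotations -/

lemma exists_isometry_of_orthonormal {ι : Type*} [Fintype ι] {v w : ι → E d}
    (hv : Orthonormal ℝ v) (hw : Orthonormal ℝ w) :
    ∃ T : E d ≃ₗᵢ[ℝ] E d, ∀ i, T (v i) = w i := by
  let b := Module.Basis.span hv.linearIndependent
  let f : Submodule.span ℝ (Set.range v) →ₗ[ℝ] E d := b.constr ℝ w
  have hb : Orthonormal ℝ b := by
    refine (Submodule.span ℝ (Set.range v)).subtypeₗᵢ.orthonormal_comp_iff.1 ?_
    convert hv using 1
    ext1 i
    exact congrArg Subtype.val (Module.Basis.span_apply hv.linearIndependent i)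
  have hf : ⇑f ∘ ⇑b = w := by ext1 i; exact b.constr_basis ℝ w i
  let g := f.isometryOfOrthonormal hb (hf ▸ hw)
  refine ⟨g.extend.toLinearIsometryEquiv rfl, fun i => ?_⟩
  have h1 : v i = (b i : E d) :=
    (congrArg Subtype.val (Module.Basis.span_apply hv.linearIndependent i)).symm
  rw [LinearIsometry.toLinearIsometryEquiv_apply, h1, LinearIsometry.extend_apply]
  exact congrFun hf i

lemma abs_det_isometry (T : E d ≃ₗᵢ[ℝ] E d) :
    LinearMap.det (T.toLinearEquiv : E d →ₗ[ℝ] E d) = 1 ∨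
      LinearMap.det (T.toLinearEquiv : E d →ₗ[ℝ] E d) = -1 := by
  have h := LinearMap.normDet_eq_abs_det (T.toLinearEquiv : E d →ₗ[ℝ] E d)
  rw [show (T.toLinearEquiv : E d →ₗ[ℝ] E d) = T.toLinearIsometry.toLinearMap from rfl,
    LinearIsometry.normDet_eq_one] at h
  exact eq_or_eq_neg_of_abs_eq h.symm

/-- A rotation with prescribed values on fewer than `d` orthonormal vectors; the last dimension is
used to correct the sign of the determinant. -/
lemma exists_rotation_of_orthonormal {ι : Type*} [Fintype ι] (hι : Fintype.card ι < d)
    {v w : ι → E d} (hv : Orthonormal ℝ v) (hw : Orthonormal ℝ w) :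
    ∃ ρ : unitary (E d →L[ℝ] E d), (ρ : E d →L[ℝ] E d).det = 1 ∧
      ∀ i, (ρ : E d →L[ℝ] E d) (v i) = w i := by
  suffices h : ∃ T : E d ≃ₗᵢ[ℝ] E d, LinearMap.det (T.toLinearEquiv : E d →ₗ[ℝ] E d) = 1 ∧
      ∀ i, T (v i) = w i by
    obtain ⟨T, hT, h⟩ := h
    exact ⟨Unitary.linearIsometryEquiv.symm T, hT, h⟩
  obtain ⟨T, hT⟩ := exists_isometry_of_orthonormal hv hw
  rcases abs_det_isometry T with h | h
  · exact ⟨T, h, hT⟩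
  · have hne : Submodule.span ℝ (Set.range v) ≠ ⊤ := by
      intro htop
      have := finrank_span_eq_card hv.linearIndependent
      rw [htop, finrank_top, finrank_euclideanSpace_fin] at this
      omega
    obtain ⟨e, he, he0⟩ := (Submodule.ne_bot_iff _).1
      (fun h0 => hne ((Submodule.orthogonal_eq_bot_iff).1 h0))
    let r := (ℝ ∙ e)ᗮ.reflection
    have hr : LinearMap.det r.toLinearMap = -1 := by
      rw [Submodule.det_reflection, Submodule.orthogonal_orthogonal, finrank_span_singleton he0,
        pow_one]
    refine ⟨r.trans T, ?_, fun i => ?_⟩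
    · have : ((r.trans T).toLinearEquiv : E d →ₗ[ℝ] E d)
          = (T.toLinearEquiv : E d →ₗ[ℝ] E d) ∘ₗ r.toLinearMap := rfl
      rw [this, LinearMap.det_comp, h, hr]; norm_num
    · have hmem : v i ∈ (ℝ ∙ e)ᗮ := by
        rw [Submodule.mem_orthogonal_singleton_iff_inner_left]
        exact (Submodule.mem_orthogonal _ _).1 he _ (Submodule.subset_span ⟨i, rfl⟩)
      rw [LinearIsometryEquiv.trans_apply, Submodule.reflection_mem_subspace_eq_self hmem, hT]

/-- The Haar probability measure used in `fibreMeasure`. -/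
abbrev rotationHaar (u : E d) : Measure (rotationsFixing u) :=
  Measure.haarMeasure (⊤ : TopologicalSpace.PositiveCompacts (rotationsFixing u))

instance (u : E d) : IsProbabilityMeasure (rotationHaar u) :=
  ⟨Measure.haarMeasure_self⟩

instance (u : E d) : SecondCountableTopology (rotationsFixing u) :=
  inferInstanceAs (SecondCountableTopology
    {ρ : {T : E d →L[ℝ] E d // T ∈ unitary (E d →L[ℝ] E d)} // ρ ∈ rotationsFixing u})

/-! ### The invariant measures on the fibres of the flag manifold -/

/-- The image of a flag under an orthogonal map. -/
def actFlag (ρ : unitary (E d →L[ℝ] E d)) (x : FlagManifold d q) : FlagManifold d q where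
  u := (ρ : E d →L[ℝ] E d) x.u
  L := x.L.map (ρ : E d →L[ℝ] E d).toLinearMap
  norm_u := by rw [unitary_norm_map, x.norm_u]
  finrank_L := by
    have hinj : Function.Injective (ρ : E d →L[ℝ] E d).toLinearMap :=
      (Unitary.linearIsometryEquiv ρ).injective
    exact (Submodule.equivMapOfInjective _ hinj x.L).finrank_eq.symm.trans x.finrank_L
  mem := ⟨x.u, x.mem, rfl⟩

lemma actFlag_mul (ρ σ : unitary (E d →L[ℝ] E d)) (x : FlagManifold d q) :
    actFlag (ρ * σ) x = actFlag ρ (actFlag σ x) :=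
  FlagManifold.ext rfl (Submodule.map_comp (σ : E d →L[ℝ] E d).toLinearMap
    (ρ : E d →L[ℝ] E d).toLinearMap x.L)

lemma continuous_actFlag :
    Continuous fun p : unitary (E d →L[ℝ] E d) × FlagManifold d q => actFlag p.1 p.2 := by
  rw [(isInducing_flag d q).continuous_iff]
  have hflag := (isInducing_flag d q).continuous
  have hu : Continuous fun p : unitary (E d →L[ℝ] E d) × FlagManifold d q => p.2.u :=
    hflag.fst.comp continuous_snd
  have hL : Continuous fun p : unitary (E d →L[ℝ] E d) × FlagManifold d q =>
      p.2.L.starProjection := hflag.snd.comp continuous_snd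
  have hρ : Continuous fun p : unitary (E d →L[ℝ] E d) × FlagManifold d q =>
      (p.1 : E d →L[ℝ] E d) := continuous_subtype_val.comp continuous_fst
  have h : Continuous fun p : unitary (E d →L[ℝ] E d) × FlagManifold d q =>
      ((p.1 : E d →L[ℝ] E d) p.2.u,
        (p.1 : E d →L[ℝ] E d) * p.2.L.starProjection * star (p.1 : E d →L[ℝ] E d)) :=
    (hρ.clm_apply hu).prodMk ((hρ.mul hL).mul hρ.star)
  refine h.congr fun p => Prod.ext rfl ?_
  ext1 v
  exact (Submodule.starProjection_map_apply (Unitary.linearIsometryEquiv p.1) p.2.L v).symm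

lemma rotate_eq_actFlag (x : FlagManifold d q) (ρ : rotationsFixing x.u) :
    x.rotate ρ = actFlag (ρ : unitary (E d →L[ℝ] E d)) x :=
  FlagManifold.ext ρ.2.2.symm rfl

lemma measurable_actFlag (u : E d) : Measurable (Function.uncurry
    fun (ρ : rotationsFixing u) (x : FlagManifold d q) =>
      actFlag (ρ : unitary (E d →L[ℝ] E d)) x) := by
  have h : Continuous fun p : rotationsFixing u × FlagManifold d q =>
      ((p.1 : unitary (E d →L[ℝ] E d)), p.2) := by fun_prop
  exact (continuous_actFlag.comp h).measurable

lemma measurable_rotate (x : FlagManifold d q) : Measurable x.rotate := by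
  have h := (measurable_actFlag (q := q) x.u).comp (measurable_prodMk_right (y := x))
  convert h using 1
  exact funext fun ρ => rotate_eq_actFlag x ρ

instance (x : FlagManifold d q) : IsProbabilityMeasure (fibreMeasure x) :=
  Measure.isProbabilityMeasure_map (measurable_rotate x).aemeasurable

lemma map_actFlag_fibreMeasure (x : FlagManifold d q) (ρ : rotationsFixing x.u) :
    (fibreMeasure x).map (actFlag (ρ : unitary (E d →L[ℝ] E d))) = fibreMeasure x := by
  have hm : Measurable (actFlag (q := q) (ρ : unitary (E d →L[ℝ] E d))) :=
    (measurable_actFlag x.u).comp measurable_prodMk_left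
  rw [fibreMeasure, Measure.map_map hm (measurable_rotate x)]
  have h : actFlag (ρ : unitary (E d →L[ℝ] E d)) ∘ x.rotate = x.rotate ∘ fun σ => ρ * σ := by
    ext1 σ
    simp only [Function.comp_apply, rotate_eq_actFlag]
    rw [← actFlag_mul]
    rfl
  rw [h, ← Measure.map_map (measurable_rotate x) (measurable_const_mul ρ), map_mul_left_eq_self]

lemma ae_fibreMeasure (x : FlagManifold d q) : ∀ᵐ y ∂(fibreMeasure x), y.u = x.u := by
  have h : MeasurableSet {y : FlagManifold d q | y.u = x.u} :=
    (isClosed_eq (isInducing_flag d q).continuous.fst continuous_const).measurableSet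
  rw [fibreMeasure, ae_map_iff (measurable_rotate x).aemeasurable h]
  exact Filter.Eventually.of_forall fun _ => rfl

/-- The proper rotations that fix `u` act transitively on the flags with unit vector `u`. -/
lemma exists_rotationsFixing_actFlag_eq (hj : j + 2 ≤ d)
    (x y : FlagManifold d (d - j)) (hxy : x.u = y.u) (u : E d) (hu : x.u = u) :
    ∃ ρ : rotationsFixing u, actFlag (ρ : unitary (E d →L[ℝ] E d)) x = y := by
  obtain ⟨a, ha, hau, has⟩ := exists_frame (by omega) x
  obtain ⟨b, hb, hbu, hbs⟩ := exists_frame (by omega) y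
  have hon : ∀ (z : FlagManifold d (d - j)) (c : Fin j → E d), Orthonormal ℝ c →
      (∀ i, inner ℝ z.u (c i) = 0) →
      Orthonormal ℝ (fun o : Option (Fin j) => o.elim z.u c) := by
    intro z c hc hz
    refine ⟨fun o => ?_, fun o o' hoo => ?_⟩
    · cases o with
      | none => exact z.norm_u
      | some i => exact hc.1 i
    · cases o with
      | none => cases o' with
        | none => exact absurd rfl hoo
        | some i => exact hz i
      | some i => cases o' with
        | none => rw [real_inner_comm]; exact hz i
        | some k => exact hc.2 fun h => hoo (congrArg some h)
  obtain ⟨ρ, hdet, hρ⟩ := exists_rotation_of_orthonormal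
    (by rw [Fintype.card_option, Fintype.card_fin]; omega) (hon x a ha hau) (hon y b hb hbu)
  have hρu : (ρ : E d →L[ℝ] E d) x.u = y.u := hρ none
  refine ⟨⟨ρ, hdet, by rw [← hu, hρu, hxy]⟩, FlagManifold.ext hρu ?_⟩
  have h1 := Submodule.map_orthogonal_equiv x.Lᗮ (Unitary.linearIsometryEquiv ρ)
  rw [Submodule.orthogonal_orthogonal] at h1
  refine h1.trans ?_
  rw [← has, Submodule.map_span, ← Set.range_comp]
  have h2 : (⇑((Unitary.linearIsometryEquiv ρ).toLinearEquiv : E d →ₗ[ℝ] E d) ∘ a) = b :=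
    funext fun i => hρ (some i)
  have h3 : Submodule.span ℝ (Set.range
      (⇑((Unitary.linearIsometryEquiv ρ).toLinearEquiv : E d →ₗ[ℝ] E d) ∘ a)) = y.Lᗮ := by
    rw [h2, hbs]
  exact (congrArg Submodule.orthogonal h3).trans (Submodule.orthogonal_orthogonal _)

/-! ### The distribution of the flag of a random frame -/

/-- A weight for frames. One factor `gramDet` comes from `weight`, the other one from
`det_coord_sq`. -/
def frameWeight (u : E d) (a : Fin j → E d) : ℝ := cut (∑ i, ‖a i‖ ^ 2) * gramDet u a ^ 2

lemma frameWeight_nonneg (u : E d) (a : Fin j → E d) : 0 ≤ frameWeight u a :=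
  mul_nonneg (cut_nonneg _) (sq_nonneg _)

lemma continuous_frameWeight :
    Continuous fun p : E d × (Fin j → E d) => frameWeight p.1 p.2 :=
  Continuous.mul (by fun_prop) (continuous_gramDet.pow 2)

lemma continuous_frameWeight_right (u : E d) :
    Continuous fun a : Fin j → E d => frameWeight u a :=
  continuous_frameWeight.comp (f := fun a => (u, a)) (by fun_prop)

lemma norm_le_of_frameWeight_ne_zero {u : E d} {a : Fin j → E d} (h : frameWeight u a ≠ 0) :
    ‖a‖ ≤ 1 := by
  have h2 := lt_one_of_cut_ne_zero (left_ne_zero_of_mul h)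
  refine (pi_norm_le_iff_of_nonneg zero_le_one).2 fun i => ?_
  have h3 : ‖a i‖ ^ 2 ≤ ∑ i, ‖a i‖ ^ 2 :=
    Finset.single_le_sum (f := fun i => ‖a i‖ ^ 2) (fun _ _ => by positivity)
      (Finset.mem_univ i)
  nlinarith [norm_nonneg (a i)]

lemma det_gram_smul (c : ℝ) (v : Fin j → E d) :
    (Matrix.gram ℝ fun i => c • v i).det = (c ^ 2) ^ j * (Matrix.gram ℝ v).det := by
  have h : (Matrix.gram ℝ fun i => c • v i) = c ^ 2 • Matrix.gram ℝ v := by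
    ext i k
    simp only [Matrix.gram_apply, inner_smul_left, inner_smul_right, Matrix.smul_apply,
      smul_eq_mul, conj_trivial]
    ring
  rw [h, Matrix.det_smul, Fintype.card_fin]

lemma reduced_smul_left (r : ℝ) (u : E d) (a : Fin j → E d) :
    reduced (r • u) a = fun i => r ^ 2 • reduced u a i := by
  ext1 i
  simp only [reduced, norm_smul, inner_smul_left, conj_trivial, mul_pow, Real.norm_eq_abs, sq_abs]
  module

lemma gramDet_smul_left (r : ℝ) (u : E d) (a : Fin j → E d) :
    gramDet (r • u) a = ((r ^ 2) ^ 2) ^ j * gramDet u a := by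
  rw [gramDet, reduced_smul_left, det_gram_smul, gramDet]

lemma gramDet_smul_right (r : ℝ) (u : E d) (a : Fin j → E d) :
    gramDet u (r • a) = (r ^ 2) ^ j * gramDet u a := by
  have h : reduced u (r • a) = fun i => r • reduced u a i := by
    ext1 i
    simp only [reduced, Pi.smul_apply, inner_smul_right]
    module
  rw [gramDet, h, det_gram_smul, gramDet]

lemma flagSpace_smul_left {r : ℝ} (hr : r ≠ 0) (u : E d) (a : Fin j → E d) :
    flagSpace (r • u) a = flagSpace u a := by
  have h : Submodule.span ℝ (Set.range (reduced (r • u) a)) =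
      Submodule.span ℝ (Set.range (reduced u a)) := by
    rw [reduced_smul_left]
    have hr2 : IsUnit (r ^ 2) := (pow_ne_zero 2 hr).isUnit
    refine le_antisymm (Submodule.span_le.2 ?_) (Submodule.span_le.2 ?_)
    · rintro _ ⟨i, rfl⟩
      exact Submodule.smul_mem _ _ (Submodule.subset_span ⟨i, rfl⟩)
    · rintro _ ⟨i, rfl⟩
      have : reduced u a i = (r ^ 2)⁻¹ • r ^ 2 • reduced u a i := by
        rw [smul_smul, inv_mul_cancel₀ (pow_ne_zero 2 hr), one_smul]
      rw [SetLike.mem_coe, this]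
      exact Submodule.smul_mem _ _ (Submodule.subset_span ⟨i, rfl⟩)
  rw [flagSpace, h, flagSpace]

lemma flagOf_smul_left (x₀ : FlagManifold d (d - j)) {r : ℝ} (hr : 0 < r) (u : E d)
    (a : Fin j → E d) : flagOf x₀ (r • u, a) = flagOf x₀ (u, a) := by
  have hiff : (r • u ≠ 0 ∧ gramDet (r • u) a ≠ 0) ↔ (u ≠ 0 ∧ gramDet u a ≠ 0) := by
    rw [gramDet_smul_left, mul_ne_zero_iff, smul_ne_zero_iff]
    have : ((r ^ 2) ^ 2) ^ j ≠ 0 := by positivity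
    have := hr.ne'
    tauto
  by_cases h : u ≠ 0 ∧ gramDet u a ≠ 0
  · have h' := hiff.2 h
    refine FlagManifold.ext ?_ ?_
    · rw [flagOf_u x₀ (p := (r • u, a)) h', flagOf_u x₀ (p := (u, a)) h]
      simp only [norm_smul, Real.norm_of_nonneg hr.le, mul_inv, smul_smul]
      congr 1
      field_simp
    · rw [flagOf_L x₀ (p := (r • u, a)) h', flagOf_L x₀ (p := (u, a)) h]
      exact flagSpace_smul_left hr.ne' u a
  · rw [flagOf, dif_neg (fun hh => h (hiff.1 hh)), flagOf, dif_neg h]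

lemma reduced_isometry (T : E d ≃ₗᵢ[ℝ] E d) (u : E d) (a : Fin j → E d) :
    reduced (T u) (fun i => T (a i)) = fun i => T (reduced u a i) := by
  ext1 i
  simp only [reduced, T.norm_map, T.inner_map_map, map_sub, map_smul]

lemma gramDet_isometry (T : E d ≃ₗᵢ[ℝ] E d) (u : E d) (a : Fin j → E d) :
    gramDet (T u) (fun i => T (a i)) = gramDet u a := by
  rw [gramDet, reduced_isometry, gramDet]
  congr 1
  ext i k
  simp [Matrix.gram_apply, T.inner_map_map]

lemma frameWeight_isometry (T : E d ≃ₗᵢ[ℝ] E d) (u : E d) (a : Fin j → E d) :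
    frameWeight (T u) (fun i => T (a i)) = frameWeight u a := by
  simp only [frameWeight, T.norm_map, gramDet_isometry]

lemma measurePreserving_frame (T : E d ≃ₗᵢ[ℝ] E d) :
    MeasurePreserving (fun (a : Fin j → E d) i => T (a i)) :=
  volume_preserving_pi fun _ => T.measurePreserving

lemma flagOf_unitary (x₀ : FlagManifold d (d - j)) (ρ : unitary (E d →L[ℝ] E d)) {u : E d}
    {a : Fin j → E d} (h : u ≠ 0 ∧ gramDet u a ≠ 0) :
    flagOf x₀ ((ρ : E d →L[ℝ] E d) u, fun i => (ρ : E d →L[ℝ] E d) (a i)) =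
      actFlag ρ (flagOf x₀ (u, a)) := by
  let T := Unitary.linearIsometryEquiv ρ
  have h' : T u ≠ 0 ∧ gramDet (T u) (fun i => T (a i)) ≠ 0 := by
    rw [gramDet_isometry]
    exact ⟨by simpa using h.1, h.2⟩
  refine FlagManifold.ext ?_ ?_
  · rw [flagOf_u x₀ h']
    change ‖T u‖⁻¹ • T u = T (flagOf x₀ (u, a)).u
    rw [flagOf_u x₀ (p := (u, a)) h, T.norm_map, map_smul]
  · rw [flagOf_L x₀ h']
    change _ = (flagOf x₀ (u, a)).L.map (T.toLinearEquiv : E d →ₗ[ℝ] E d)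
    rw [flagOf_L x₀ (p := (u, a)) h]
    change flagSpace (T u) (fun i => T (a i)) = _
    rw [flagSpace, flagSpace, Submodule.map_orthogonal_equiv, Submodule.map_span,
      ← Set.range_comp, reduced_isometry]
    rfl

/-- The total mass of `frameWeight u`. -/
def frameMass (d j : ℕ) (u : E d) : ENNReal :=
  ∫⁻ a : Fin j → E d, ENNReal.ofReal (frameWeight u a)

lemma frameMass_eq {u v : E d} (hu : ‖u‖ = 1) (hv : ‖v‖ = 1) :
    frameMass d j u = frameMass d j v := by
  obtain ⟨T, hT⟩ := exists_isometry_of_orthonormal (ι := Unit) (v := fun _ => u) (w := fun _ => v)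
    ⟨fun _ => hu, fun _ _ h => absurd rfl h⟩ ⟨fun _ => hv, fun _ _ h => absurd rfl h⟩
  rw [frameMass, frameMass, ← (measurePreserving_frame T).lintegral_comp
    (continuous_frameWeight_right v).measurable.ennreal_ofReal, ← hT ()]
  simp only [frameWeight_isometry]

lemma frameMass_ne_top (u : E d) : frameMass d j u ≠ ⊤ := by
  obtain ⟨C, hC⟩ := (isCompact_closedBall (0 : Fin j → E d) 1).bddAbove_image
    (continuous_frameWeight_right u).continuousOn
  have hle : frameMass d j u ≤ ∫⁻ a : Fin j → E d,
      (closedBall 0 1).indicator (fun _ => ENNReal.ofReal C) a := by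
    refine lintegral_mono fun a => ?_
    by_cases h : frameWeight u a = 0
    · simp [h]
    · have hmem : a ∈ closedBall (0 : Fin j → E d) 1 := by
        simpa using norm_le_of_frameWeight_ne_zero h
      rw [Set.indicator_of_mem hmem]
      exact ENNReal.ofReal_le_ofReal (hC ⟨a, hmem, rfl⟩)
  refine (hle.trans_lt ?_).ne
  rw [lintegral_indicator isClosed_closedBall.measurableSet, setLIntegral_const]
  exact ENNReal.mul_lt_top ENNReal.ofReal_lt_top (isCompact_closedBall _ _).measure_lt_top

lemma frameMass_ne_zero (hj : j ≤ d) (x : FlagManifold d (d - j)) : frameMass d j x.u ≠ 0 := by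
  obtain ⟨a, ha, hau, -⟩ := exists_frame hj x
  let r : ℝ := (j + 1 : ℝ)⁻¹
  have hr : 0 < r := by positivity
  have hpos : 0 < frameWeight x.u (r • a) := by
    refine mul_pos (cut_pos ?_) ?_
    · have h1 : ∀ i, ‖(r • a) i‖ ^ 2 = r ^ 2 := fun i => by
        rw [Pi.smul_apply, norm_smul, ha.1 i, mul_one, Real.norm_of_nonneg hr.le]
      simp only [h1, Finset.sum_const, Finset.card_univ, Fintype.card_fin, nsmul_eq_mul]
      have h2 : r * (j + 1) = 1 := inv_mul_cancel₀ (by positivity)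
      have h3 : (0 : ℝ) ≤ j := Nat.cast_nonneg j
      nlinarith
    · rw [gramDet_smul_right, gramDet_of_orthonormal x.norm_u ha hau]
      positivity
  rw [frameMass, ← pos_iff_ne_zero, lintegral_pos_iff_support
    (continuous_frameWeight_right x.u).measurable.ennreal_ofReal]
  have hopen : IsOpen {a : Fin j → E d | 0 < frameWeight x.u a} :=
    isOpen_lt continuous_const (continuous_frameWeight_right x.u)
  refine (hopen.measure_pos volume ⟨_, hpos⟩).trans_le (measure_mono fun b hb => ?_)
  exact (ENNReal.ofReal_pos.2 hb).ne'

/-- The distribution of the flag of a random frame, given its first vector, is proportional to the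
invariant measure of the fibre. -/
lemma lintegral_frameWeight (hj : j + 2 ≤ d) (x₀ x : FlagManifold d (d - j))
    {G : FlagManifold d (d - j) → ENNReal} (hG : Measurable G) :
    ∫⁻ a : Fin j → E d, ENNReal.ofReal (frameWeight x.u a) * G (flagOf x₀ (x.u, a)) =
      frameMass d j x.u * ∫⁻ y, G y ∂(fibreMeasure x) := by
  have hu0 : x.u ≠ 0 := norm_ne_zero_iff.1 (by rw [x.norm_u]; exact one_ne_zero)
  have hmw : Measurable fun a : Fin j → E d => ENNReal.ofReal (frameWeight x.u a) :=
    (continuous_frameWeight_right x.u).measurable.ennreal_ofReal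
  have hmf : Measurable fun a : Fin j → E d => flagOf x₀ (x.u, a) :=
    (measurable_flagOf x₀).comp measurable_prodMk_left
  let μ : Measure (FlagManifold d (d - j)) :=
    ((volume : Measure (Fin j → E d)).withDensity fun a =>
      ENNReal.ofReal (frameWeight x.u a)).map fun a => flagOf x₀ (x.u, a)
  have hμ : ∀ H : FlagManifold d (d - j) → ENNReal, Measurable H → ∫⁻ y, H y ∂μ =
      ∫⁻ a : Fin j → E d, ENNReal.ofReal (frameWeight x.u a) * H (flagOf x₀ (x.u, a)) := by
    intro H hH
    rw [lintegral_map hH hmf]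
    exact lintegral_withDensity_eq_lintegral_mul _ hmw (hH.comp hmf)
  have hmass : μ Set.univ = frameMass d j x.u := by
    rw [← lintegral_one, hμ _ measurable_const]
    simp [frameMass]
  have hfin : IsFiniteMeasure μ := ⟨by rw [hmass]; exact (frameMass_ne_top _).lt_top⟩
  have hinv : ∀ ρ : rotationsFixing x.u,
      μ.map (actFlag (ρ : unitary (E d →L[ℝ] E d))) = μ := by
    intro ρ
    have hact : Measurable (actFlag (q := d - j) (ρ : unitary (E d →L[ℝ] E d))) :=
      (measurable_actFlag x.u).comp measurable_prodMk_left
    refine Measure.ext_of_lintegral _ fun H hH => ?_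
    rw [lintegral_map hH hact, hμ (fun y => H (actFlag ρ y)) (hH.comp hact), hμ _ hH]
    let T := Unitary.linearIsometryEquiv (ρ : unitary (E d →L[ℝ] E d))
    have hTu : T x.u = x.u := ρ.2.2
    rw [← (measurePreserving_frame T).lintegral_comp
      (f := fun a => ENNReal.ofReal (frameWeight x.u a) * H (flagOf x₀ (x.u, a)))
      (hmw.mul (hH.comp hmf))]
    refine lintegral_congr fun a => ?_
    have h1 := frameWeight_isometry T x.u a
    rw [hTu] at h1
    simp only [h1]
    by_cases h0 : frameWeight x.u a = 0
    · simp [h0]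
    · have h2 := flagOf_unitary x₀ (ρ : unitary (E d →L[ℝ] E d))
        ⟨hu0, pow_ne_zero_iff two_ne_zero |>.1 (right_ne_zero_of_mul h0)⟩
      rw [ρ.2.2] at h2
      rw [← h2]
      rfl
  have hsupp : ∀ᵐ y ∂μ, y ∈ {y : FlagManifold d (d - j) | y.u = x.u} := by
    have hms : MeasurableSet {y : FlagManifold d (d - j) | y.u = x.u} :=
      (isClosed_eq (isInducing_flag d (d - j)).continuous.fst continuous_const).measurableSet
    rw [ae_iff]
    have : {y | y ∉ {y : FlagManifold d (d - j) | y.u = x.u}} =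
      {y : FlagManifold d (d - j) | y.u = x.u}ᶜ := rfl
    rw [this, ← lintegral_indicator_one hms.compl, hμ _ (measurable_one.indicator hms.compl)]
    refine (lintegral_congr fun a => ?_).trans lintegral_zero
    by_cases h0 : frameWeight x.u a = 0
    · simp [h0]
    · have h2 : (flagOf x₀ (x.u, a)).u = x.u := by
        rw [flagOf_u x₀ (p := (x.u, a))
          ⟨hu0, pow_ne_zero_iff two_ne_zero |>.1 (right_ne_zero_of_mul h0)⟩, x.norm_u, inv_one,
          one_smul]
      simp [h2]
  have key := smul_eq_smul_of_invariant (rotationHaar x.u) (measurable_actFlag (q := d - j) x.u)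
    (fun g h y => actFlag_mul _ _ y)
    (S := {y : FlagManifold d (d - j) | y.u = x.u})
    (fun y hy z hz => exists_rotationsFixing_actFlag_eq hj y z (hy.trans hz.symm) x.u hy)
    μ (fibreMeasure x) hinv (map_actFlag_fibreMeasure x) hsupp (ae_fibreMeasure x)
  rw [measure_univ, one_smul, hmass] at key
  rw [← hμ G hG, key, lintegral_smul_measure, smul_eq_mul]

/-! ### Hausdorff measure on the sphere -/

lemma exists_isometry_range_eq (S : Submodule ℝ (E d)) (hS : Module.finrank ℝ S = q) :
    ∃ ι : E q →ₗᵢ[ℝ] E d, LinearMap.range ι.toLinearMap = S := by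
  let b := (stdOrthonormalBasis ℝ S).reindex (finCongr hS)
  refine ⟨S.subtypeₗᵢ.comp b.repr.symm.toLinearIsometry, ?_⟩
  have h : (S.subtypeₗᵢ.comp b.repr.symm.toLinearIsometry).toLinearMap =
      S.subtype ∘ₗ (b.repr.symm.toLinearEquiv : E q →ₗ[ℝ] S) := rfl
  rw [h, LinearMap.range_comp, LinearEquiv.range, Submodule.map_top, Submodule.range_subtype]

lemma dist_normalize_le {a b : E d} (ha : 1 ≤ ‖a‖) (hb : 1 ≤ ‖b‖) :
    dist (‖a‖⁻¹ • a) (‖b‖⁻¹ • b) ≤ 2 * dist a b := by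
  have ha0 : ‖a‖ ≠ 0 := by positivity
  have hb0 : ‖b‖ ≠ 0 := by positivity
  have h1 : ‖a‖⁻¹ • a - ‖b‖⁻¹ • b = ‖a‖⁻¹ • (a - b) + (‖a‖⁻¹ * (‖b‖ - ‖a‖)) • ‖b‖⁻¹ • b := by
    rw [smul_sub, smul_smul, mul_sub, inv_mul_cancel₀ ha0, sub_mul, one_mul, mul_assoc,
      mul_inv_cancel₀ hb0, mul_one, sub_smul]
    abel
  have h2 : ‖‖b‖⁻¹ • b‖ = 1 := by
    rw [norm_smul, norm_inv, norm_norm, inv_mul_cancel₀ hb0]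
  have h3 : ‖a‖⁻¹ ≤ 1 := inv_le_one_of_one_le₀ ha
  have h4 : |‖b‖ - ‖a‖| ≤ ‖a - b‖ := by rw [norm_sub_rev]; exact abs_norm_sub_norm_le b a
  rw [dist_eq_norm, dist_eq_norm, h1]
  refine (norm_add_le _ _).trans ?_
  rw [norm_smul, norm_smul, h2, norm_mul, norm_inv, norm_norm, mul_one, Real.norm_eq_abs]
  have h5 := mul_le_mul h3 h4 (abs_nonneg _) zero_le_one
  have h6 := mul_le_mul_of_nonneg_right h3 (norm_nonneg (a - b))
  linarith

lemma euclideanHausdorffMeasure_ne_top_iff {n : ℕ} (s : Set (E d)) :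
    μHE[n] s ≠ ⊤ ↔ Measure.hausdorffMeasure (n : ℝ) s ≠ ⊤ := by
  rw [Measure.euclideanHausdorffMeasure_def, Measure.smul_apply, ENNReal.smul_def, smul_eq_mul]
  have h0 := Measure.addHaarScalarFactor_volume_hausdorffMeasure_ne_zero n
  refine ⟨fun h hh => h ?_, fun h => ENNReal.mul_ne_top ENNReal.coe_ne_top h⟩
  rw [hh, ENNReal.mul_top (by simpa using h0)]

lemma euclideanHausdorffMeasure_sphere_ne_top (n : ℕ) :
    μHE[n] (sphere (0 : E (n + 1)) 1) ≠ ⊤ := by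
  rw [euclideanHausdorffMeasure_ne_top_iff]
  refine ((isCompact_sphere (0 : E (n + 1)) 1).measure_lt_top_of_nhdsWithin fun e he => ?_).ne
  have he1 : ‖e‖ = 1 := by simpa using he
  have he0 : e ≠ 0 := norm_ne_zero_iff.1 (by rw [he1]; exact one_ne_zero)
  have hfin : Module.finrank ℝ (ℝ ∙ e)ᗮ = n := by
    have h := (ℝ ∙ e).finrank_add_finrank_orthogonal
    rw [finrank_span_singleton he0, finrank_euclideanSpace_fin] at h
    omega
  obtain ⟨ι, hι⟩ := exists_isometry_range_eq _ hfin
  have horth : ∀ y, inner ℝ e (ι y) = 0 := fun y =>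
    Submodule.mem_orthogonal_singleton_iff_inner_right.1 (hι ▸ ⟨y, rfl⟩ : ι y ∈ (ℝ ∙ e)ᗮ)
  -- The cap around `e` is the central projection of a ball of the tangent space at `e`.
  let r : E n → E (n + 1) := fun y => ‖e + ι y‖⁻¹ • (e + ι y)
  have hnorm : ∀ y, 1 ≤ ‖e + ι y‖ := fun y => by
    have h : ‖e + ι y‖ * ‖e + ι y‖ = ‖e‖ * ‖e‖ + ‖ι y‖ * ‖ι y‖ :=
      norm_add_sq_eq_norm_sq_add_norm_sq_of_inner_eq_zero _ _ (horth y)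
    rw [he1] at h
    nlinarith [norm_nonneg (e + ι y), mul_self_nonneg ‖ι y‖]
  have hLip : LipschitzWith 2 r := LipschitzWith.of_dist_le_mul fun y z => by
    refine (dist_normalize_le (hnorm y) (hnorm z)).trans ?_
    rw [dist_add_left, ι.dist_map]
    rfl
  refine ⟨{u | (1 : ℝ) / 2 < inner ℝ e u} ∩ sphere 0 1, ?_, ?_⟩
  · refine Filter.inter_mem (mem_nhdsWithin_of_mem_nhds ?_) self_mem_nhdsWithin
    refine (isOpen_lt continuous_const (by fun_prop)).mem_nhds ?_
    rw [Set.mem_ofPred_eq, real_inner_self_eq_norm_sq, he1]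
    norm_num
  · have hsub : {u | (1 : ℝ) / 2 < inner ℝ e u} ∩ sphere (0 : E (n + 1)) 1 ⊆
        r '' closedBall 0 2 := by
      rintro u ⟨hu, hu1⟩
      have hu1 : ‖u‖ = 1 := by simpa using hu1
      have hu : (1 : ℝ) / 2 < inner ℝ e u := hu
      set t : ℝ := inner ℝ e u
      have hmem : t⁻¹ • u - e ∈ (ℝ ∙ e)ᗮ := by
        rw [Submodule.mem_orthogonal_singleton_iff_inner_right, inner_sub_right, inner_smul_right,
          real_inner_self_eq_norm_sq, he1, inv_mul_cancel₀ (by positivity)]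
        norm_num
      rw [← hι] at hmem
      obtain ⟨y, hy⟩ := hmem
      have hy : e + ι y = t⁻¹ • u := by
        change ι y = _ at hy
        rw [hy]; abel
      have ht : t⁻¹ ≤ 2 := by
        rw [inv_le_comm₀ (by positivity) (by norm_num)]; linarith
      refine ⟨y, ?_, ?_⟩
      · rw [mem_closedBall_zero_iff]
        have h : ‖e + ι y‖ * ‖e + ι y‖ = ‖e‖ * ‖e‖ + ‖ι y‖ * ‖ι y‖ :=
          norm_add_sq_eq_norm_sq_add_norm_sq_of_inner_eq_zero _ _ (horth y)
        rw [hy, norm_smul, hu1, he1, ι.norm_map, mul_one,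
          Real.norm_of_nonneg (by positivity)] at h
        have h0 : 0 ≤ t⁻¹ := by positivity
        nlinarith [norm_nonneg y]
      · simp only [r, hy, norm_smul, hu1, mul_one, norm_inv, inv_inv, smul_smul]
        rw [Real.norm_of_nonneg (by positivity), mul_inv_cancel₀ (by positivity), one_smul]
    refine (measure_mono hsub).trans_lt ((hLip.hausdorffMeasure_image_le
      (Nat.cast_nonneg n) _).trans_lt ?_)
    exact ENNReal.mul_lt_top (by simp) (isCompact_closedBall _ _).measure_lt_top

lemma euclideanHausdorffMeasure_sphere_ne_zero (n : ℕ) :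
    μHE[n] (sphere (0 : E (n + 1)) 1) ≠ 0 := by
  obtain ⟨e, he1⟩ : ∃ e : E (n + 1), ‖e‖ = 1 := ⟨EuclideanSpace.single 0 1, by simp⟩
  have he0 : e ≠ 0 := norm_ne_zero_iff.1 (by rw [he1]; exact one_ne_zero)
  have hfin : Module.finrank ℝ (ℝ ∙ e)ᗮ = n := by
    have h := (ℝ ∙ e).finrank_add_finrank_orthogonal
    rw [finrank_span_singleton he0, finrank_euclideanSpace_fin] at h
    omega
  obtain ⟨ι, hι⟩ := exists_isometry_range_eq _ hfin
  have horth : ∀ y, inner ℝ e (ι y) = 0 := fun y =>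
    Submodule.mem_orthogonal_singleton_iff_inner_right.1 (hι ▸ ⟨y, rfl⟩ : ι y ∈ (ℝ ∙ e)ᗮ)
  -- The orthogonal projection of the sphere to a hyperplane is a ball.
  let π : E (n + 1) →L[ℝ] E n := ι.toContinuousLinearMap.adjoint
  have hπι : ∀ y, π (ι y) = y := fun y => ext_inner_left ℝ fun z => by
    rw [ContinuousLinearMap.adjoint_inner_right]
    exact ι.inner_map_map z y
  have hπe : π e = 0 := ext_inner_left ℝ fun z => by
    rw [ContinuousLinearMap.adjoint_inner_right, real_inner_comm, inner_zero_right]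
    exact horth z
  have hLip : LipschitzWith 1 π := by
    refine π.lipschitz.weaken ?_
    have h : ‖π‖ ≤ 1 := by
      rw [LinearIsometryEquiv.norm_map]
      exact ι.norm_toContinuousLinearMap_le
    exact h
  have hsub : closedBall (0 : E n) 1 ⊆ π '' sphere 0 1 := by
    intro y hy
    have hy1 : ‖y‖ ≤ 1 := by simpa using hy
    have hs : 0 ≤ 1 - ‖y‖ ^ 2 := by nlinarith [norm_nonneg y]
    refine ⟨√(1 - ‖y‖ ^ 2) • e + ι y, ?_, by simp [hπι, hπe]⟩
    have h : ‖√(1 - ‖y‖ ^ 2) • e + ι y‖ * ‖√(1 - ‖y‖ ^ 2) • e + ι y‖ =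
        ‖√(1 - ‖y‖ ^ 2) • e‖ * ‖√(1 - ‖y‖ ^ 2) • e‖ + ‖ι y‖ * ‖ι y‖ :=
      norm_add_sq_eq_norm_sq_add_norm_sq_of_inner_eq_zero _ _ (by
        rw [inner_smul_left, horth, mul_zero])
    rw [norm_smul √(1 - ‖y‖ ^ 2), he1, mul_one, Real.norm_of_nonneg (Real.sqrt_nonneg _),
      Real.mul_self_sqrt hs, ι.norm_map] at h
    rw [mem_sphere_zero_iff_norm]
    nlinarith [norm_nonneg (√(1 - ‖y‖ ^ 2) • e + ι y)]
  intro h0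
  have h1 : Measure.hausdorffMeasure (n : ℝ) (sphere (0 : E (n + 1)) 1) = 0 := by
    rw [Measure.euclideanHausdorffMeasure_def, Measure.smul_apply, ENNReal.smul_def, smul_eq_mul,
      mul_eq_zero] at h0
    exact h0.resolve_left (by
      simpa using Measure.addHaarScalarFactor_volume_hausdorffMeasure_ne_zero n)
  have h2 := (measure_mono hsub).trans (hLip.hausdorffMeasure_image_le (Nat.cast_nonneg n)
    (sphere 0 1))
  rw [h1, mul_zero] at h2
  have h3 : 0 < Measure.hausdorffMeasure (n : ℝ) (ball (0 : E n) 1) :=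
    isOpen_ball.measure_pos _ ⟨0, by simp⟩
  exact (h3.trans_le ((measure_mono ball_subset_closedBall).trans h2)).ne' rfl

/-- Integration in polar coordinates of a function of the direction against a radial weight. The
constant is not made explicit: the two sides are invariant under rotations. -/
lemma exists_lintegral_normalize_eq (hq : 2 ≤ q) (m : ℕ) :
    ∃ c : ENNReal, c ≠ 0 ∧ c ≠ ⊤ ∧ ∀ k : E q → ENNReal, Measurable k →
      ∫⁻ v : E q, ENNReal.ofReal (cut (‖v‖ ^ 2) * ‖v‖ ^ m) * k (‖v‖⁻¹ • v) =
        c * ∫⁻ v in sphere (0 : E q) 1, k v ∂μHE[q - 1] := by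
  obtain ⟨n, rfl⟩ : ∃ n, q = n + 1 := ⟨q - 1, by omega⟩
  rw [Nat.add_sub_cancel]
  have hωc : Continuous fun v : E (n + 1) => cut (‖v‖ ^ 2) * ‖v‖ ^ m := by fun_prop
  have hω := hωc.measurable.ennreal_ofReal
  have hN : Measurable fun v : E (n + 1) => ‖v‖⁻¹ • v := by fun_prop
  let μ : Measure (E (n + 1)) := ((volume : Measure (E (n + 1))).withDensity fun v =>
    ENNReal.ofReal (cut (‖v‖ ^ 2) * ‖v‖ ^ m)).map fun v => ‖v‖⁻¹ • v
  have hμ : ∀ k : E (n + 1) → ENNReal, Measurable k → ∫⁻ v, k v ∂μ =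
      ∫⁻ v : E (n + 1), ENNReal.ofReal (cut (‖v‖ ^ 2) * ‖v‖ ^ m) * k (‖v‖⁻¹ • v) := by
    intro k hk
    rw [lintegral_map hk hN]
    exact lintegral_withDensity_eq_lintegral_mul _ hω (hk.comp hN)
  have hmass : μ Set.univ = ∫⁻ v : E (n + 1), ENNReal.ofReal (cut (‖v‖ ^ 2) * ‖v‖ ^ m) := by
    rw [← lintegral_one, hμ _ measurable_const]; simp
  have hmass0 : μ Set.univ ≠ 0 := by
    rw [hmass, ← pos_iff_ne_zero, lintegral_pos_iff_support hω]
    have hopen : IsOpen {v : E (n + 1) | 0 < cut (‖v‖ ^ 2) * ‖v‖ ^ m} :=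
      isOpen_lt continuous_const hωc
    refine (hopen.measure_pos volume ⟨(2 : ℝ)⁻¹ • EuclideanSpace.single 0 1, ?_⟩).trans_le
      (measure_mono fun b hb => (ENNReal.ofReal_pos.2 hb).ne')
    simp only [Set.mem_ofPred_eq, norm_smul, norm_inv, Real.norm_ofNat, PiLp.norm_single,
      norm_one, mul_one]
    exact mul_pos (cut_pos (by norm_num)) (by positivity)
  have hmassT : μ Set.univ ≠ ⊤ := by
    have hle : μ Set.univ ≤ ∫⁻ v : E (n + 1), (closedBall 0 1).indicator (fun _ => 1) v := by
      rw [hmass]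
      refine lintegral_mono fun v => ?_
      by_cases h : cut (‖v‖ ^ 2) = 0
      · simp [h]
      · have h1 := lt_one_of_cut_ne_zero h
        have h2 : ‖v‖ ≤ 1 := by nlinarith [norm_nonneg v]
        rw [Set.indicator_of_mem (by simpa using h2)]
        refine ENNReal.ofReal_le_one.2 ?_
        exact mul_le_one₀ (cut_le_one (by positivity)) (by positivity)
          (pow_le_one₀ (norm_nonneg v) h2)
    refine (hle.trans_lt ?_).ne
    rw [lintegral_indicator isClosed_closedBall.measurableSet, setLIntegral_const, one_mul]
    exact (isCompact_closedBall _ _).measure_lt_top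
  let ν : Measure (E (n + 1)) := μHE[n].restrict (sphere (0 : E (n + 1)) 1)
  have hνu : ν Set.univ = μHE[n] (sphere (0 : E (n + 1)) 1) := by
    rw [Measure.restrict_apply_univ]
  have : IsFiniteMeasure μ := ⟨hmassT.lt_top⟩
  have : IsFiniteMeasure ν := ⟨by
    rw [hνu]; exact (euclideanHausdorffMeasure_sphere_ne_top n).lt_top⟩
  have hact : Measurable (Function.uncurry fun (ρ : rotationsFixing (0 : E (n + 1)))
      (v : E (n + 1)) => ((ρ : unitary (E (n + 1) →L[ℝ] E (n + 1))) :
        E (n + 1) →L[ℝ] E (n + 1)) v) := by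
    have h : Continuous fun p : rotationsFixing (0 : E (n + 1)) × E (n + 1) =>
      ((p.1 : unitary (E (n + 1) →L[ℝ] E (n + 1))) : E (n + 1) →L[ℝ] E (n + 1)) p.2 := by fun_prop
    exact h.measurable
  have hinvμ : ∀ ρ : rotationsFixing (0 : E (n + 1)), μ.map
      (fun v => ((ρ : unitary (E (n + 1) →L[ℝ] E (n + 1))) : E (n + 1) →L[ℝ] E (n + 1)) v)
      = μ := by
    intro ρ
    let T := Unitary.linearIsometryEquiv (ρ : unitary (E (n + 1) →L[ℝ] E (n + 1)))
    have hT : Measurable T := T.continuous.measurable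
    refine Measure.ext_of_lintegral _ fun k hk => ?_
    change ∫⁻ v, k v ∂(μ.map T) = _
    rw [lintegral_map hk hT, hμ (fun v => k (T v)) (hk.comp hT), hμ k hk]
    rw [← T.measurePreserving.lintegral_comp
      (f := fun v => ENNReal.ofReal (cut (‖v‖ ^ 2) * ‖v‖ ^ m) * k (‖v‖⁻¹ • v))
      (hω.mul (hk.comp hN))]
    simp only [T.norm_map, map_smul]
  have hinvν : ∀ ρ : rotationsFixing (0 : E (n + 1)), ν.map
      (fun v => ((ρ : unitary (E (n + 1) →L[ℝ] E (n + 1))) : E (n + 1) →L[ℝ] E (n + 1)) v)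
      = ν := by
    intro ρ
    let T := Unitary.linearIsometryEquiv (ρ : unitary (E (n + 1) →L[ℝ] E (n + 1)))
    have h1 := T.toIsometryEquiv.measurePreserving_euclideanHausdorffMeasure n
    have h2 : T.toIsometryEquiv ⁻¹' sphere (0 : E (n + 1)) 1 = sphere 0 1 := by
      ext v; simp
    have h3 := h1.restrict_preimage (s := sphere (0 : E (n + 1)) 1) isClosed_sphere.measurableSet
    rw [h2] at h3
    exact h3.map_eq
  have key := smul_eq_smul_of_invariant (rotationHaar (0 : E (n + 1))) hact (fun _ _ _ => rfl)
    (S := sphere (0 : E (n + 1)) 1) ?_ μ ν hinvμ hinvν ?_ ?_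
  · rw [hνu] at key
    have hν0 := euclideanHausdorffMeasure_sphere_ne_zero n
    have hνT := euclideanHausdorffMeasure_sphere_ne_top n
    refine ⟨(μHE[n] (sphere (0 : E (n + 1)) 1))⁻¹ * μ Set.univ,
      mul_ne_zero (ENNReal.inv_ne_zero.2 hνT) hmass0,
      ENNReal.mul_ne_top (ENNReal.inv_ne_top.2 hν0) hmassT, fun k hk => ?_⟩
    have h1 := congrArg (fun ρ : Measure (E (n + 1)) => ∫⁻ v, k v ∂ρ) key
    simp only [lintegral_smul_measure, smul_eq_mul] at h1
    rw [← hμ k hk, mul_assoc, ← h1, ← mul_assoc, ENNReal.inv_mul_cancel hν0 hνT, one_mul]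
  · intro v hv w hw
    have hv : ‖v‖ = 1 := by simpa using hv
    have hw : ‖w‖ = 1 := by simpa using hw
    obtain ⟨ρ, hdet, hρ⟩ := exists_rotation_of_orthonormal (ι := Unit) (v := fun _ => v)
      (w := fun _ => w) (by rw [Fintype.card_unit]; omega) ⟨fun _ => hv, fun _ _ h => absurd rfl h⟩
      ⟨fun _ => hw, fun _ _ h => absurd rfl h⟩
    exact ⟨⟨ρ, hdet, map_zero _⟩, hρ ()⟩
  · have hms : MeasurableSet {v : E (n + 1) | v ∈ sphere (0 : E (n + 1)) 1} :=
      isClosed_sphere.measurableSet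
    rw [ae_map_iff hN.aemeasurable hms]
    have h0 : ∀ᵐ v : E (n + 1), v ≠ 0 := by simp [ae_iff]
    filter_upwards [(withDensity_absolutelyContinuous _ _).ae_le h0] with v hv
    rw [mem_sphere_zero_iff_norm, norm_smul, norm_inv, norm_norm,
      inv_mul_cancel₀ (norm_ne_zero_iff.2 hv)]
  · exact ae_restrict_mem isClosed_sphere.measurableSet

/-! ### Determinants of projections between subspaces -/

lemma sum_inner_mul_inner_eq {ι : Type*} [Fintype ι] {S : Submodule ℝ (E d)}
    (b : OrthonormalBasis ι ℝ S) (z w : E d) :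
    ∑ i, inner ℝ z (b i : E d) * inner ℝ (b i : E d) w = inner ℝ z (S.starProjection w) := by
  have h1 : ∀ v : E d, ∀ i, inner ℝ (b i : E d) v =
      inner ℝ (b i) (S.orthogonalProjectionOnto v) := fun v i =>
    (Submodule.inner_orthogonalProjectionOnto_eq_of_mem_left (b i) v).symm
  have h2 := b.sum_inner_mul_inner (S.orthogonalProjectionOnto z) (S.orthogonalProjectionOnto w)
  have h3 : inner ℝ z (S.starProjection w) =
      inner ℝ (S.orthogonalProjectionOnto z) (S.orthogonalProjectionOnto w) :=
    (Submodule.inner_orthogonalProjectionOnto_eq_of_mem_right (S.orthogonalProjectionOnto w) z).symm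
  rw [h3, ← h2]
  refine Finset.sum_congr rfl fun i _ => ?_
  rw [real_inner_comm, h1 z, h1 w, real_inner_comm]

lemma sum_inner_mul_inner_add {ι κ : Type*} [Fintype ι] [Fintype κ] {S : Submodule ℝ (E d)}
    (b : OrthonormalBasis ι ℝ S) (c : OrthonormalBasis κ ℝ Sᗮ) (z w : E d) :
    ∑ i, inner ℝ z (b i : E d) * inner ℝ w (b i : E d) +
      ∑ i, inner ℝ z (c i : E d) * inner ℝ w (c i : E d) = inner ℝ z w := by
  simp only [real_inner_comm _ w]
  rw [sum_inner_mul_inner_eq b, sum_inner_mul_inner_eq c, ← inner_add_right,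
    S.starProjection_add_starProjection_orthogonal]

/-- Complementary blocks of an orthogonal matrix have the same determinant up to sign. -/
lemma det_sq_eq_of_orthogonal_blocks {A : Matrix (Fin q) (Fin q) ℝ} {B : Matrix (Fin q) (Fin j) ℝ}
    {C : Matrix (Fin j) (Fin q) ℝ} {D : Matrix (Fin j) (Fin j) ℝ}
    (h1 : A * A.transpose + B * B.transpose = 1) (h2 : A * C.transpose + B * D.transpose = 0)
    (h3 : C * C.transpose + D * D.transpose = 1) : A.det ^ 2 = D.det ^ 2 := by
  let O := Matrix.fromBlocks A B C D
  have h2' : C * A.transpose + D * B.transpose = 0 := by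
    have := congrArg Matrix.transpose h2
    simpa using this
  have hO : O * O.transpose = 1 := by
    rw [Matrix.fromBlocks_transpose, Matrix.fromBlocks_multiply, h1, h2, h3, h2',
      Matrix.fromBlocks_one]
  have hdet : O.det ^ 2 = 1 := by
    have := congrArg Matrix.det hO
    rwa [Matrix.det_mul, Matrix.det_transpose, Matrix.det_one, ← sq] at this
  have hmul : O * Matrix.fromBlocks 1 C.transpose 0 D.transpose = Matrix.fromBlocks A 0 C 1 := by
    rw [Matrix.fromBlocks_multiply]
    simp [h2, h3]
  have := congrArg Matrix.det hmul
  rw [Matrix.det_mul, Matrix.det_fromBlocks_zero₂₁, Matrix.det_fromBlocks_zero₁₂, Matrix.det_one,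
    Matrix.det_one, one_mul, mul_one, Matrix.det_transpose] at this
  rw [← this, mul_pow, hdet, one_mul]

lemma absDet_eq (x y : FlagManifold d q) :
    absDet x y = |(Matrix.of fun k l => inner ℝ (y.basis k : E d) (x.basis l : E d)).det| := by
  rw [absDet]
  congr 2
  ext k l
  rw [LinearMap.toMatrix_apply, OrthonormalBasis.coe_toBasis,
    OrthonormalBasis.coe_toBasis_repr_apply, OrthonormalBasis.repr_apply_apply]
  exact Submodule.inner_orthogonalProjectionOnto_eq_of_mem_left (𝕜 := ℝ) (K := y.L) (y.basis k)
    (x.basis l : E d)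

lemma absDet_comm (x y : FlagManifold d q) : absDet x y = absDet y x := by
  rw [absDet_eq, absDet_eq, ← Matrix.det_transpose]
  congr 2
  ext k l
  exact real_inner_comm (x.basis k : E d) (y.basis l : E d)

lemma absDet_sq_eq_gram (x y : FlagManifold d q) :
    absDet x y ^ 2 = (Matrix.of fun k l =>
      inner ℝ (y.basis k : E d) (x.L.starProjection (y.basis l : E d))).det := by
  let A : Matrix (Fin q) (Fin q) ℝ :=
    Matrix.of fun k l => inner ℝ (y.basis k : E d) (x.basis l : E d)
  have h : A.det ^ 2 = (A * A.transpose).det := by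
    rw [Matrix.det_mul, Matrix.det_transpose, sq]
  rw [absDet_eq, sq_abs, h]
  congr 1
  ext k l
  rw [Matrix.of_apply, ← sum_inner_mul_inner_eq x.basis]
  simp only [A, Matrix.mul_apply, Matrix.transpose_apply, Matrix.of_apply]
  exact Finset.sum_congr rfl fun i _ => by rw [real_inner_comm (y.basis l : E d)]

lemma continuous_absDet_sq (x : FlagManifold d q) : Continuous fun y => absDet y x ^ 2 := by
  simp only [absDet_sq_eq_gram]
  refine Continuous.matrix_det (continuous_matrix fun k l => ?_)
  have h : Continuous fun y : FlagManifold d q => y.L.starProjection :=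
    (isInducing_flag d q).continuous.snd
  exact continuous_const.inner (h.clm_apply continuous_const)

/-- The projection between two subspaces and the one between their orthogonal complements have the
same absolute determinant. -/
lemma absDet_sq_eq_orthogonal (x y : FlagManifold d q)
    (e : OrthonormalBasis (Fin j) ℝ x.Lᗮ) (b : OrthonormalBasis (Fin j) ℝ y.Lᗮ) :
    absDet y x ^ 2 = (Matrix.of fun k l => inner ℝ (e k : E d) (b l : E d)).det ^ 2 := by
  rw [absDet_eq, sq_abs]
  have hm : ∀ k l, inner ℝ (x.basis k : E d) (x.basis l : E d) = if k = l then (1 : ℝ) else 0 :=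
    orthonormal_iff_ite.1 (x.basis.orthonormal.comp_linearIsometry x.L.subtypeₗᵢ)
  have he : ∀ k l, inner ℝ (e k : E d) (e l : E d) = if k = l then (1 : ℝ) else 0 :=
    orthonormal_iff_ite.1 (e.orthonormal.comp_linearIsometry x.Lᗮ.subtypeₗᵢ)
  refine det_sq_eq_of_orthogonal_blocks
    (B := Matrix.of fun k l => inner ℝ (x.basis k : E d) (b l : E d))
    (C := Matrix.of fun k l => inner ℝ (e k : E d) (y.basis l : E d)) ?_ ?_ ?_
  · ext k l
    simp only [Matrix.add_apply, Matrix.mul_apply, Matrix.transpose_apply, Matrix.of_apply,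
      sum_inner_mul_inner_add, hm, Matrix.one_apply]
  · ext k l
    simp only [Matrix.add_apply, Matrix.mul_apply, Matrix.transpose_apply, Matrix.of_apply,
      sum_inner_mul_inner_add, Matrix.zero_apply]
    exact (Submodule.mem_orthogonal _ _).1 (e l).2 _ (x.basis k).2
  · ext k l
    simp only [Matrix.add_apply, Matrix.mul_apply, Matrix.transpose_apply, Matrix.of_apply,
      sum_inner_mul_inner_add, he, Matrix.one_apply]

/-- The squared determinant of the coordinates given by a frame `a`, on the orthogonal complement
of the space of a flag `x`, splits into the Gram determinant of `a` and the determinant of the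
projection between the spaces of `x` and of the flag of `a`. -/
lemma det_coord_sq {x y : FlagManifold d (d - j)} {ι : E j →ₗᵢ[ℝ] E d}
    (hι : LinearMap.range ι.toLinearMap = x.Lᗮ) {a : Fin j → E d} (hg : gramDet x.u a ≠ 0)
    (hy : y.L = flagSpace x.u a) :
    LinearMap.det (coord a ∘ₗ ι.toLinearMap) ^ 2 = gramDet x.u a * absDet y x ^ 2 := by
  have hyo : y.Lᗮ = Submodule.span ℝ (Set.range (reduced x.u a)) := by
    rw [hy, flagSpace, Submodule.orthogonal_orthogonal]
  have hyd : Module.finrank ℝ y.Lᗮ = j := by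
    rw [hyo, finrank_span_eq_card (linearIndependent_reduced hg), Fintype.card_fin]
  have hmem : ∀ v, ι v ∈ x.Lᗮ := fun v => hι ▸ ⟨v, rfl⟩
  let b := (stdOrthonormalBasis ℝ y.Lᗮ).reindex (finCongr hyd)
  have hιe : Orthonormal ℝ fun k => (⟨ι (EuclideanSpace.basisFun (Fin j) ℝ k), hmem _⟩ : x.Lᗮ) :=
    x.Lᗮ.subtypeₗᵢ.orthonormal_comp_iff.1
      ((EuclideanSpace.basisFun (Fin j) ℝ).orthonormal.comp_linearIsometry ι)
  have hxd : Fintype.card (Fin j) = Module.finrank ℝ x.Lᗮ := by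
    rw [← hι, LinearMap.finrank_range_of_inj ι.injective, finrank_euclideanSpace]
  let e : OrthonormalBasis (Fin j) ℝ x.Lᗮ := OrthonormalBasis.mk hιe
    (by rw [hιe.linearIndependent.span_eq_top_of_card_eq_finrank' hxd])
  have he : ∀ k, (e k : E d) = ι (EuclideanSpace.basisFun (Fin j) ℝ k) := fun k => by
    simp [e]
  let T : Matrix (Fin j) (Fin j) ℝ := Matrix.of fun i l => inner ℝ (reduced x.u a i) (b l : E d)
  have hred : ∀ i, y.Lᗮ.starProjection (reduced x.u a i) = reduced x.u a i := fun i =>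
    Submodule.starProjection_eq_self_iff.2 (hyo ▸ Submodule.subset_span ⟨i, rfl⟩)
  have hgram : gramDet x.u a = T.det ^ 2 := by
    have h : Matrix.gram ℝ (reduced x.u a) = T * T.transpose := by
      ext i k
      simp only [T, Matrix.gram_apply, Matrix.mul_apply, Matrix.transpose_apply, Matrix.of_apply]
      conv_lhs => rw [← hred k, ← sum_inner_mul_inner_eq b]
      exact Finset.sum_congr rfl fun l _ => by rw [real_inner_comm (reduced x.u a k)]
    rw [gramDet, h, Matrix.det_mul, Matrix.det_transpose, sq]
  have hmat : LinearMap.toMatrix (EuclideanSpace.basisFun (Fin j) ℝ).toBasis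
      (EuclideanSpace.basisFun (Fin j) ℝ).toBasis (coord a ∘ₗ ι.toLinearMap) =
      T * (Matrix.of fun k l => inner ℝ (e k : E d) (b l : E d)).transpose := by
    ext i k
    rw [LinearMap.toMatrix_apply]
    simp only [T, Matrix.mul_apply, Matrix.transpose_apply, Matrix.of_apply]
    have h1 : ∑ l, inner ℝ (reduced x.u a i) (b l : E d) * inner ℝ (e k : E d) (b l : E d) =
        inner ℝ (reduced x.u a i) (e k : E d) := by
      have h2 := sum_inner_mul_inner_eq b (e k : E d) (reduced x.u a i)
      rw [hred] at h2
      rw [real_inner_comm, ← h2]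
      exact Finset.sum_congr rfl fun l _ => by
        rw [mul_comm, real_inner_comm (reduced x.u a i)]
    rw [h1, he]
    have h3 : inner ℝ x.u (ι (EuclideanSpace.basisFun (Fin j) ℝ k)) = (0 : ℝ) :=
      (Submodule.mem_orthogonal _ _).1 (hmem _) _ x.mem
    rw [reduced, inner_sub_left, inner_smul_left, inner_smul_left, h3, x.norm_u]
    simp [EuclideanSpace.basisFun_repr]
  rw [← LinearMap.det_toMatrix (EuclideanSpace.basisFun (Fin j) ℝ).toBasis, hmat, Matrix.det_mul,
    Matrix.det_transpose, mul_pow, ← hgram, ← absDet_sq_eq_orthogonal x y e b]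

/-! ### Faces of polytopes -/

/-- The face of `K` in direction `u`. -/
def faceIn (K : ConvexBody (E d)) (u : E d) : Set (E d) :=
  {y | y ∈ (K : Set (E d)) ∧ inner ℝ u y = supp K u}

/-- The normal cone of `P` at `F`. -/
def normalCone (P F : Set (E d)) : Set (E d) := {u | ∀ x ∈ F, ∀ y ∈ P, inner ℝ u (y - x) ≤ 0}

lemma faceIn_nonempty (K : ConvexBody (E d)) (u : E d) : (faceIn K u).Nonempty := by
  obtain ⟨y, hy, h⟩ := exists_eq_supp K u
  exact ⟨y, hy, h⟩

lemma faceIn_subset (K : ConvexBody (E d)) (u : E d) : faceIn K u ⊆ K := fun _ h => h.1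

lemma mem_faceIn_iff (K : ConvexBody (E d)) (u y : E d) :
    y ∈ faceIn K u ↔ y ∈ (K : Set (E d)) ∧ ∀ z ∈ (K : Set (E d)), inner ℝ u z ≤ inner ℝ u y := by
  refine and_congr_right fun hy => ⟨fun h z hz => h ▸ le_supp K u hz, fun h => ?_⟩
  exact le_antisymm (le_supp K u hy) (supp_le K u h)

lemma isExposed_faceIn (K : ConvexBody (E d)) (u : E d) :
    IsExposed ℝ (K : Set (E d)) (faceIn K u) :=
  fun _ => ⟨innerSL ℝ u, by ext y; simp [mem_faceIn_iff]⟩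

lemma exists_eq_faceIn {K : ConvexBody (E d)} {F : Set (E d)} (hF : IsExposed ℝ (K : Set (E d)) F)
    (hne : F.Nonempty) : ∃ u, F = faceIn K u := by
  obtain ⟨l, rfl⟩ := hF hne
  refine ⟨(InnerProductSpace.toDual ℝ (E d)).symm l, ?_⟩
  ext y
  simp [mem_faceIn_iff]

lemma isCompact_faceIn (K : ConvexBody (E d)) (u : E d) : IsCompact (faceIn K u) :=
  (isExposed_faceIn K u).isCompact K.isCompact

lemma convex_faceIn (K : ConvexBody (E d)) (u : E d) : Convex ℝ (faceIn K u) :=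
  (isExposed_faceIn K u).convex K.convex

lemma mem_normalCone_iff {K : ConvexBody (E d)} {F : Set (E d)} (hF : F ⊆ K) {u : E d} :
    u ∈ normalCone (K : Set (E d)) F ↔ F ⊆ faceIn K u := by
  simp only [normalCone, Set.mem_ofPred_eq, inner_sub_right, sub_nonpos]
  exact ⟨fun h x hx => (mem_faceIn_iff K u x).2 ⟨hF hx, h x hx⟩,
    fun h x hx y hy => ((mem_faceIn_iff K u x).1 (h hx)).2 y hy⟩

lemma isClosed_normalCone (P F : Set (E d)) : IsClosed (normalCone P F) := by
  have : normalCone P F = ⋂ x ∈ F, ⋂ y ∈ P, {u : E d | inner ℝ u (y - x) ≤ 0} := by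
    ext u; simp [normalCone]
  rw [this]
  exact isClosed_biInter fun x _ => isClosed_biInter fun y _ =>
    isClosed_le (by fun_prop) continuous_const

/-- The normal vectors of a set are orthogonal to its direction. -/
lemma mem_orthogonal_vectorSpan {K : ConvexBody (E d)} {F : Set (E d)} {u : E d}
    (hF : F ⊆ faceIn K u) : u ∈ (vectorSpan ℝ F)ᗮ := by
  rw [Submodule.mem_orthogonal']
  intro v hv
  rw [vectorSpan_def] at hv
  induction hv using Submodule.span_induction with
  | mem x hx =>
    obtain ⟨y, hy, z, hz, rfl⟩ := hx
    change inner ℝ u (y - z) = 0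
    rw [inner_sub_right, (hF hy).2, (hF hz).2, sub_self]
  | zero => simp
  | add x y _ _ hx hy => rw [inner_add_right, hx, hy, add_zero]
  | smul c x _ hx => rw [inner_smul_right, hx, mul_zero]

lemma normalCone_subset_orthogonal {K : ConvexBody (E d)} {F : Set (E d)} (hF : F ⊆ K) :
    normalCone (K : Set (E d)) F ⊆ (vectorSpan ℝ F)ᗮ :=
  fun _ hu => mem_orthogonal_vectorSpan ((mem_normalCone_iff hF).1 hu)

/-- A face is determined by its affine hull. -/
lemma eq_of_subset_of_finrank_le {K : ConvexBody (E d)} {F F' : Set (E d)}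
    (hF : IsExposed ℝ (K : Set (E d)) F) (hne : F.Nonempty) (hF'K : F' ⊆ K) (hsub : F ⊆ F')
    (hr : Module.finrank ℝ (vectorSpan ℝ F') ≤ Module.finrank ℝ (vectorSpan ℝ F)) : F = F' := by
  obtain ⟨u, rfl⟩ := exists_eq_faceIn hF hne
  obtain ⟨z, hz⟩ := hne
  have heq := Submodule.eq_of_le_of_finrank_le (vectorSpan_mono ℝ hsub) hr
  refine hsub.antisymm fun y hy => ⟨hF'K hy, ?_⟩
  have hmem : y - z ∈ vectorSpan ℝ (faceIn K u) :=
    heq ▸ vsub_mem_vectorSpan ℝ hy (hsub hz)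
  have h0 := (Submodule.mem_orthogonal' _ _).1
    (mem_orthogonal_vectorSpan (Set.Subset.refl _)) _ hmem
  rw [inner_sub_right, hz.2, sub_eq_zero] at h0
  exact h0

/-- A face of a polytope is the convex hull of the generating points that it contains. -/
lemma faceIn_eq_convexHull {P : ConvexBody (E d)} {s : Finset (E d)}
    (hs : (P : Set (E d)) = convexHull ℝ (s : Set (E d))) (u : E d) :
    faceIn P u = convexHull ℝ ((s : Set (E d)) ∩ faceIn P u) := by
  classical
  refine Set.Subset.antisymm (fun y hy => ?_) (convexHull_min Set.inter_subset_right
    (convex_faceIn P u))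
  have hyP := hy.1
  rw [hs, Finset.mem_convexHull'] at hyP
  obtain ⟨w, hw0, hw1, rfl⟩ := hyP
  have hle : ∀ z ∈ s, inner ℝ u z ≤ supp P u := fun z hz =>
    le_supp P u (hs ▸ subset_convexHull ℝ _ hz)
  have hzero : ∀ z ∈ s, w z * (supp P u - inner ℝ u z) = 0 := by
    have h1 : ∑ z ∈ s, w z * (supp P u - inner ℝ u z) = 0 := by
      have h2 := hy.2
      rw [inner_sum] at h2
      simp only [inner_smul_right] at h2
      simp only [mul_sub, Finset.sum_sub_distrib, h2, ← Finset.sum_mul, hw1, one_mul, sub_self]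
    exact (Finset.sum_eq_zero_iff_of_nonneg fun z hz =>
      mul_nonneg (hw0 z hz) (sub_nonneg.2 (hle z hz))).1 h1
  have hmem : ∀ z ∈ s, w z ≠ 0 → z ∈ faceIn P u := fun z hz hwz =>
    ⟨hs ▸ subset_convexHull ℝ _ hz,
      (sub_eq_zero.1 ((mul_eq_zero.1 (hzero z hz)).resolve_left hwz)).symm⟩
  have hsum : ∀ f : E d → E d, ∑ z ∈ s with w z ≠ 0, w z • f z = ∑ z ∈ s, w z • f z := fun f =>
    Finset.sum_filter_of_ne fun z _ h h0 => h (by rw [h0, zero_smul])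
  rw [← hsum fun z => z]
  refine (convex_convexHull ℝ _).sum_mem (fun z hz => hw0 z (Finset.mem_filter.1 hz).1) ?_
    fun z hz => subset_convexHull ℝ _ ⟨(Finset.mem_filter.1 hz).1,
      hmem z (Finset.mem_filter.1 hz).1 (Finset.mem_filter.1 hz).2⟩
  rw [Finset.sum_filter_ne_zero, hw1]

lemma finite_exposed {P : ConvexBody (E d)} (hP : P ∈ polytopes d) :
    {F : Set (E d) | F.Nonempty ∧ IsExposed ℝ (P : Set (E d)) F}.Finite := by
  obtain ⟨s, hs⟩ := hP
  refine Set.Finite.subset ((s.finite_toSet.powerset).image fun t => convexHull ℝ t) ?_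
  rintro F ⟨hne, hF⟩
  obtain ⟨u, rfl⟩ := exists_eq_faceIn hF hne
  exact ⟨(s : Set (E d)) ∩ faceIn P u, Set.inter_subset_left, (faceIn_eq_convexHull hs u).symm⟩

lemma finite_faces {P : ConvexBody (E d)} (hP : P ∈ polytopes d) :
    (faces j (P : Set (E d))).Finite :=
  (finite_exposed hP).subset fun _ hF => ⟨hF.1, hF.2.1⟩

lemma isCompact_of_mem_faces {P : ConvexBody (E d)} {F : Set (E d)}
    (hF : F ∈ faces j (P : Set (E d))) : IsCompact F :=
  hF.2.1.isCompact P.isCompact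

/-! ### Generic parameters -/

/-- For almost all `w`, the affine subspace `w + range (comb a)` misses the normal spaces of the
faces of dimension greater than `j`. -/
lemma ae_notMem_orthogonal (a : Fin j → E d) {V : Submodule ℝ (E d)}
    (hV : j < Module.finrank ℝ V) : ∀ᵐ w : E d, ∀ l, w + comb a l ∉ Vᗮ := by
  have hne : Vᗮ ⊔ LinearMap.range (comb a) ≠ ⊤ := by
    intro htop
    have h1 := Submodule.finrank_add_le_finrank_add_finrank Vᗮ (LinearMap.range (comb a))
    have h2 := LinearMap.finrank_range_le (comb a)
    have h3 := V.finrank_add_finrank_orthogonal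
    rw [htop, finrank_top] at h1
    rw [finrank_euclideanSpace_fin] at h1 h2 h3
    omega
  have h0 := Measure.addHaar_submodule (volume : Measure (E d)) _ hne
  refine (measure_eq_zero_iff_ae_notMem.1 h0).mono fun w hw l hl => hw ?_
  have : w = (w + comb a l) + -comb a l := by abel
  rw [this]
  exact Submodule.add_mem_sup hl (Submodule.neg_mem _ ⟨l, rfl⟩)

lemma volume_image_coord_eq_zero (a : Fin j → E d) {F : Set (E d)}
    (hF : Module.finrank ℝ (vectorSpan ℝ F) < j) : volume (coord a '' F) = 0 := by
  rcases F.eq_empty_or_nonempty with rfl | ⟨z, hz⟩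
  · simp
  have hne : AffineSubspace.mk' (coord a z) ((vectorSpan ℝ F).map (coord a)) ≠ ⊤ := by
    intro htop
    have h1 := congrArg AffineSubspace.direction htop
    rw [AffineSubspace.direction_mk', AffineSubspace.direction_top] at h1
    have h2 := Submodule.finrank_map_le (coord a) (vectorSpan ℝ F)
    rw [h1, finrank_top, finrank_euclideanSpace_fin] at h2
    omega
  refine measure_mono_null ?_ (Measure.addHaar_affineSubspace volume _ hne)
  rintro _ ⟨y, hy, rfl⟩
  rw [SetLike.mem_coe, AffineSubspace.mem_mk', vsub_eq_sub, ← map_sub]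
  exact Submodule.mem_map_of_mem (vsub_mem_vectorSpan ℝ hy hz)

lemma eq_vadd_image {F : Set (E d)} {ι : E j →ₗᵢ[ℝ] E d}
    (hι : LinearMap.range ι.toLinearMap = vectorSpan ℝ F) {z : E d} (hz : z ∈ F) :
    F = z +ᵥ ι '' {v : E j | z + ι v ∈ F} := by
  ext y
  rw [Set.mem_vadd_set_iff_neg_vadd_mem]
  constructor
  · intro hy
    have h1 : y - z ∈ vectorSpan ℝ F := vsub_mem_vectorSpan ℝ hy hz
    rw [← hι] at h1
    obtain ⟨v, hv⟩ := h1
    have hv : ι v = y - z := hv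
    refine ⟨v, ?_, by rw [hv, vadd_eq_add]; abel⟩
    rw [Set.mem_ofPred_eq, hv, add_sub_cancel]
    exact hy
  · rintro ⟨v, hv, h⟩
    have h2 : y = z + ι v := by rw [h, vadd_eq_add]; abel
    rw [h2]; exact hv

lemma volume_image_coord (a : Fin j → E d) {F : Set (E d)} {ι : E j →ₗᵢ[ℝ] E d}
    (hι : LinearMap.range ι.toLinearMap = vectorSpan ℝ F) :
    volume (coord a '' F) =
      ENNReal.ofReal |LinearMap.det (coord a ∘ₗ ι.toLinearMap)| * μHE[j] F := by
  rcases F.eq_empty_or_nonempty with rfl | ⟨z, hz⟩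
  · simp
  set F' : Set (E j) := {v : E j | z + ι v ∈ F}
  have hF' : F = z +ᵥ ι '' F' := eq_vadd_image hι hz
  have h1 : coord a '' F = coord a z +ᵥ (coord a ∘ₗ ι.toLinearMap) '' F' := by
    conv_lhs => rw [hF']
    rw [← Set.image_vadd, ← Set.image_vadd, Set.image_image, Set.image_image, Set.image_image]
    simp
  have h2 : μHE[j] F = volume F' := by
    conv_lhs => rw [hF']
    rw [measure_vadd, ι.isometry.euclideanHausdorffMeasure_image,
      EuclideanSpace.euclideanHausdorffMeasure_eq_volume]
  rw [h1, measure_vadd, Measure.addHaar_image_linearMap, h2]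

lemma euclideanHausdorffMeasure_face_ne_top {P : ConvexBody (E d)} {F : Set (E d)}
    (hF : F ∈ faces j (P : Set (E d))) : μHE[j] F ≠ ⊤ := by
  obtain ⟨ι, hι⟩ := exists_isometry_range_eq _ hF.2.2
  obtain ⟨z, hz⟩ := hF.1
  have hcF := isCompact_of_mem_faces hF
  have hpre : IsCompact {v : E j | z + ι v ∈ F} := by
    have h : Topology.IsClosedEmbedding fun v => z + ι v :=
      (Homeomorph.addLeft z).isClosedEmbedding.comp ι.isometry.isClosedEmbedding
    exact h.isCompact_preimage hcF
  rw [eq_vadd_image hι hz, measure_vadd, ι.isometry.euclideanHausdorffMeasure_image,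
    EuclideanSpace.euclideanHausdorffMeasure_eq_volume]
  exact hpre.measure_lt_top.ne

/-! ### Integration over the parameters of a face -/

open Classical in
/-- A multiplier `l` for which `w + comb a l` is orthogonal to `F`, if there is one. -/
def faceMult (F : Set (E d)) (a : Fin j → E d) (w : E d) : E j :=
  if h : ∃ l, w + comb a l ∈ (vectorSpan ℝ F)ᗮ then h.choose else 0

lemma inner_comb_isometry (a : Fin j → E d) (ι : E j →ₗᵢ[ℝ] E d) (l v : E j) :
    inner ℝ (comb a l) (ι v) =
      inner ℝ (LinearMap.adjoint (coord a ∘ₗ ι.toLinearMap) l) v := by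
  rw [inner_comb, LinearMap.adjoint_inner_left]
  rfl

lemma exists_linear_faceMult {F : Set (E d)} {a : Fin j → E d} {ι : E j →ₗᵢ[ℝ] E d}
    (hι : LinearMap.range ι.toLinearMap = vectorSpan ℝ F)
    (hdet : LinearMap.det (coord a ∘ₗ ι.toLinearMap) ≠ 0) :
    ∃ Λ : E d →ₗ[ℝ] E j, ∀ w l, w + comb a l ∈ (vectorSpan ℝ F)ᗮ ↔ l = Λ w := by
  set D := coord a ∘ₗ ι.toLinearMap with hD
  have hsurj : Function.Surjective D := (LinearMap.equivOfDetNeZero D hdet).surjective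
  have hinj : Function.Injective (LinearMap.adjoint D) := by
    rw [← LinearMap.ker_eq_bot, LinearMap.ker_eq_bot']
    intro l hl
    refine ext_inner_right ℝ fun v => ?_
    obtain ⟨z, rfl⟩ := hsurj v
    rw [← LinearMap.adjoint_inner_left, hl, inner_zero_left, inner_zero_left]
  let e := LinearEquiv.ofInjectiveEndo (LinearMap.adjoint D) hinj
  have he : ∀ l, e l = LinearMap.adjoint D l := fun l => rfl
  refine ⟨-(e.symm.toLinearMap ∘ₗ LinearMap.adjoint ι.toLinearMap), fun w l => ?_⟩
  have h1 : w + comb a l ∈ (vectorSpan ℝ F)ᗮ ↔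
      LinearMap.adjoint ι.toLinearMap w + e l = 0 := by
    rw [Submodule.mem_orthogonal', ← hι]
    constructor
    · intro h
      refine ext_inner_right ℝ fun v => ?_
      have h2 := h (ι v) ⟨v, rfl⟩
      rw [inner_add_left, inner_comb_isometry] at h2
      rw [inner_add_left, LinearMap.adjoint_inner_left, he, inner_zero_left]
      exact h2
    · rintro h _ ⟨v, rfl⟩
      have h2 : inner ℝ (LinearMap.adjoint ι.toLinearMap w + e l) v = 0 := by
        rw [h, inner_zero_left]
      rw [inner_add_left, LinearMap.adjoint_inner_left, he] at h2
      rw [inner_add_left]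
      change inner ℝ w (ι v) + inner ℝ (comb a l) (ι v) = 0
      rw [inner_comb_isometry]
      exact h2
  rw [h1, add_comm, add_eq_zero_iff_eq_neg]
  constructor
  · intro h
    simp only [LinearMap.neg_apply, LinearMap.comp_apply, LinearEquiv.coe_coe]
    rw [← map_neg, ← h, e.symm_apply_apply]
  · rintro rfl
    simp

lemma exists_linear_eq_faceMult {F : Set (E d)} {a : Fin j → E d} {ι : E j →ₗᵢ[ℝ] E d}
    (hι : LinearMap.range ι.toLinearMap = vectorSpan ℝ F)
    (hdet : LinearMap.det (coord a ∘ₗ ι.toLinearMap) ≠ 0) :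
    ∃ Λ : E d →ₗ[ℝ] E j, (∀ w l, w + comb a l ∈ (vectorSpan ℝ F)ᗮ ↔ l = Λ w) ∧
      ∀ w, faceMult F a w = Λ w := by
  obtain ⟨Λ, hΛ⟩ := exists_linear_faceMult hι hdet
  refine ⟨Λ, hΛ, fun w => ?_⟩
  have h : ∃ l, w + comb a l ∈ (vectorSpan ℝ F)ᗮ := ⟨Λ w, (hΛ _ _).2 rfl⟩
  rw [faceMult, dif_pos h]
  exact (hΛ _ _).1 h.choose_spec

/-- Fubini's theorem for an orthogonal decomposition. -/
lemma lintegral_orthogonal {V : Submodule ℝ (E d)} {ι : E j →ₗᵢ[ℝ] E d} {κ : E q →ₗᵢ[ℝ] E d}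
    (hι : LinearMap.range ι.toLinearMap = V) (hκ : LinearMap.range κ.toLinearMap = Vᗮ)
    {f : E d → ENNReal} (hf : Measurable f) :
    ∫⁻ w, f w = ∫⁻ z : E j, ∫⁻ v : E q, f (ι z + κ v) := by
  have horth : ∀ z v, inner ℝ (ι z) (κ v) = 0 := fun z v =>
    (Submodule.mem_orthogonal _ _).1 (hκ ▸ ⟨v, rfl⟩ : κ v ∈ Vᗮ) _ (hι ▸ ⟨z, rfl⟩)
  have hdim : j + q = d := by
    have h := V.finrank_add_finrank_orthogonal
    rw [← hκ, ← hι, LinearMap.finrank_range_of_inj ι.injective,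
      LinearMap.finrank_range_of_inj κ.injective] at h
    simpa using h
  let Φ₀ : WithLp 2 (E j × E q) →ₗ[ℝ] E d :=
    (ι.toLinearMap.coprod κ.toLinearMap) ∘ₗ (WithLp.linearEquiv 2 ℝ (E j × E q)).toLinearMap
  have hΦ₀ : ∀ p, Φ₀ p = ι p.fst + κ p.snd := fun p => rfl
  let Φ₁ : WithLp 2 (E j × E q) →ₗᵢ[ℝ] E d := ⟨Φ₀, fun p => by
    have h1 : ‖Φ₀ p‖ * ‖Φ₀ p‖ = ‖p‖ * ‖p‖ := by
      rw [hΦ₀, norm_add_sq_eq_norm_sq_add_norm_sq_of_inner_eq_zero _ _ (horth _ _), ι.norm_map,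
        κ.norm_map, ← sq ‖p‖, WithLp.prod_norm_sq_eq_of_L2, sq, sq]
    nlinarith [norm_nonneg (Φ₀ p), norm_nonneg p]⟩
  let Φ : WithLp 2 (E j × E q) ≃ₗᵢ[ℝ] E d := Φ₁.toLinearIsometryEquiv (by
    rw [(WithLp.linearEquiv 2 ℝ (E j × E q)).finrank_eq, Module.finrank_prod,
      finrank_euclideanSpace_fin, finrank_euclideanSpace_fin, finrank_euclideanSpace_fin, hdim])
  have hm : Measurable fun p : E j × E q => f (ι p.1 + κ p.2) :=
    hf.comp (Continuous.measurable (by fun_prop))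
  rw [← Φ.measurePreserving.lintegral_comp hf,
    ← (WithLp.volume_preserving_toLp (E j) (E q)).lintegral_comp (f := fun p => f (Φ p))
      (hf.comp Φ.continuous.measurable)]
  exact lintegral_prod _ hm.aemeasurable

/-- The change of variables `w = κ v - comb a l`. -/
lemma lintegral_eq_det_mul {V : Submodule ℝ (E d)} {ι : E j →ₗᵢ[ℝ] E d} {κ : E q →ₗᵢ[ℝ] E d}
    (hι : LinearMap.range ι.toLinearMap = V) (hκ : LinearMap.range κ.toLinearMap = Vᗮ)
    {a : Fin j → E d} (hdet : LinearMap.det (coord a ∘ₗ ι.toLinearMap) ≠ 0)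
    {f : E d → ENNReal} (hf : Measurable f) :
    ∫⁻ w, f w = ENNReal.ofReal |LinearMap.det (coord a ∘ₗ ι.toLinearMap)| *
      ∫⁻ l : E j, ∫⁻ v : E q, f (κ v - comb a l) := by
  set D := coord a ∘ₗ ι.toLinearMap with hD
  have hdadj : LinearMap.det (LinearMap.adjoint D) = LinearMap.det D := by
    let b := EuclideanSpace.basisFun (Fin j) ℝ
    rw [← LinearMap.det_toMatrix b.toBasis, LinearMap.toMatrix_adjoint b b,
      Matrix.det_conjTranspose, LinearMap.det_toMatrix, star_trivial]
  let D' := -LinearMap.adjoint D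
  have hdet' : |LinearMap.det D'| = |LinearMap.det D| := by
    rw [show D' = (-1 : ℝ) • LinearMap.adjoint D by simp [D'], LinearMap.det_smul, abs_mul,
      abs_pow, abs_neg, abs_one, one_pow, one_mul, hdadj]
  have hne : LinearMap.det D' ≠ 0 := by
    rw [← abs_ne_zero, hdet', abs_ne_zero]; exact hdet
  have hcD' : Continuous D' := LinearMap.continuous_of_finiteDimensional D'
  have hdecomp : ∀ l, ∃ v₀ : E q, ∀ v : E q, ι (D' l) + κ (v - v₀) = κ v - comb a l := by
    intro l
    have h1 : comb a l ∈ V ⊔ Vᗮ := by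
      rw [V.sup_orthogonal_of_hasOrthogonalProjection]; trivial
    obtain ⟨y, hy, z, hz, hyz⟩ := Submodule.mem_sup.1 h1
    rw [← hι] at hy
    rw [← hκ] at hz
    obtain ⟨y, rfl⟩ := hy
    obtain ⟨z, rfl⟩ := hz
    have hyz : ι y + κ z = comb a l := hyz
    refine ⟨z, fun v => ?_⟩
    have h2 : D' l = -y := by
      refine neg_inj.2 (ext_inner_right ℝ fun v => ?_)
      rw [← inner_comb_isometry, ← hyz, inner_add_left, ι.inner_map_map]
      have : inner ℝ (κ z) (ι v) = (0 : ℝ) := by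
        have hz : κ z ∈ Vᗮ := hκ ▸ ⟨z, rfl⟩
        exact (Submodule.mem_orthogonal' _ _).1 hz _ (hι ▸ ⟨v, rfl⟩)
      rw [this, add_zero]
    rw [h2, ← hyz, map_neg, map_sub]
    abel
  have hg : Measurable fun z : E j => ∫⁻ v : E q, f (ι z + κ v) :=
    Measurable.lintegral_prod_right' (f := fun p : E j × E q => f (ι p.1 + κ p.2))
      (hf.comp (Continuous.measurable (by fun_prop)))
  have hmap : ∫⁻ l, ∫⁻ v : E q, f (ι (D' l) + κ v) =
      ENNReal.ofReal |(LinearMap.det D')⁻¹| * ∫⁻ z : E j, ∫⁻ v : E q, f (ι z + κ v) := by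
    rw [← lintegral_map hg hcD'.measurable,
      Measure.map_linearMap_addHaar_eq_smul_addHaar _ hne, lintegral_smul_measure, smul_eq_mul]
  have hshift : ∀ l, ∫⁻ v : E q, f (ι (D' l) + κ v) = ∫⁻ v : E q, f (κ v - comb a l) := by
    intro l
    obtain ⟨v₀, hv₀⟩ := hdecomp l
    rw [← lintegral_sub_right_eq_self _ v₀]
    simp only [hv₀]
  rw [lintegral_orthogonal hι hκ hf, ← lintegral_congr hshift, hmap, ← mul_assoc,
    ← ENNReal.ofReal_mul (abs_nonneg _), abs_inv, hdet', mul_inv_cancel₀ (abs_ne_zero.2 hdet),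
    ENNReal.ofReal_one, one_mul]

/-- For a fixed frame `a`, the contribution of a face `F` to the integral over `w` and `x`. One
factor `|det|` comes from the volume of `coord a '' F`, the other one from the change of
variables. -/
lemma volume_mul_lintegral_faceMult {F : Set (E d)} {ι : E j →ₗᵢ[ℝ] E d} {κ : E q →ₗᵢ[ℝ] E d}
    (hι : LinearMap.range ι.toLinearMap = vectorSpan ℝ F)
    (hκ : LinearMap.range κ.toLinearMap = (vectorSpan ℝ F)ᗮ) (a : Fin j → E d)
    {S : E d → E j → ENNReal} (hS : Measurable (Function.uncurry S)) :
    volume (coord a '' F) * ∫⁻ w, S (w + comb a (faceMult F a w)) (faceMult F a w) =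
      μHE[j] F * (ENNReal.ofReal (LinearMap.det (coord a ∘ₗ ι.toLinearMap) ^ 2) *
        ∫⁻ l : E j, ∫⁻ v : E q, S (κ v) l) := by
  rw [volume_image_coord a hι]
  by_cases hdet : LinearMap.det (coord a ∘ₗ ι.toLinearMap) = 0
  · simp [hdet]
  obtain ⟨Λ, hΛ, hfm⟩ := exists_linear_eq_faceMult hι hdet
  have hcΛ : Continuous Λ := LinearMap.continuous_of_finiteDimensional Λ
  have hcc : Continuous fun w => comb a (Λ w) := continuous_comb continuous_const hcΛ
  have hm : Measurable fun w => S (w + comb a (Λ w)) (Λ w) :=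
    hS.comp (Continuous.measurable (by fun_prop : Continuous fun w => (w + comb a (Λ w), Λ w)))
  have hval : ∀ (l : E j) (v : E q), Λ (κ v - comb a l) = l := fun l v =>
    ((hΛ _ _).1 (by rw [sub_add_cancel, ← hκ]; exact ⟨v, rfl⟩)).symm
  simp only [hfm]
  rw [lintegral_eq_det_mul hι hκ hdet hm]
  simp only [hval, sub_add_cancel]
  rw [← sq_abs, sq, ENNReal.ofReal_mul (abs_nonneg _)]
  ring

lemma measurable_volume_mul_faceMult {F : Set (E d)} {ι : E j →ₗᵢ[ℝ] E d}
    (hι : LinearMap.range ι.toLinearMap = vectorSpan ℝ F) (a : Fin j → E d)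
    {S : E d → E j → ENNReal} (hS : Measurable (Function.uncurry S)) :
    Measurable fun w =>
      volume (coord a '' F) * S (w + comb a (faceMult F a w)) (faceMult F a w) := by
  by_cases hdet : LinearMap.det (coord a ∘ₗ ι.toLinearMap) = 0
  · rw [volume_image_coord a hι]
    simp [hdet]
  obtain ⟨Λ, hΛ, hfm⟩ := exists_linear_eq_faceMult hι hdet
  have hcΛ : Continuous Λ := LinearMap.continuous_of_finiteDimensional Λ
  have hcc : Continuous fun w => comb a (Λ w) := continuous_comb continuous_const hcΛ
  simp only [hfm]
  exact (hS.comp (Continuous.measurable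
    (by fun_prop : Continuous fun w => (w + comb a (Λ w), Λ w)))).const_mul _

/-! ### The multiplier of a polytope -/

/-- Lagrange multipliers: if the minimizer lies in the interior of the unit ball, then some point of
the face in direction `w + comb a (mult P a w x)` lies over `x`. Otherwise, a hyperplane separating
`x` from the image of the face is a direction of descent. -/
lemma exists_mem_faceIn {P : ConvexBody (E d)} (hP : P ∈ polytopes d) {a : Fin j → E d} {w : E d}
    {x : E j} (hx : DifferentiableAt ℝ (val P a w) x) (hlt : ‖mult P a w x‖ < 1) :
    ∃ y ∈ faceIn P (w + comb a (mult P a w x)), coord a y = x := by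
  obtain ⟨s, hs⟩ := hP
  set l := mult P a w x with hl
  set u := w + comb a l with hu
  by_contra! hne
  have hcont : Continuous (coord a) := LinearMap.continuous_of_finiteDimensional _
  have hxF : x ∉ coord a '' faceIn P u := by
    rintro ⟨y, hy, h⟩; exact hne y hy h
  obtain ⟨f, c, hf, hfx⟩ := geometric_hahn_banach_closed_point
    ((convex_faceIn P u).linear_image (coord a)) ((isCompact_faceIn P u).image hcont).isClosed hxF
  set m := (InnerProductSpace.toDual ℝ (E j)).symm f with hm
  have hfm : ∀ z, f z = inner ℝ m z := fun z => by simp [hm]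
  have hev1 : ∀ᶠ t : ℝ in 𝓝[>] 0, ‖l + t • m‖ ≤ 1 := by
    have hc : Tendsto (fun t : ℝ => ‖l + t • m‖) (𝓝 0) (𝓝 ‖l‖) := by
      have : Continuous fun t : ℝ => ‖l + t • m‖ := by fun_prop
      simpa using this.tendsto 0
    exact ((hc.mono_left nhdsWithin_le_nhds).eventually (gt_mem_nhds hlt)).mono
      fun _ h => le_of_lt h
  have hev2 : ∀ᶠ t : ℝ in 𝓝[>] 0, ∀ z ∈ s, inner ℝ (u + t • comb a m) z ≤ supp P u + t * c := by
    rw [Finset.eventually_all]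
    intro z hz
    have hzP : z ∈ (P : Set (E d)) := hs ▸ subset_convexHull ℝ _ hz
    by_cases hzF : z ∈ faceIn P u
    · filter_upwards [self_mem_nhdsWithin] with t ht
      have ht : 0 < t := ht
      have h1 := hf _ ⟨z, hzF, rfl⟩
      rw [hfm] at h1
      rw [inner_add_left, hzF.2, real_inner_smul_left, inner_comb]
      nlinarith
    · have h1 : inner ℝ u z < supp P u := lt_of_le_of_ne (le_supp P u hzP) fun h => hzF ⟨hzP, h⟩
      have hc : Tendsto (fun t : ℝ => inner ℝ (u + t • comb a m) z - t * c) (𝓝 0)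
          (𝓝 (inner ℝ u z)) := by
        have : Continuous fun t : ℝ => inner ℝ (u + t • comb a m) z - t * c := by fun_prop
        simpa using this.tendsto 0
      refine ((hc.mono_left nhdsWithin_le_nhds).eventually (gt_mem_nhds h1)).mono fun t ht => ?_
      linarith
  obtain ⟨t, ⟨h1, h2⟩, ht⟩ := ((hev1.and hev2).and self_mem_nhdsWithin).exists
  have ht : 0 < t := ht
  have h3 : supp P (u + t • comb a m) ≤ supp P u + t * c := by
    refine supp_le P _ fun y hy => ?_
    have hcvx : Convex ℝ {y : E d | inner ℝ (u + t • comb a m) y ≤ supp P u + t * c} :=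
      convex_halfSpace_le (innerₛₗ ℝ (u + t • comb a m)).isLinear _
    rw [hs] at hy
    exact convexHull_min (fun z hz => h2 z hz) hcvx hy
  have h4 := val_le P a w x h1
  rw [← (mult_spec hx).2, ← hl] at h4
  simp only [obj] at h4
  rw [map_add, map_smul, ← add_assoc, ← hu, inner_add_left, real_inner_smul_left] at h4
  rw [hfm] at hfx
  nlinarith

lemma eq_mult_of_mem_faceIn {K : ConvexBody (E d)} {a : Fin j → E d} {w : E d} {x l : E j}
    (hx : DifferentiableAt ℝ (val K a w) x) (hl : ‖l‖ ≤ 1) {y : E d}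
    (hy : y ∈ faceIn K (w + comb a l)) (hyx : coord a y = x) : l = mult K a w x := by
  refine eq_mult hx hl (le_antisymm ?_ (val_le K a w x hl))
  obtain ⟨l', -, h'⟩ := exists_obj_eq_val K a w x
  have h1 := le_supp K (w + comb a l') hy.1
  rw [inner_add_left, inner_comb, hyx] at h1
  have h2 := hy.2
  rw [inner_add_left, inner_comb, hyx] at h2
  rw [← h', obj, obj, ← h2]
  linarith

/-- For generic parameters, a function of the multiplier is a sum over the `j`-faces of a polytope:
only the face in direction `w + comb a (mult P a w x)` contributes, whose point over `x`
maximizes `w`. -/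
lemma eq_sum_faces {P : ConvexBody (E d)} (hP : P ∈ polytopes d) {a : Fin j → E d} {w : E d}
    {x : E j} (hx : DifferentiableAt ℝ (val P a w) x)
    (hw : ∀ F : Set (E d), F.Nonempty ∧ IsExposed ℝ (P : Set (E d)) F →
      j < Module.finrank ℝ (vectorSpan ℝ F) → ∀ l, w + comb a l ∉ (vectorSpan ℝ F)ᗮ)
    (hvol : ∀ F : Set (E d), F.Nonempty ∧ IsExposed ℝ (P : Set (E d)) F →
      volume (coord a '' F) = 0 → x ∉ coord a '' F)
    {T : E d → E j → ENNReal} (hT : ∀ u l, T u l ≠ 0 → ‖l‖ < 1) :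
    T (w + comb a (mult P a w x)) (mult P a w x) =
      ∑ F ∈ (finite_faces (j := j) hP).toFinset, (coord a '' F).indicator (fun _ =>
        (normalCone (P : Set (E d)) F).indicator (fun u => T u (faceMult F a w))
          (w + comb a (faceMult F a w))) x := by
  set l := mult P a w x with hl
  set u := w + comb a l with hu
  have hF'exp : (faceIn P u).Nonempty ∧ IsExposed ℝ (P : Set (E d)) (faceIn P u) :=
    ⟨faceIn_nonempty P u, isExposed_faceIn P u⟩
  have huF' : u ∈ (vectorSpan ℝ (faceIn P u))ᗮ := mem_orthogonal_vectorSpan (Set.Subset.refl _)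
  have hle : Module.finrank ℝ (vectorSpan ℝ (faceIn P u)) ≤ j := by
    by_contra! h
    exact hw _ hF'exp h l huF'
  have key : ∀ F ∈ faces j (P : Set (E d)), (coord a '' F).indicator (fun _ =>
      (normalCone (P : Set (E d)) F).indicator (fun u => T u (faceMult F a w))
        (w + comb a (faceMult F a w))) x ≠ 0 → F = faceIn P u ∧ T u l ≠ 0 := by
    intro F hF h
    obtain ⟨y, hyF, hyx⟩ := Set.mem_of_indicator_ne_zero h
    rw [Set.indicator_of_mem (show x ∈ coord a '' F from ⟨y, hyF, hyx⟩)] at h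
    have hn := Set.mem_of_indicator_ne_zero h
    rw [Set.indicator_of_mem hn] at h
    have hFP : F ⊆ (P : Set (E d)) := hF.2.1.subset
    rw [mem_normalCone_iff hFP] at hn
    have hfm := eq_mult_of_mem_faceIn hx (hT _ _ h).le (hn hyF) hyx
    rw [hfm] at h hn
    exact ⟨eq_of_subset_of_finrank_le hF.2.1 hF.1 (faceIn_subset P u) hn
      (hle.trans hF.2.2.ge), h⟩
  by_cases h0 : T u l = 0
  · rw [h0]
    refine (Finset.sum_eq_zero fun F hF => ?_).symm
    by_contra h
    exact (key F ((Set.Finite.mem_toFinset _).1 hF) h).2 h0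
  · obtain ⟨y, hyF, hyx⟩ := exists_mem_faceIn hP hx (hT _ _ h0)
    rw [← hl, ← hu] at hyF
    have hxF : x ∈ coord a '' faceIn P u := ⟨y, hyF, hyx⟩
    have hv : volume (coord a '' faceIn P u) ≠ 0 := fun h => hvol _ hF'exp h hxF
    have hge : j ≤ Module.finrank ℝ (vectorSpan ℝ (faceIn P u)) := by
      by_contra! h
      exact hv (volume_image_coord_eq_zero a h)
    have hface : faceIn P u ∈ faces j (P : Set (E d)) := ⟨hF'exp.1, hF'exp.2, le_antisymm hle hge⟩
    obtain ⟨ι, hι⟩ := exists_isometry_range_eq _ hface.2.2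
    have hdet : LinearMap.det (coord a ∘ₗ ι.toLinearMap) ≠ 0 := by
      intro h
      rw [volume_image_coord a hι, h] at hv
      simp at hv
    obtain ⟨Λ, hΛ, hfm⟩ := exists_linear_eq_faceMult hι hdet
    have hfl : faceMult (faceIn P u) a w = l := by rw [hfm]; exact ((hΛ w l).1 huF').symm
    rw [Finset.sum_eq_single (faceIn P u)]
    · rw [Set.indicator_of_mem hxF, hfl, Set.indicator_of_mem]
      rw [mem_normalCone_iff (faceIn_subset P u)]
    · intro F hF hne
      by_contra h
      exact hne (key F ((Set.Finite.mem_toFinset _).1 hF) h).1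
    · intro h
      exact absurd ((Set.Finite.mem_toFinset _).2 hface) h

/-! ### The contribution of a face -/

/-- The transform `T` for functions with values in `[0, ∞]`. -/
def lflagTransform (G : FlagManifold d q → ENNReal) (x : FlagManifold d q) : ENNReal :=
  ∫⁻ y, ENNReal.ofReal (absDet y x ^ 2) * G y ∂(fibreMeasure x)

/-- The contribution of the face `F` to the integral of `G` with respect to the flag measure
of `P`. -/
def faceIntegral (P : Set (E d)) (G : FlagManifold d (d - j) → ENNReal) (F : Set (E d)) : ENNReal :=
  μHE[j] F * ∫⁻ u in sphericalNormals P F,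
    FlagManifold.eval (lflagTransform G) u (vectorSpan ℝ F)ᗮ ∂μHE[d - 1 - j]

lemma continuous_det_coord (ι : E j →ₗᵢ[ℝ] E d) :
    Continuous fun a : Fin j → E d => LinearMap.det (coord a ∘ₗ ι.toLinearMap) := by
  let b := EuclideanSpace.basisFun (Fin j) ℝ
  have h : ∀ a : Fin j → E d, LinearMap.det (coord a ∘ₗ ι.toLinearMap) =
      (Matrix.of fun i k => inner ℝ (a i) (ι (b k))).det := by
    intro a
    rw [← LinearMap.det_toMatrix b.toBasis]
    congr 1
    ext i k
    rw [LinearMap.toMatrix_apply]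
    simp [b]
  simp only [h]
  exact Continuous.matrix_det (continuous_matrix fun i k => by
    simp only [Matrix.of_apply]; fun_prop)

/-- One factor `gramDet` of `frameWeight` is part of `weight`; the other one arises from the
determinants of the face, together with the factor `absDet ^ 2`. -/
lemma lintegral_det_sq (hj : j + 2 ≤ d) (x₀ x : FlagManifold d (d - j)) {ι : E j →ₗᵢ[ℝ] E d}
    (hι : LinearMap.range ι.toLinearMap = x.Lᗮ)
    {G : FlagManifold d (d - j) → ENNReal} (hG : Measurable G) :
    ∫⁻ a : Fin j → E d, ENNReal.ofReal (LinearMap.det (coord a ∘ₗ ι.toLinearMap) ^ 2 *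
        (cut (∑ i, ‖a i‖ ^ 2) * gramDet x.u a)) * G (flagOf x₀ (x.u, a)) =
      frameMass d j x.u * lflagTransform G x := by
  rw [lflagTransform, ← lintegral_frameWeight hj x₀ x (G := fun y =>
    ENNReal.ofReal (absDet y x ^ 2) * G y)
    ((continuous_absDet_sq x).measurable.ennreal_ofReal.mul hG)]
  refine lintegral_congr fun a => ?_
  by_cases hg : gramDet x.u a = 0
  · simp [hg, frameWeight]
  have hu0 : x.u ≠ 0 := norm_ne_zero_iff.1 (by rw [x.norm_u]; exact one_ne_zero)
  rw [det_coord_sq hι hg (flagOf_L x₀ (p := (x.u, a)) ⟨hu0, hg⟩),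
    ← mul_assoc (ENNReal.ofReal (frameWeight x.u a)),
    ← ENNReal.ofReal_mul (frameWeight_nonneg _ _), frameWeight]
  congr 2
  ring

lemma smul_mem_normalCone_iff {P F : Set (E d)} {r : ℝ} (hr : 0 < r) {u : E d} :
    r • u ∈ normalCone P F ↔ u ∈ normalCone P F := by
  simp only [normalCone, Set.mem_ofPred_eq, real_inner_smul_left]
  refine forall₂_congr fun x _ => forall₂_congr fun y _ => ?_
  exact ⟨fun h => by by_contra! h'; nlinarith [mul_pos hr h'], fun h => by nlinarith⟩

/-- Integration over the sphere of a subspace. -/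
lemma lintegral_image_sphere {κ : E q →ₗᵢ[ℝ] E d} {n : ℕ} {S : Set (E d)} (hS : MeasurableSet S)
    (hSs : S ⊆ sphere 0 1) (hSr : S ⊆ Set.range κ) (e : E d → ENNReal) :
    ∫⁻ v in sphere (0 : E q) 1, (κ ⁻¹' S).indicator (fun v => e (κ v)) v ∂μHE[n] =
      ∫⁻ u in S, e u ∂μHE[n] := by
  have hκ : MeasurableEmbedding κ := κ.isometry.isClosedEmbedding.measurableEmbedding
  have h1 : (μHE[n] : Measure (E d)).restrict S =
      ((μHE[n] : Measure (E q)).restrict (κ ⁻¹' S)).map κ := by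
    rw [← hκ.restrict_map, κ.isometry.map_euclideanHausdorffMeasure,
      Measure.restrict_restrict hS, Set.inter_eq_left.2 hSr]
  have hsub : κ ⁻¹' S ⊆ sphere 0 1 := fun v hv => by
    have := hSs hv
    simpa using this
  rw [h1, hκ.lintegral_map, lintegral_indicator (hκ.measurable hS),
    Measure.restrict_restrict (hκ.measurable hS), Set.inter_eq_left.2 hsub]

/-- Integration in polar coordinates over the normal space of a face. The power `4 * j` is the
degree of homogeneity of `gramDet` in its first argument. -/
lemma lintegral_normal_space (hj : j + 2 ≤ d) (x₀ : FlagManifold d (d - j))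
    {c : ENNReal} (hc : ∀ k : E (d - j) → ENNReal, Measurable k →
      ∫⁻ v, ENNReal.ofReal (cut (‖v‖ ^ 2) * ‖v‖ ^ (4 * j)) * k (‖v‖⁻¹ • v) =
        c * ∫⁻ v in sphere (0 : E (d - j)) 1, k v ∂μHE[d - j - 1])
    {P : ConvexBody (E d)} {F : Set (E d)} (hF : F ∈ faces j (P : Set (E d)))
    {ι : E j →ₗᵢ[ℝ] E d} {κ : E (d - j) →ₗᵢ[ℝ] E d}
    (hι : LinearMap.range ι.toLinearMap = vectorSpan ℝ F)
    (hκ : LinearMap.range κ.toLinearMap = (vectorSpan ℝ F)ᗮ)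
    {G : FlagManifold d (d - j) → ENNReal} (hG : Measurable G) :
    μHE[j] F * ∫⁻ v : E (d - j), (normalCone (P : Set (E d)) F).indicator (fun u =>
        ∫⁻ a : Fin j → E d, ENNReal.ofReal (LinearMap.det (coord a ∘ₗ ι.toLinearMap) ^ 2) *
          (ENNReal.ofReal (weight (u, a)) * G (flagOf x₀ (u, a)))) (κ v) =
      c * frameMass d j x₀.u * faceIntegral (P : Set (E d)) G F := by
  set N := normalCone (P : Set (E d)) F
  have hN : MeasurableSet N := (isClosed_normalCone _ _).measurableSet
  have hFP : F ⊆ (P : Set (E d)) := hF.2.1.subset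
  have hfin : Module.finrank ℝ (vectorSpan ℝ F)ᗮ = d - j := by
    have := (vectorSpan ℝ F).finrank_add_finrank_orthogonal
    rw [hF.2.2, finrank_euclideanSpace_fin] at this
    omega
  let h : E d → ENNReal := fun u => ∫⁻ a : Fin j → E d,
    ENNReal.ofReal (LinearMap.det (coord a ∘ₗ ι.toLinearMap) ^ 2 *
        (cut (∑ i, ‖a i‖ ^ 2) * gramDet u a)) * G (flagOf x₀ (u, a))
  have hh : Measurable h := by
    refine Measurable.lintegral_prod_right' (f := fun p : E d × (Fin j → E d) =>
      ENNReal.ofReal (LinearMap.det (coord p.2 ∘ₗ ι.toLinearMap) ^ 2 *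
        (cut (∑ i, ‖p.2 i‖ ^ 2) * gramDet p.1 p.2)) * G (flagOf x₀ p))
      (Measurable.mul (Measurable.ennreal_ofReal (Continuous.measurable ?_))
        (hG.comp (measurable_flagOf x₀)))
    have h1 := (continuous_det_coord ι).comp (continuous_snd (X := E d))
    exact (h1.pow 2).mul (Continuous.mul (by fun_prop) continuous_gramDet)
  have hk : Measurable fun v : E (d - j) => N.indicator h (κ v) :=
    (hh.indicator hN).comp κ.continuous.measurable
  have hpolar : ∀ᵐ v : E (d - j), N.indicator (fun u => ∫⁻ a : Fin j → E d,
        ENNReal.ofReal (LinearMap.det (coord a ∘ₗ ι.toLinearMap) ^ 2) *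
          (ENNReal.ofReal (weight (u, a)) * G (flagOf x₀ (u, a)))) (κ v) =
      ENNReal.ofReal (cut (‖v‖ ^ 2) * ‖v‖ ^ (4 * j)) * N.indicator h (κ (‖v‖⁻¹ • v)) := by
    have : Nontrivial (E (d - j)) := by
      have : Nonempty (Fin (d - j)) := ⟨⟨0, by omega⟩⟩
      infer_instance
    filter_upwards [Measure.ae_ne volume (0 : E (d - j))] with v hv
    have hv0 : 0 < ‖v‖ := norm_pos_iff.2 hv
    have hv1 : 0 < ‖v‖⁻¹ := inv_pos.2 hv0
    rw [map_smul]
    by_cases hvN : κ v ∈ N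
    · rw [Set.indicator_of_mem hvN, Set.indicator_of_mem ((smul_mem_normalCone_iff hv1).2 hvN),
        ← lintegral_const_mul' _ _ ENNReal.ofReal_ne_top]
      refine lintegral_congr fun a => ?_
      rw [flagOf_smul_left x₀ hv1, ← mul_assoc, ← mul_assoc, ← ENNReal.ofReal_mul (sq_nonneg _),
        ← ENNReal.ofReal_mul (mul_nonneg (cut_nonneg _) (by positivity))]
      congr 2
      rw [gramDet_smul_left, weight]
      simp only [κ.norm_map]
      have : ‖v‖ ^ (4 * j) * ((‖v‖⁻¹ ^ 2) ^ 2) ^ j = 1 := by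
        rw [← pow_mul, ← pow_mul, show 2 * (2 * j) = 4 * j by ring, ← mul_pow,
          mul_inv_cancel₀ hv0.ne', one_pow]
      linear_combination (-(LinearMap.det (coord a ∘ₗ ι.toLinearMap) ^ 2 * cut (‖v‖ ^ 2) *
        cut (∑ i, ‖a i‖ ^ 2) * gramDet (κ v) a)) * this
    · rw [Set.indicator_of_notMem hvN, Set.indicator_of_notMem
        (fun h => hvN ((smul_mem_normalCone_iff hv1).1 h)), mul_zero]
  rw [lintegral_congr_ae hpolar, hc _ hk, faceIntegral]
  have hS : sphericalNormals (P : Set (E d)) F = sphere 0 1 ∩ N := by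
    ext u; simp [sphericalNormals, N, normalCone]
  have hSr : sphere 0 1 ∩ N ⊆ Set.range κ := fun u hu => by
    have h1 : u ∈ LinearMap.range κ.toLinearMap := hκ ▸ normalCone_subset_orthogonal hFP hu.2
    exact h1
  have hdim : d - 1 - j = d - j - 1 := by omega
  rw [hS, hdim, ← lintegral_image_sphere (κ := κ) (isClosed_sphere.measurableSet.inter hN)
    Set.inter_subset_left hSr]
  have hval : ∀ v ∈ sphere (0 : E (d - j)) 1, N.indicator h (κ v) = frameMass d j x₀.u *
      (κ ⁻¹' (sphere 0 1 ∩ N)).indicator (fun v =>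
        FlagManifold.eval (lflagTransform G) (κ v) (vectorSpan ℝ F)ᗮ) v := by
    intro v hv
    have hv1 : ‖κ v‖ = 1 := by simpa using hv
    by_cases hvN : κ v ∈ N
    · rw [Set.indicator_of_mem hvN, Set.indicator_of_mem (show v ∈ κ ⁻¹' (sphere 0 1 ∩ N) from
        ⟨by simpa using hv, hvN⟩)]
      have hmem : κ v ∈ (vectorSpan ℝ F)ᗮ := normalCone_subset_orthogonal hFP hvN
      rw [FlagManifold.eval, dif_pos ⟨hv1, hfin, hmem⟩, frameMass_eq x₀.norm_u hv1]
      exact lintegral_det_sq hj x₀ ⟨κ v, (vectorSpan ℝ F)ᗮ, hv1, hfin, hmem⟩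
        (by rw [hι, Submodule.orthogonal_orthogonal]) hG
    · rw [Set.indicator_of_notMem hvN, Set.indicator_of_notMem (fun h => hvN h.2), mul_zero]
  rw [setLIntegral_congr_fun isClosed_sphere.measurableSet hval,
    lintegral_const_mul' _ _ (frameMass_ne_top _)]
  ring

/-! ### The auxiliary measure of a polytope -/

/-- The mass of the cut-off function on `E j`. -/
def cutMass (j : ℕ) : ENNReal := ∫⁻ l : E j, ENNReal.ofReal (cut (‖l‖ ^ 2))

lemma measurable_ofReal_cut : Measurable fun l : E j => ENNReal.ofReal (cut (‖l‖ ^ 2)) :=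
  (by fun_prop : Continuous fun l : E j => cut (‖l‖ ^ 2)).measurable.ennreal_ofReal

lemma cutMass_ne_top (j : ℕ) : cutMass j ≠ ⊤ := by
  have hle : cutMass j ≤ ∫⁻ l : E j, (closedBall (0 : E j) 1).indicator 1 l := by
    refine lintegral_mono fun l => ?_
    by_cases h : cut (‖l‖ ^ 2) = 0
    · simp [h]
    · have h1 := lt_one_of_cut_ne_zero h
      have hl : l ∈ closedBall (0 : E j) 1 := by
        rw [mem_closedBall_zero_iff]; nlinarith [norm_nonneg l]
      rw [Set.indicator_of_mem hl, Pi.one_apply]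
      exact ENNReal.ofReal_le_one.2 (cut_le_one (sq_nonneg _))
  rw [lintegral_indicator_one isClosed_closedBall.measurableSet] at hle
  exact (hle.trans_lt (isCompact_closedBall _ _).measure_lt_top).ne

lemma cutMass_ne_zero (j : ℕ) : cutMass j ≠ 0 := by
  rw [← pos_iff_ne_zero, cutMass, lintegral_pos_iff_support measurable_ofReal_cut]
  have hopen : IsOpen {l : E j | 0 < cut (‖l‖ ^ 2)} := isOpen_lt continuous_const (by fun_prop)
  refine (hopen.measure_pos volume ⟨0, ?_⟩).trans_le (measure_mono fun l hl => ?_)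
  · exact cut_pos (by simp)
  · exact (ENNReal.ofReal_pos.2 hl).ne'

lemma lintegral_mult {P : ConvexBody (E d)} (hP : P ∈ polytopes d) (a : Fin j → E d)
    {T : E d → E j → ENNReal} (hT : ∀ u l, T u l ≠ 0 → ‖l‖ < 1)
    (hTm : Measurable (Function.uncurry T)) {ι : Set (E d) → E j →ₗᵢ[ℝ] E d}
    {κ : Set (E d) → E q →ₗᵢ[ℝ] E d}
    (hι : ∀ F ∈ faces j (P : Set (E d)), LinearMap.range (ι F).toLinearMap = vectorSpan ℝ F)
    (hκ : ∀ F ∈ faces j (P : Set (E d)), LinearMap.range (κ F).toLinearMap = (vectorSpan ℝ F)ᗮ) :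
    ∫⁻ w, ∫⁻ x, T (w + comb a (mult P a w x)) (mult P a w x) =
      ∑ F ∈ (finite_faces (j := j) hP).toFinset, μHE[j] F *
        (ENNReal.ofReal (LinearMap.det (coord a ∘ₗ (ι F).toLinearMap) ^ 2) *
          ∫⁻ l : E j, ∫⁻ v : E q, (normalCone (P : Set (E d)) F).indicator (fun u => T u l)
            (κ F v)) := by
  let S : Set (E d) → E d → E j → ENNReal := fun F u l =>
    (normalCone (P : Set (E d)) F).indicator (fun u => T u l) u
  have hS : ∀ F, Measurable (Function.uncurry (S F)) := fun F => by
    have h : Function.uncurry (S F) =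
        (Prod.fst ⁻¹' normalCone (P : Set (E d)) F).indicator (Function.uncurry T) := by
      ext1 ⟨u, l⟩
      by_cases hu : u ∈ normalCone (P : Set (E d)) F <;> simp [S, Function.uncurry, hu]
    rw [h]
    exact hTm.indicator (measurable_fst (isClosed_normalCone _ _).measurableSet)
  have hcpt : ∀ F ∈ faces j (P : Set (E d)), IsCompact (coord a '' F) := fun F hF =>
    (isCompact_of_mem_faces hF).image (LinearMap.continuous_of_finiteDimensional _)
  have hgen : ∀ᵐ w : E d, ∀ F : Set (E d), F.Nonempty ∧ IsExposed ℝ (P : Set (E d)) F →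
      j < Module.finrank ℝ (vectorSpan ℝ F) → ∀ l, w + comb a l ∉ (vectorSpan ℝ F)ᗮ := by
    have h1 : ∀ᵐ w : E d, ∀ F ∈ {F : Set (E d) | F.Nonempty ∧ IsExposed ℝ (P : Set (E d)) F},
        j < Module.finrank ℝ (vectorSpan ℝ F) → ∀ l, w + comb a l ∉ (vectorSpan ℝ F)ᗮ := by
      rw [ae_ball_iff (finite_exposed hP).countable]
      intro F _
      by_cases hF : j < Module.finrank ℝ (vectorSpan ℝ F)
      · exact (ae_notMem_orthogonal a hF).mono fun w hw _ => hw
      · exact Filter.Eventually.of_forall fun w h => absurd h hF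
    exact h1
  have hvol : ∀ᵐ x : E j, ∀ F : Set (E d), F.Nonempty ∧ IsExposed ℝ (P : Set (E d)) F →
      volume (coord a '' F) = 0 → x ∉ coord a '' F := by
    have h1 : ∀ᵐ x : E j, ∀ F ∈ {F : Set (E d) | F.Nonempty ∧ IsExposed ℝ (P : Set (E d)) F},
        volume (coord a '' F) = 0 → x ∉ coord a '' F := by
      rw [ae_ball_iff (finite_exposed hP).countable]
      intro F _
      by_cases hF : volume (coord a '' F) = 0
      · exact (measure_eq_zero_iff_ae_notMem.1 hF).mono fun x hx _ => hx
      · exact Filter.Eventually.of_forall fun x h => absurd h hF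
    exact h1
  have hw : ∀ᵐ w : E d, ∫⁻ x, T (w + comb a (mult P a w x)) (mult P a w x) =
      ∑ F ∈ (finite_faces (j := j) hP).toFinset, volume (coord a '' F) *
        S F (w + comb a (faceMult F a w)) (faceMult F a w) := by
    filter_upwards [hgen] with w hw
    have hx : ∀ᵐ x : E j, T (w + comb a (mult P a w x)) (mult P a w x) =
        ∑ F ∈ (finite_faces (j := j) hP).toFinset, (coord a '' F).indicator (fun _ =>
          S F (w + comb a (faceMult F a w)) (faceMult F a w)) x := by
      filter_upwards [hvol, ae_differentiableAt_val P a w] with x hx hd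
      exact eq_sum_faces hP hd hw hx hT
    rw [lintegral_congr_ae hx, lintegral_finsetSum' _ fun F hF => ?_]
    · refine Finset.sum_congr rfl fun F hF => ?_
      rw [lintegral_indicator_const (hcpt F ((Set.Finite.mem_toFinset _).1 hF)).measurableSet,
        mul_comm]
    · exact (measurable_const.indicator
        (hcpt F ((Set.Finite.mem_toFinset _).1 hF)).measurableSet).aemeasurable
  rw [lintegral_congr_ae hw, lintegral_finsetSum' _ fun F hF =>
    (measurable_volume_mul_faceMult (hι F ((Set.Finite.mem_toFinset _).1 hF)) a
      (hS F)).aemeasurable]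
  refine Finset.sum_congr rfl fun F hF => ?_
  have hF := (Set.Finite.mem_toFinset _).1 hF
  rw [lintegral_const_mul' _ _ (hcpt F hF).measure_lt_top.ne,
    volume_mul_lintegral_faceMult (hι F hF) (hκ F hF) a (hS F)]

/-- The value of `G` at the flag of `u` and `a`, weighted with the part of the density that depends
only on `u` and `a`. -/
def weighted (x₀ : FlagManifold d (d - j)) (G : FlagManifold d (d - j) → ENNReal)
    (a : Fin j → E d) (u : E d) : ENNReal :=
  ENNReal.ofReal (weight (u, a)) * G (flagOf x₀ (u, a))

lemma measurable_weighted (x₀ : FlagManifold d (d - j)) {G : FlagManifold d (d - j) → ENNReal}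
    (hG : Measurable G) : Measurable fun p : E d × (Fin j → E d) => weighted x₀ G p.2 p.1 :=
  continuous_weight.measurable.ennreal_ofReal.mul (hG.comp (measurable_flagOf x₀))

lemma measurable_weighted_right (x₀ : FlagManifold d (d - j))
    {G : FlagManifold d (d - j) → ENNReal} (hG : Measurable G) (a : Fin j → E d) :
    Measurable (weighted x₀ G a) :=
  Measurable.of_uncurry_right (f := fun u a => weighted x₀ G a u) (measurable_weighted x₀ hG)

lemma measurable_cut_mul_weighted (x₀ : FlagManifold d (d - j))
    {G : FlagManifold d (d - j) → ENNReal} (hG : Measurable G) (a : Fin j → E d) :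
    Measurable fun p : E d × E j => ENNReal.ofReal (cut (‖p.2‖ ^ 2)) * weighted x₀ G a p.1 :=
  (measurable_ofReal_cut.comp measurable_snd).mul
    ((measurable_weighted_right x₀ hG a).comp measurable_fst)

/-- The contribution of a face `F`, as a function of the frame `a` and of a vector `v` of the normal
space of `F`, which is parametrized by `κ`; the direction of `F` is parametrized by `ι`. -/
def frameIntegrand (x₀ : FlagManifold d (d - j)) (P F : Set (E d)) (ι : E j →ₗᵢ[ℝ] E d)
    (κ : E q →ₗᵢ[ℝ] E d) (G : FlagManifold d (d - j) → ENNReal) (a : Fin j → E d) (v : E q) :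
    ENNReal :=
  ENNReal.ofReal (LinearMap.det (coord a ∘ₗ ι.toLinearMap) ^ 2) *
    (normalCone P F).indicator (weighted x₀ G a) (κ v)

lemma measurable_frameIntegrand (x₀ : FlagManifold d (d - j)) (P F : Set (E d))
    (ι : E j →ₗᵢ[ℝ] E d) (κ : E q →ₗᵢ[ℝ] E d) {G : FlagManifold d (d - j) → ENNReal}
    (hG : Measurable G) : Measurable (Function.uncurry (frameIntegrand x₀ P F ι κ G)) := by
  have h2 : (fun p : (Fin j → E d) × E q =>
      (normalCone P F).indicator (weighted x₀ G p.1) (κ p.2)) =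
      ((fun p : (Fin j → E d) × E q => κ p.2) ⁻¹' normalCone P F).indicator
        fun p => weighted x₀ G p.1 (κ p.2) := by
    ext1 p
    by_cases hv : κ p.2 ∈ normalCone P F <;> simp [hv]
  have hκm : Measurable fun p : (Fin j → E d) × E q => κ p.2 := Continuous.measurable (by fun_prop)
  refine Measurable.mul ?_ ?_
  · exact (((continuous_det_coord ι).comp continuous_fst).pow 2).measurable.ennreal_ofReal
  · rw [h2]
    exact ((measurable_weighted x₀ hG).comp (hκm.prodMk measurable_fst)).indicator
      (hκm (isClosed_normalCone _ _).measurableSet)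

lemma lintegral_frameIntegrand (hj : j + 2 ≤ d) (x₀ : FlagManifold d (d - j))
    {c : ENNReal} (hc : ∀ k : E (d - j) → ENNReal, Measurable k →
      ∫⁻ v, ENNReal.ofReal (cut (‖v‖ ^ 2) * ‖v‖ ^ (4 * j)) * k (‖v‖⁻¹ • v) =
        c * ∫⁻ v in sphere (0 : E (d - j)) 1, k v ∂μHE[d - j - 1])
    {P : ConvexBody (E d)} {F : Set (E d)} (hF : F ∈ faces j (P : Set (E d)))
    {ι : E j →ₗᵢ[ℝ] E d} {κ : E (d - j) →ₗᵢ[ℝ] E d}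
    (hι : LinearMap.range ι.toLinearMap = vectorSpan ℝ F)
    (hκ : LinearMap.range κ.toLinearMap = (vectorSpan ℝ F)ᗮ)
    {G : FlagManifold d (d - j) → ENNReal} (hG : Measurable G) :
    μHE[j] F * ∫⁻ a, ∫⁻ v, frameIntegrand x₀ (P : Set (E d)) F ι κ G a v =
      c * frameMass d j x₀.u * faceIntegral (P : Set (E d)) G F := by
  rw [lintegral_lintegral_swap (measurable_frameIntegrand x₀ _ F ι κ hG).aemeasurable,
    ← lintegral_normal_space hj x₀ hc hF hι hκ hG]
  congr 1
  refine lintegral_congr fun v => ?_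
  by_cases hv : κ v ∈ normalCone (P : Set (E d)) F <;> simp [frameIntegrand, weighted, hv]

/-- The integral over `w` and `x` as a sum over the faces. -/
lemma lintegral_density_eq (x₀ : FlagManifold d (d - j)) {P : ConvexBody (E d)}
    (hP : P ∈ polytopes d) {G : FlagManifold d (d - j) → ENNReal} (hG : Measurable G)
    {ι : Set (E d) → E j →ₗᵢ[ℝ] E d} {κ : Set (E d) → E q →ₗᵢ[ℝ] E d}
    (hι : ∀ F ∈ faces j (P : Set (E d)), LinearMap.range (ι F).toLinearMap = vectorSpan ℝ F)
    (hκ : ∀ F ∈ faces j (P : Set (E d)), LinearMap.range (κ F).toLinearMap = (vectorSpan ℝ F)ᗮ)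
    (a : Fin j → E d) :
    ∫⁻ w, ∫⁻ x, ENNReal.ofReal (density P ((a, w), x)) * G (flagOf x₀ (normalVec P ((a, w), x))) =
      ∑ F ∈ (finite_faces (j := j) hP).toFinset, cutMass j * μHE[j] F *
        ∫⁻ v, frameIntegrand x₀ (P : Set (E d)) F (ι F) (κ F) G a v := by
  let T : E d → E j → ENNReal := fun u l => ENNReal.ofReal (cut (‖l‖ ^ 2)) * weighted x₀ G a u
  have hT : ∀ u l, T u l ≠ 0 → ‖l‖ < 1 := fun u l h => by
    have h1 : cut (‖l‖ ^ 2) ≠ 0 := fun h0 => h (by simp [T, h0])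
    nlinarith [lt_one_of_cut_ne_zero h1, norm_nonneg l]
  have hTm : Measurable (Function.uncurry T) := measurable_cut_mul_weighted x₀ hG a
  have hden : ∀ w x, ENNReal.ofReal (density P ((a, w), x)) *
      G (flagOf x₀ (normalVec P ((a, w), x))) =
        T (w + comb a (mult P a w x)) (mult P a w x) := fun w x => by
    simp only [density, normalVec, weighted, T]
    rw [ENNReal.ofReal_mul (cut_nonneg _), mul_assoc]
  simp only [hden]
  rw [lintegral_mult hP a hT hTm hι hκ]
  refine Finset.sum_congr rfl fun F _ => ?_
  have hsplit : ∫⁻ l : E j, ∫⁻ v : E q, (normalCone (P : Set (E d)) F).indicator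
        (fun u => T u l) (κ F v) = cutMass j *
          ∫⁻ v : E q, (normalCone (P : Set (E d)) F).indicator (weighted x₀ G a) (κ F v) := by
    rw [cutMass, ← lintegral_mul_const _ measurable_ofReal_cut]
    refine lintegral_congr fun l => ?_
    rw [← lintegral_const_mul' _ _ ENNReal.ofReal_ne_top]
    refine lintegral_congr fun v => ?_
    by_cases hv : κ F v ∈ normalCone (P : Set (E d)) F <;> simp [T, hv]
  rw [hsplit]
  simp only [frameIntegrand]
  rw [lintegral_const_mul' _ _ ENNReal.ofReal_ne_top]
  ring

lemma volume_param_lintegral {f : Param d j → ENNReal} (hf : Measurable f) :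
    ∫⁻ p, f p = ∫⁻ a, ∫⁻ w, ∫⁻ x, f ((a, w), x) := by
  rw [Measure.volume_eq_prod, lintegral_prod _ hf.aemeasurable, Measure.volume_eq_prod,
    lintegral_prod _ (Measurable.lintegral_prod_right' hf).aemeasurable]

lemma lintegral_auxMeasure_eq_sum (hj : j + 2 ≤ d) (x₀ : FlagManifold d (d - j))
    {c : ENNReal} (hc : ∀ k : E (d - j) → ENNReal, Measurable k →
      ∫⁻ v, ENNReal.ofReal (cut (‖v‖ ^ 2) * ‖v‖ ^ (4 * j)) * k (‖v‖⁻¹ • v) =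
        c * ∫⁻ v in sphere (0 : E (d - j)) 1, k v ∂μHE[d - j - 1])
    {P : ConvexBody (E d)} (hP : P ∈ polytopes d)
    {ι : Set (E d) → E j →ₗᵢ[ℝ] E d} {κ : Set (E d) → E (d - j) →ₗᵢ[ℝ] E d}
    (hι : ∀ F ∈ faces j (P : Set (E d)), LinearMap.range (ι F).toLinearMap = vectorSpan ℝ F)
    (hκ : ∀ F ∈ faces j (P : Set (E d)), LinearMap.range (κ F).toLinearMap = (vectorSpan ℝ F)ᗮ)
    {G : FlagManifold d (d - j) → ENNReal} (hG : Measurable G) :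
    ∫⁻ x, G x ∂(auxMeasure x₀ P) = cutMass j * (c * frameMass d j x₀.u) *
      ∑ F ∈ (finite_faces (j := j) hP).toFinset, faceIntegral (P : Set (E d)) G F := by
  have hm : Measurable fun p : Param d j =>
      ENNReal.ofReal (density P p) * G (flagOf x₀ (normalVec P p)) :=
    (measurable_density P).ennreal_ofReal.mul (hG.comp (measurable_flagOf_normalVec x₀ P))
  rw [lintegral_auxMeasure x₀ P hG, volume_param_lintegral hm]
  simp only [lintegral_density_eq x₀ hP hG hι hκ]
  have hR : ∀ F : Set (E d), Measurable fun a : Fin j → E d => cutMass j * μHE[j] F *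
      ∫⁻ v, frameIntegrand x₀ (P : Set (E d)) F (ι F) (κ F) G a v := fun F =>
    (Measurable.lintegral_prod_right' (measurable_frameIntegrand x₀ _ F (ι F) (κ F) hG)).const_mul _
  rw [lintegral_finsetSum' _ fun F _ => (hR F).aemeasurable, Finset.mul_sum]
  refine Finset.sum_congr rfl fun F hF => ?_
  have hF := (Set.Finite.mem_toFinset _).1 hF
  rw [lintegral_const_mul' _ _ (ENNReal.mul_ne_top (cutMass_ne_top j)
    (euclideanHausdorffMeasure_face_ne_top hF)), mul_assoc, mul_assoc (cutMass j),
    ← lintegral_frameIntegrand hj x₀ hc hF (hι F hF) (hκ F hF) hG]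

/-- Up to a constant factor, the auxiliary measure of a polytope is its flag measure. -/
theorem exists_lintegral_auxMeasure_eq (hj : j + 2 ≤ d) (x₀ : FlagManifold d (d - j)) :
    ∃ C : ENNReal, C ≠ 0 ∧ C ≠ ⊤ ∧ ∀ {P : ConvexBody (E d)} (hP : P ∈ polytopes d)
      {G : FlagManifold d (d - j) → ENNReal}, Measurable G →
      ∫⁻ x, G x ∂(auxMeasure x₀ P) =
        C * ∑ F ∈ (finite_faces (j := j) hP).toFinset, faceIntegral (P : Set (E d)) G F := by
  obtain ⟨c, hc0, hct, hc⟩ := exists_lintegral_normalize_eq (q := d - j) (by omega) (4 * j)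
  refine ⟨cutMass j * (c * frameMass d j x₀.u),
    mul_ne_zero (cutMass_ne_zero j) (mul_ne_zero hc0 (frameMass_ne_zero (by omega) x₀)),
    ENNReal.mul_ne_top (cutMass_ne_top j) (ENNReal.mul_ne_top hct (frameMass_ne_top _)), ?_⟩
  intro P hP G hG
  have hfin : Module.finrank ℝ x₀.Lᗮ = j := by
    have := x₀.L.finrank_add_finrank_orthogonal
    rw [x₀.finrank_L, finrank_euclideanSpace_fin] at this
    omega
  have hι : ∀ F : Set (E d), ∃ ι : E j →ₗᵢ[ℝ] E d, F ∈ faces j (P : Set (E d)) →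
      LinearMap.range ι.toLinearMap = vectorSpan ℝ F := fun F => by
    by_cases hF : F ∈ faces j (P : Set (E d))
    · obtain ⟨ι, h⟩ := exists_isometry_range_eq _ hF.2.2
      exact ⟨ι, fun _ => h⟩
    · obtain ⟨ι, -⟩ := exists_isometry_range_eq _ hfin
      exact ⟨ι, fun h => absurd h hF⟩
  have hκ : ∀ F : Set (E d), ∃ κ : E (d - j) →ₗᵢ[ℝ] E d, F ∈ faces j (P : Set (E d)) →
      LinearMap.range κ.toLinearMap = (vectorSpan ℝ F)ᗮ := fun F => by
    by_cases hF : F ∈ faces j (P : Set (E d))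
    · obtain ⟨κ, h⟩ := exists_isometry_range_eq (q := d - j) (vectorSpan ℝ F)ᗮ (by
        have := (vectorSpan ℝ F).finrank_add_finrank_orthogonal
        rw [hF.2.2, finrank_euclideanSpace_fin] at this
        omega)
      exact ⟨κ, fun _ => h⟩
    · obtain ⟨κ, -⟩ := exists_isometry_range_eq _ x₀.finrank_L
      exact ⟨κ, fun h => absurd h hF⟩
  choose ι hι using hι
  choose κ hκ using hκ
  exact lintegral_auxMeasure_eq_sum hj x₀ hc hP hι hκ hG

/-! ### The flag measure of a convex body -/

lemma sum_faceIntegral_indicator {P : ConvexBody (E d)} (hP : P ∈ polytopes d)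
    (A : Set (FlagManifold d (d - j))) :
    ∑ F ∈ (finite_faces (j := j) hP).toFinset, faceIntegral (P : Set (E d)) (A.indicator 1) F =
      flagMeasureValue j (P : Set (E d)) A := by
  rw [flagMeasureValue, finsum_mem_eq_finite_toFinset_sum _ (finite_faces hP)]
  rfl

/-- `auxMeasure` as a finite measure. -/
def auxFiniteMeasure (x₀ : FlagManifold d (d - j)) (K : ConvexBody (E d)) :
    FiniteMeasure (FlagManifold d (d - j)) := ⟨auxMeasure x₀ K, isFiniteMeasure_auxMeasure x₀ K⟩

lemma continuous_auxFiniteMeasure (hj1 : 1 ≤ j) (x₀ : FlagManifold d (d - j)) :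
    Continuous (auxFiniteMeasure x₀) := by
  refine continuous_iff_seqContinuous.2 fun K K₀ hK => ?_
  refine FiniteMeasure.tendsto_iff_forall_integral_tendsto.2 fun f => ?_
  exact tendsto_integral_auxMeasure hj1 x₀ hK f.continuous fun x => f.norm_coe_le_norm x

/-- Existence of the flag measures of convex bodies, as multiples of the auxiliary measures. -/
theorem exists_flagMeasure (hj1 : 1 ≤ j) (hj : j + 2 ≤ d) :
    ∃ ψ : ConvexBody (E d) → FiniteMeasure (FlagManifold d (d - j)), Continuous ψ ∧
      (∀ {K M U I : ConvexBody (E d)}, (U : Set (E d)) = (K : Set (E d)) ∪ (M : Set (E d)) →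
        (I : Set (E d)) = (K : Set (E d)) ∩ (M : Set (E d)) → ψ U + ψ I = ψ K + ψ M) ∧
      ∀ {P : ConvexBody (E d)} (hP : P ∈ polytopes d) {G : FlagManifold d (d - j) → ENNReal},
        Measurable G → ∫⁻ x, G x ∂(ψ P : Measure (FlagManifold d (d - j))) =
          ∑ F ∈ (finite_faces (j := j) hP).toFinset, faceIntegral (P : Set (E d)) G F := by
  obtain ⟨x₀⟩ := nonempty_flag (d := d) (j := j) (by omega)
  obtain ⟨C, hC0, hCt, hC⟩ := exists_lintegral_auxMeasure_eq hj x₀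
  have hc : ((C.toNNReal⁻¹ : NNReal) : ENNReal) = C⁻¹ := by
    rw [ENNReal.coe_inv (ENNReal.toNNReal_ne_zero.2 ⟨hC0, hCt⟩), ENNReal.coe_toNNReal hCt]
  refine ⟨fun K => C.toNNReal⁻¹ • auxFiniteMeasure x₀ K,
    (continuous_const_smul _).comp (continuous_auxFiniteMeasure hj1 x₀), fun {K M U I} hU hI => ?_,
    fun {P} hP {G} hG => ?_⟩
  · beta_reduce
    rw [← smul_add, ← smul_add]
    congr 1
    exact Subtype.ext (auxMeasure_union_add_inter x₀ hU hI)
  · change ∫⁻ x, G x ∂(((C.toNNReal⁻¹ : NNReal) : ENNReal) • auxMeasure x₀ P) = _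
    rw [lintegral_smul_measure, hC hP hG, hc, smul_eq_mul, ← mul_assoc,
      ENNReal.inv_mul_cancel hC0 hCt, one_mul]

lemma eq_of_isContinuousFlagMeasure
    {ψ ψ' : ConvexBody (E d) → FiniteMeasure (FlagManifold d (d - j))}
    (h : IsContinuousFlagMeasure j ψ) (h' : IsContinuousFlagMeasure j ψ') : ψ = ψ' :=
  h.1.ext_on (dense_polytopes d) h'.1 fun P hP =>
    FiniteMeasure.eq_of_forall_toMeasure_apply_eq _ _ fun A hA => by
      rw [h.2 P hP A hA, h'.2 P hP A hA]

/-! ### Spherical images of faces -/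

/-- Near the exposing vector of a face, the normal cone fills the normal space. -/
lemma eventually_mem_normalCone {P : ConvexBody (E d)} (hP : P ∈ polytopes d) {u v : E d}
    (hv : v ∈ (vectorSpan ℝ (faceIn P u))ᗮ) :
    ∀ᶠ t : ℝ in 𝓝[>] 0, u + t • v ∈ normalCone (P : Set (E d)) (faceIn P u) := by
  obtain ⟨s, hs⟩ := hP
  obtain ⟨x₀, hx₀⟩ := faceIn_nonempty P u
  have hconst : ∀ x ∈ faceIn P u, inner ℝ v x = inner ℝ v x₀ := fun x hx => by
    have h := (Submodule.mem_orthogonal' _ _).1 hv _ (vsub_mem_vectorSpan ℝ hx hx₀)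
    rw [vsub_eq_sub, inner_sub_right, sub_eq_zero] at h
    exact h
  have hev : ∀ᶠ t : ℝ in 𝓝[>] 0, ∀ z ∈ s,
      inner ℝ (u + t • v) z ≤ supp P u + t * inner ℝ v x₀ := by
    rw [Finset.eventually_all]
    intro z hz
    have hzP : z ∈ (P : Set (E d)) := hs ▸ subset_convexHull ℝ _ hz
    by_cases hzF : z ∈ faceIn P u
    · refine Filter.Eventually.of_forall fun t => ?_
      rw [inner_add_left, hzF.2, real_inner_smul_left, hconst z hzF]
    · have h1 : inner ℝ u z < supp P u := lt_of_le_of_ne (le_supp P u hzP) fun h => hzF ⟨hzP, h⟩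
      have hc : Tendsto (fun t : ℝ => inner ℝ (u + t • v) z - t * inner ℝ v x₀) (𝓝 0)
          (𝓝 (inner ℝ u z)) := by
        have : Continuous fun t : ℝ => inner ℝ (u + t • v) z - t * inner ℝ v x₀ := by fun_prop
        simpa using this.tendsto 0
      refine ((hc.mono_left nhdsWithin_le_nhds).eventually (gt_mem_nhds h1)).mono fun t ht => ?_
      linarith
  refine hev.mono fun t ht x hx y hy => ?_
  have hcvx : Convex ℝ {y : E d | inner ℝ (u + t • v) y ≤ supp P u + t * inner ℝ v x₀} :=
    convex_halfSpace_le (innerₛₗ ℝ (u + t • v)).isLinear _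
  have hy' : inner ℝ (u + t • v) y ≤ supp P u + t * inner ℝ v x₀ := by
    rw [hs] at hy
    exact convexHull_min (fun z hz => ht z hz) hcvx hy
  have hx' : inner ℝ (u + t • v) x = supp P u + t * inner ℝ v x₀ := by
    rw [inner_add_left, hx.2, real_inner_smul_left, hconst x hx]
  rw [inner_sub_right, hx']
  linarith

lemma span_sphericalNormals {P : ConvexBody (E d)} (hP : P ∈ polytopes d) {F : Set (E d)}
    (hF : F ∈ faces j (P : Set (E d))) :
    Submodule.span ℝ (sphericalNormals (P : Set (E d)) F) = (vectorSpan ℝ F)ᗮ := by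
  obtain ⟨u, rfl⟩ := exists_eq_faceIn hF.2.1 hF.1
  refine le_antisymm (Submodule.span_le.2 fun v hv =>
    normalCone_subset_orthogonal (faceIn_subset P u) hv.2) fun v hv => ?_
  have hcone : ∀ w ∈ normalCone (P : Set (E d)) (faceIn P u),
      w ∈ Submodule.span ℝ (sphericalNormals (P : Set (E d)) (faceIn P u)) := fun w hw => by
    by_cases h0 : w = 0
    · rw [h0]; exact Submodule.zero_mem _
    · have hw0 : 0 < ‖w‖ := norm_pos_iff.2 h0
      have h1 : ‖w‖⁻¹ • w ∈ sphericalNormals (P : Set (E d)) (faceIn P u) :=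
        ⟨by rw [norm_smul, norm_inv, norm_norm, inv_mul_cancel₀ hw0.ne'],
          (smul_mem_normalCone_iff (inv_pos.2 hw0)).2 hw⟩
      have h2 := Submodule.smul_mem _ ‖w‖ (Submodule.subset_span (R := ℝ) h1)
      rwa [smul_smul, mul_inv_cancel₀ hw0.ne', one_smul] at h2
  obtain ⟨t, ht, ht0⟩ := ((eventually_mem_normalCone hP hv).and self_mem_nhdsWithin).exists
  have ht0 : 0 < t := ht0
  have hu := hcone u ((mem_normalCone_iff (faceIn_subset P u)).2 (Set.Subset.refl _))
  have h3 := Submodule.smul_mem _ t⁻¹ (Submodule.sub_mem _ (hcone _ ht) hu)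
  rwa [add_sub_cancel_left, smul_smul, inv_mul_cancel₀ ht0.ne', one_smul] at h3

lemma finrank_orthogonal_vectorSpan {P F : Set (E d)} (hF : F ∈ faces j P) :
    Module.finrank ℝ (vectorSpan ℝ F)ᗮ = d - j := by
  have := (vectorSpan ℝ F).finrank_add_finrank_orthogonal
  rw [hF.2.2, finrank_euclideanSpace_fin] at this
  omega

lemma isSphericalPolytope_sphericalNormals (hj : j + 2 ≤ d) {P : ConvexBody (E d)}
    (hP : P ∈ polytopes d) {F : Set (E d)} (hF : F ∈ faces j (P : Set (E d))) :
    IsSphericalPolytope (d - 1 - j) (sphericalNormals (P : Set (E d)) F) := by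
  classical
  refine ⟨?_, by rw [span_sphericalNormals hP hF, finrank_orthogonal_vectorSpan hF]; omega⟩
  obtain ⟨s, hs⟩ := hP
  obtain ⟨u₀, hu₀⟩ := exists_eq_faceIn hF.2.1 hF.1
  have hFs : F = convexHull ℝ ((s : Set (E d)) ∩ F) := by
    rw [hu₀]; exact faceIn_eq_convexHull hs u₀
  refine ⟨(s ×ˢ s.filter (· ∈ F)).image fun p => p.1 - p.2, ?_⟩
  ext u
  refine and_congr_right fun _ => ⟨fun h a ha => ?_, fun h x hx y hy => ?_⟩
  · obtain ⟨⟨y, x⟩, hp, rfl⟩ := Finset.mem_image.1 ha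
    rw [Finset.mem_product, Finset.mem_filter] at hp
    rw [real_inner_comm]
    exact h x hp.2.2 y (hs ▸ subset_convexHull ℝ _ hp.1)
  · have h1 : ∀ x ∈ F, ∀ y ∈ s, inner ℝ u y ≤ inner ℝ u x := fun x hx y hy => by
      have hcvx : Convex ℝ {x : E d | inner ℝ u y ≤ inner ℝ u x} :=
        convex_halfSpace_ge (innerₛₗ ℝ u).isLinear _
      rw [hFs] at hx
      refine convexHull_min (fun z hz => ?_) hcvx hx
      have h2 := h (y - z) (Finset.mem_image.2 ⟨(y, z), Finset.mem_product.2 ⟨hy,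
        Finset.mem_filter.2 hz⟩, rfl⟩)
      rw [real_inner_comm, inner_sub_right, sub_nonpos] at h2
      exact h2
    have hcvx : Convex ℝ {y : E d | inner ℝ u y ≤ inner ℝ u x} :=
      convex_halfSpace_le (innerₛₗ ℝ u).isLinear _
    rw [inner_sub_right, sub_nonpos]
    rw [hs] at hy
    exact convexHull_min (fun z hz => h1 x hx z hz) hcvx hy

lemma isClosed_sphericalNormals (P F : Set (E d)) : IsClosed (sphericalNormals P F) := by
  have : sphericalNormals P F = {u | ‖u‖ = 1} ∩ normalCone P F := rfl
  rw [this]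
  exact (isClosed_eq continuous_norm continuous_const).inter (isClosed_normalCone P F)

lemma measure_sphericalNormals_ne_top (hj : j + 2 ≤ d) {P : ConvexBody (E d)} {F : Set (E d)}
    (hF : F ∈ faces j (P : Set (E d))) :
    (μHE[d - 1 - j] : Measure (E d)) (sphericalNormals (P : Set (E d)) F) ≠ ⊤ := by
  obtain ⟨κ, hκ⟩ := exists_isometry_range_eq (q := d - 1 - j + 1) (vectorSpan ℝ F)ᗮ (by
    rw [finrank_orthogonal_vectorSpan hF]; omega)
  refine ne_top_of_le_ne_top (euclideanHausdorffMeasure_sphere_ne_top (d - 1 - j)) ?_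
  rw [← κ.isometry.euclideanHausdorffMeasure_image]
  refine measure_mono fun u hu => ?_
  have h1 : u ∈ LinearMap.range κ.toLinearMap :=
    hκ ▸ normalCone_subset_orthogonal hF.2.1.subset hu.2
  obtain ⟨v, rfl⟩ := h1
  exact ⟨v, by simpa using hu.1, rfl⟩

/-! ### Strongly flag-continuous valuations as integrals -/

lemma integrable_absDet_sq_mul (hj : j ≤ d) {g : FlagManifold d (d - j) → ℝ} (hg : Continuous g)
    (x : FlagManifold d (d - j)) :
    Integrable (fun y => absDet x y ^ 2 * g y) (fibreMeasure x) := by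
  have := compactSpace_flag hj
  have hc : Continuous fun y => absDet x y ^ 2 * g y := by
    simp only [absDet_comm x]
    exact (continuous_absDet_sq x).mul hg
  exact (BoundedContinuousFunction.mkOfCompact ⟨_, hc⟩).integrable _

lemma lflagTransform_ofReal (hj : j ≤ d) {g : FlagManifold d (d - j) → ℝ} (hg : Continuous g)
    (hg0 : ∀ y, 0 ≤ g y) (x : FlagManifold d (d - j)) :
    lflagTransform (fun y => ENNReal.ofReal (g y)) x = ENNReal.ofReal (flagTransform g x) := by
  rw [flagTransform, ofReal_integral_eq_lintegral_ofReal (integrable_absDet_sq_mul hj hg x)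
    (Filter.Eventually.of_forall fun y => mul_nonneg (sq_nonneg _) (hg0 y)), lflagTransform]
  refine lintegral_congr fun y => ?_
  rw [absDet_comm, ENNReal.ofReal_mul (sq_nonneg _)]

/-- The transform of a function of arbitrary sign, in terms of transforms of nonnegative
functions. -/
lemma ofReal_flagTransform_add (hj : j ≤ d) {g : FlagManifold d (d - j) → ℝ} (hg : Continuous g)
    {M : ℝ} (hM : 0 ≤ M) (hgM : ∀ y, 0 ≤ g y + M) (x : FlagManifold d (d - j)) :
    ENNReal.ofReal (flagTransform g x) + lflagTransform (fun _ => ENNReal.ofReal M) x =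
      ENNReal.ofReal (-flagTransform g x) +
        lflagTransform (fun y => ENNReal.ofReal (g y + M)) x := by
  have hconst : Continuous fun _ : FlagManifold d (d - j) => M := continuous_const
  have hgMc : Continuous fun y => g y + M := hg.add hconst
  rw [lflagTransform_ofReal hj hconst (fun _ => hM), lflagTransform_ofReal hj hgMc hgM]
  have hadd : flagTransform (fun y => g y + M) x =
      flagTransform g x + flagTransform (fun _ => M) x := by
    rw [flagTransform, flagTransform, flagTransform, ← integral_add
      (integrable_absDet_sq_mul hj hg x) (integrable_absDet_sq_mul hj hconst x)]
    simp only [mul_add]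
  have h1 : 0 ≤ flagTransform (fun _ => M) x :=
    integral_nonneg fun y => mul_nonneg (sq_nonneg _) hM
  have h2 : 0 ≤ flagTransform (fun y => g y + M) x :=
    integral_nonneg fun y => mul_nonneg (sq_nonneg _) (hgM y)
  rw [hadd] at h2 ⊢
  rcases le_total 0 (flagTransform g x) with h | h
  · rw [ENNReal.ofReal_of_nonpos (neg_nonpos.2 h), zero_add, ENNReal.ofReal_add h h1]
  · rw [ENNReal.ofReal_of_nonpos h, zero_add, ← ENNReal.ofReal_add (neg_nonneg.2 h) h2,
      neg_add_cancel_left]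

lemma eval_of_mem {α : Type*} [Zero α] (h : FlagManifold d q → α) {u : E d}
    {L : Submodule ℝ (E d)} (hu : ‖u‖ = 1) (hL : Module.finrank ℝ L = q) (hm : u ∈ L) :
    FlagManifold.eval h u L = h ⟨u, L, hu, hL, hm⟩ := dif_pos ⟨hu, hL, hm⟩

lemma measurable_eval {h : FlagManifold d q → ℝ} (hh : Continuous h) {L : Submodule ℝ (E d)}
    (hL : Module.finrank ℝ L = q) : Measurable fun u => FlagManifold.eval h u L := by
  classical
  let S : Set (E d) := {u | ‖u‖ = 1 ∧ u ∈ L}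
  have hS : IsClosed S := (isClosed_eq continuous_norm continuous_const).inter
    L.closed_of_finiteDimensional
  have hcont : ContinuousOn (fun u => FlagManifold.eval h u L) S := by
    rw [continuousOn_iff_continuous_domRestrict]
    have h1 : Continuous fun u : S => (⟨u, L, u.2.1, hL, u.2.2⟩ : FlagManifold d q) :=
      continuous_induced_rng.2 (continuous_subtype_val.prodMk
        (continuous_const (y := L.starProjection)))
    refine (hh.comp h1).congr fun u => ?_
    exact (eval_of_mem h u.2.1 hL u.2.2).symm
  have hpw : (fun u => FlagManifold.eval h u L) =
      S.piecewise (fun u => FlagManifold.eval h u L) fun _ => 0 := by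
    ext1 u
    by_cases hu : u ∈ S
    · rw [Set.piecewise_eq_of_mem _ _ _ hu]
    · rw [Set.piecewise_eq_of_notMem _ _ _ hu]
      exact dif_neg fun h => hu ⟨h.1, h.2.2⟩
  rw [hpw]
  exact hcont.measurable_piecewise continuousOn_const hS.measurableSet

lemma abs_eval_le {h : FlagManifold d q → ℝ} {B : ℝ} (hB0 : 0 ≤ B) (hB : ∀ x, |h x| ≤ B)
    (u : E d) (L : Submodule ℝ (E d)) : |FlagManifold.eval h u L| ≤ B := by
  rw [FlagManifold.eval]
  split_ifs
  · exact hB _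
  · simpa using hB0

/-- The volume of a face times the integral of the positive part of `h` over the spherical image of
the face. -/
def facePart (P : Set (E d)) (j : ℕ) (h : E d → Submodule ℝ (E d) → ℝ) (F : Set (E d)) : ENNReal :=
  μHE[j] F * ∫⁻ u in sphericalNormals P F,
    ENNReal.ofReal (h u (vectorSpan ℝ F)ᗮ) ∂μHE[d - 1 - j]

lemma facePart_ne_top (hj : j + 2 ≤ d) {P : ConvexBody (E d)} {F : Set (E d)}
    (hF : F ∈ faces j (P : Set (E d))) {h : E d → Submodule ℝ (E d) → ℝ} {B : ℝ}
    (hB : ∀ u L, |h u L| ≤ B) : facePart (P : Set (E d)) j h F ≠ ⊤ := by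
  refine ENNReal.mul_ne_top (euclideanHausdorffMeasure_face_ne_top hF) ?_
  have hle : ∫⁻ u in sphericalNormals (P : Set (E d)) F,
      ENNReal.ofReal (h u (vectorSpan ℝ F)ᗮ) ∂μHE[d - 1 - j] ≤
      ∫⁻ _ in sphericalNormals (P : Set (E d)) F, ENNReal.ofReal B ∂μHE[d - 1 - j] :=
    lintegral_mono fun u => ENNReal.ofReal_le_ofReal ((le_abs_self _).trans (hB u _))
  rw [setLIntegral_const] at hle
  exact ne_top_of_le_ne_top
    (ENNReal.mul_ne_top ENNReal.ofReal_ne_top (measure_sphericalNormals_ne_top hj hF)) hle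

lemma facePart_add_faceIntegral (hj : j + 2 ≤ d) {P : ConvexBody (E d)}
    {F : Set (E d)} (hF : F ∈ faces j (P : Set (E d))) {g h : FlagManifold d (d - j) → ℝ}
    (hg : Continuous g) (hh : Continuous h) (hgh : ∀ x, h x = flagTransform g x)
    {M : ℝ} (hM : 0 ≤ M) (hgM : ∀ y, 0 ≤ g y + M) :
    facePart (P : Set (E d)) j (FlagManifold.eval h) F +
        faceIntegral (P : Set (E d)) (fun _ : FlagManifold d (d - j) => ENNReal.ofReal M) F =
      facePart (P : Set (E d)) j (fun u L => -FlagManifold.eval h u L) F +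
        faceIntegral (P : Set (E d)) (fun y : FlagManifold d (d - j) =>
          ENNReal.ofReal (g y + M)) F := by
  have hL := finrank_orthogonal_vectorSpan hF
  have hm := measurable_eval hh hL
  have hm' : Measurable fun u => -FlagManifold.eval h u (vectorSpan ℝ F)ᗮ := hm.neg
  rw [facePart, facePart, faceIntegral, faceIntegral, ← mul_add, ← mul_add,
    ← lintegral_add_left hm.ennreal_ofReal, ← lintegral_add_left hm'.ennreal_ofReal]
  congr 1
  refine setLIntegral_congr_fun (isClosed_sphericalNormals _ _).measurableSet fun u hu => ?_
  have hmem : u ∈ (vectorSpan ℝ F)ᗮ := normalCone_subset_orthogonal hF.2.1.subset hu.2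
  simp only [eval_of_mem _ hu.1 hL hmem, hgh]
  exact ofReal_flagTransform_add (by omega) hg hM hgM _

lemma faceVolume_mul_integral (hj : j + 2 ≤ d) {P : ConvexBody (E d)}
    {F : Set (E d)} (hF : F ∈ faces j (P : Set (E d))) {h : FlagManifold d (d - j) → ℝ}
    (hh : Continuous h) {B : ℝ} (hB0 : 0 ≤ B) (hB : ∀ x, |h x| ≤ B) :
    (∫ u in sphericalNormals (P : Set (E d)) F,
        FlagManifold.eval h u (vectorSpan ℝ F)ᗮ ∂μHE[d - 1 - j]) * faceVolume j F =
      (facePart (P : Set (E d)) j (FlagManifold.eval h) F).toReal -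
        (facePart (P : Set (E d)) j (fun u L => -FlagManifold.eval h u L) F).toReal := by
  have hm := measurable_eval hh (finrank_orthogonal_vectorSpan hF)
  have hint : Integrable (fun u => FlagManifold.eval h u (vectorSpan ℝ F)ᗮ)
      ((μHE[d - 1 - j] : Measure (E d)).restrict (sphericalNormals (P : Set (E d)) F)) :=
    Measure.integrableOn_of_bounded (measure_sphericalNormals_ne_top hj hF)
      hm.aestronglyMeasurable
      (Filter.Eventually.of_forall fun u => abs_eval_le hB0 hB u (vectorSpan ℝ F)ᗮ)
  rw [integral_eq_lintegral_pos_part_sub_lintegral_neg_part hint, facePart, facePart,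
    ENNReal.toReal_mul, ENNReal.toReal_mul, faceVolume]
  ring

/-- A strongly flag-continuous functional is an integral with respect to the flag measures. -/
lemma eq_integral_of_isStronglyFlagContinuousWith (hj : j + 2 ≤ d) {φ : polytopes d → ℝ}
    {g : C(FlagManifold d (d - j), ℝ)} (hg : IsStronglyFlagContinuousWith j φ g)
    (P : polytopes d) {μ : Measure (FlagManifold d (d - j))} [IsFiniteMeasure μ]
    (hμ : ∀ {G : FlagManifold d (d - j) → ENNReal}, Measurable G → ∫⁻ x, G x ∂μ =
      ∑ F ∈ (finite_faces (j := j) P.2).toFinset, faceIntegral (P.1 : Set (E d)) G F) :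
    φ P = ∫ x, g x ∂μ := by
  obtain ⟨h, hgh, f, hf, hfp⟩ := hg
  have := compactSpace_flag (d := d) (j := j) (by omega)
  set M : ℝ := ‖g‖
  have hM : 0 ≤ M := norm_nonneg g
  have hgM : ∀ y, 0 ≤ g y + M := fun y => by
    have h1 := g.norm_coe_le_norm y
    rw [Real.norm_eq_abs] at h1
    linarith [neg_abs_le (g y)]
  have hB : ∀ x, |h x| ≤ ‖h‖ := fun x => h.norm_coe_le_norm x
  have hB' : ∀ u L, |FlagManifold.eval h u L| ≤ ‖h‖ := abs_eval_le (norm_nonneg h) hB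
  have hterm : ∀ F ∈ (finite_faces (j := j) P.2).toFinset,
      f (sphericalNormals (P.1 : Set (E d)) F) * faceVolume j F =
        (facePart (P.1 : Set (E d)) j (FlagManifold.eval h) F).toReal -
          (facePart (P.1 : Set (E d)) j (fun u L => -FlagManifold.eval h u L) F).toReal := by
    intro F hF
    have hF := (Set.Finite.mem_toFinset _).1 hF
    have hspan := span_sphericalNormals P.2 hF
    rw [(hfp _ (isSphericalPolytope_sphericalNormals hj P.2 hF)).1
      (by rw [hspan, finrank_orthogonal_vectorSpan hF]), hspan]
    exact faceVolume_mul_integral hj hF h.continuous (norm_nonneg h) hB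
  have hp : ∀ F ∈ (finite_faces (j := j) P.2).toFinset,
      facePart (P.1 : Set (E d)) j (FlagManifold.eval h) F ≠ ⊤ := fun F hF =>
    facePart_ne_top hj ((Set.Finite.mem_toFinset _).1 hF) hB'
  have hn : ∀ F ∈ (finite_faces (j := j) P.2).toFinset,
      facePart (P.1 : Set (E d)) j (fun u L => -FlagManifold.eval h u L) F ≠ ⊤ := fun F hF =>
    facePart_ne_top hj ((Set.Finite.mem_toFinset _).1 hF) (B := ‖h‖) fun u L => by
      rw [abs_neg]; exact hB' u L
  have hsum := Finset.sum_congr rfl fun F hF =>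
    facePart_add_faceIntegral hj ((Set.Finite.mem_toFinset (finite_faces (j := j) P.2)).1 hF)
      g.continuous h.continuous hgh hM hgM
  have hgm : Measurable fun y : FlagManifold d (d - j) => ENNReal.ofReal (g y + M) :=
    (g.continuous.add continuous_const).measurable.ennreal_ofReal
  rw [Finset.sum_add_distrib, Finset.sum_add_distrib, ← hμ measurable_const, ← hμ hgm] at hsum
  have hintg : Integrable (fun x => g x) μ :=
    (BoundedContinuousFunction.mkOfCompact g).integrable μ
  have hintM : Integrable (fun x => g x + M) μ := hintg.add (integrable_const M)
  rw [← ofReal_integral_eq_lintegral_ofReal (integrable_const M)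
      (Filter.Eventually.of_forall fun _ => hM),
    ← ofReal_integral_eq_lintegral_ofReal hintM (Filter.Eventually.of_forall hgM)] at hsum
  have hreal := congrArg ENNReal.toReal hsum
  rw [ENNReal.toReal_add (ENNReal.sum_ne_top.2 hp) ENNReal.ofReal_ne_top,
    ENNReal.toReal_add (ENNReal.sum_ne_top.2 hn) ENNReal.ofReal_ne_top,
    ENNReal.toReal_ofReal (integral_nonneg fun _ => hM),
    ENNReal.toReal_ofReal (integral_nonneg hgM),
    integral_add hintg (integrable_const M), ENNReal.toReal_sum hp, ENNReal.toReal_sum hn] at hreal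
  rw [hf.eq_sum, finsum_mem_eq_finite_toFinset_sum _ (finite_faces P.2),
    Finset.sum_congr rfl hterm, Finset.sum_sub_distrib]
  linarith

end FlagVal

end

open FlagVal MeasureTheory in
theorem theorem4p1 (d j : ℕ) (hj1 : 1 ≤ j) (hj2 : j + 2 ≤ d)
    (φ : polytopes d → ℝ)
    (hval : IsValuationOn (polytopes d) φ)
    (htrans : IsTranslationInvariantOn (polytopes d) φ)
    (hhom : IsHomogeneousOn j (polytopes d) φ)
    (g : C(FlagManifold d (d - j), ℝ))
    (hg : IsStronglyFlagContinuousWith j φ g) :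
    (∃! Φ : ConvexBody (E d) → ℝ, IsContinuousExtension φ Φ) ∧
    (∃! ψ : ConvexBody (E d) → FiniteMeasure (FlagManifold d (d - j)),
      IsContinuousFlagMeasure j ψ) ∧
    (∀ Φ : ConvexBody (E d) → ℝ, IsContinuousExtension φ Φ →
      IsValuationOn Set.univ (fun K => Φ K.1) ∧
      IsTranslationInvariantOn Set.univ (fun K => Φ K.1) ∧
      ∀ ψ : ConvexBody (E d) → FiniteMeasure (FlagManifold d (d - j)),
        IsContinuousFlagMeasure j ψ →
          ∀ K : ConvexBody (E d),
            Φ K = ∫ x, g x ∂(ψ K : Measure (FlagManifold d (d - j)))) := by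
  obtain ⟨ψ₀, hψc, hψval, hψP⟩ := exists_flagMeasure (d := d) hj1 hj2
  have hcpt := compactSpace_flag (d := d) (j := j) (by omega)
  have hψ₀ : IsContinuousFlagMeasure j ψ₀ := ⟨hψc, fun P hP A hA => by
    rw [← lintegral_indicator_one hA, hψP hP (measurable_one.indicator hA),
      sum_faceIntegral_indicator hP]⟩
  have hΦ₀ : IsContinuousExtension φ
      fun K => ∫ x, g x ∂(ψ₀ K : Measure (FlagManifold d (d - j))) := by
    refine ⟨continuous_iff_continuousAt.2 fun K => ?_, fun P => ?_⟩
    · exact FiniteMeasure.tendsto_iff_forall_integral_tendsto.1 (hψc.tendsto K)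
        (BoundedContinuousFunction.mkOfCompact g)
    · exact (eq_integral_of_isStronglyFlagContinuousWith hj2 hg P fun hG => hψP P.2 hG).symm
  have hunique : ∀ Φ Φ' : ConvexBody (E d) → ℝ, IsContinuousExtension φ Φ →
      IsContinuousExtension φ Φ' → Φ = Φ' := fun Φ Φ' h h' =>
    h.1.ext_on (dense_polytopes d) h'.1 fun P hP => (h.2 ⟨P, hP⟩).trans (h'.2 ⟨P, hP⟩).symm
  refine ⟨⟨_, hΦ₀, fun Φ h => hunique _ _ h hΦ₀⟩,
    ⟨ψ₀, hψ₀, fun ψ h => eq_of_isContinuousFlagMeasure h hψ₀⟩, fun Φ hΦ => ?_⟩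
  obtain rfl := hunique _ _ hΦ hΦ₀
  refine ⟨fun K M U I hU hI => ?_, fun K M x hM => ?_, fun ψ hψ K => ?_⟩
  · have hint : ∀ K, Integrable (fun x => g x) (ψ₀ K : Measure (FlagManifold d (d - j))) :=
      fun K => (BoundedContinuousFunction.mkOfCompact g).integrable _
    have h := congrArg (fun μ : FiniteMeasure (FlagManifold d (d - j)) =>
      ∫ x, g x ∂(μ : Measure (FlagManifold d (d - j)))) (hψval hU hI)
    simpa only [FiniteMeasure.toMeasure_add, integral_add_measure (hint _) (hint _)] using h
  · -- Translation invariance extends from polytopes by density.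
    have htr : IsContinuousExtension φ fun K =>
        ∫ x, g x ∂(ψ₀ (translate x K) : Measure (FlagManifold d (d - j))) :=
      ⟨hΦ.1.comp (continuous_translate x), fun P =>
        (hΦ.2 ⟨_, translate_mem_polytopes x P.2⟩).trans (htrans _ _ x rfl)⟩
    have hMK : M.1 = translate x K.1 := SetLike.ext' hM
    beta_reduce
    rw [hMK]
    exact congrFun (hunique _ _ htr hΦ) K.1
  · rw [eq_of_isContinuousFlagMeasure hψ hψ₀]
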